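/- Let $d\ge 2$, let $\Theta=\{\mathbf w\in\mathbb R^d:\|\mathbf w\|=1\}$ (Euclidean norm), and let $\lambda$ be surface area on $\Theta$. Let $\mathbf X_1,\mathbf X_2,\dots$ be i.i.d. random vectors in $\mathbb R^d$ with common law $P$, and put $R_i=\|\mathbf X_i\|$, $\mathbf W_i=\mathbf X_i/\|\mathbf X_i\|$; $R_{1:n}\le\dots\le R_{n:n}$ are the order statistics of $R_1,\dots,R_n$. Let $H(s)=P(\|\mathbf z\|\le s)$ and $U(t)=H^{-1}(1-1/t)$, where $H^{-1}$ is the generalized inverse. Assume: (a) $P$ has a continuous and positive density $f$, and for some positive function $q$ on $\mathbb R^d\setminus\{\mathbf 0\}$ and some positive function $V$ on $(0,\infty)$ that is regularly varying at infinity with index $-\alpha$, $\alpha>0$, $$\lim_{t\to\infty}\frac{f(t\mathbf z)}{t^{-d}V(t)}=q(\mathbf z)\ \text{ for all }\mathbf z\ne\mathbf 0,\qquad \lim_{t\to\infty}\sup_{\mathbf z\in\Theta}\Bigl|\frac{f(t\mathbf z)}{t^{-d}V(t)}-q(\mathbf z)\Bigr|=0;$$ (b) $k=k_n<n$ is a sequence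 of positive integers with $k\to\infty$ and $k/n\to0$; (c) $\lim_{t\to\infty}U(t)/t^{1/\alpha}=c$ for some $c\in(0,\infty)$. Let $p=p_n>0$ with $p\to0$, and let $\beta_n$ be such that the extreme risk region $Q_n=\{\mathbf z:f(\mathbf z)\le\beta_n\}$ has $P(Q_n)=p_n$. Let $\widehat\alpha=\widehat\alpha_n$ be an estimator of $\alpha$ with $\sqrt k(\widehat\alpha-\alpha)=O_{\mathbb P}(1)$. Let $K:[0,1]\to[0,1]$ be continuous and nonincreasing with $K(0)=1$, $K(1)=0$, set $K(u)=0$ for $u>1$, and let $h=h_n\in(0,1)$. Put $C_{\mathbf w}(h)=\{\mathbf v\in\Theta:\mathbf w^T\mathbf v\ge1-h\}$, $$c(h,K)=\Bigl(\int_{C_{\mathbf w}(h)}K\Bigl(\frac{1-\mathbf v^T\mathbf w}{h}\Bigr)\,d\lambda(\mathbf v)\Bigr)^{-1}$$ (which does not depend on $\mathbf w\in\Theta$), $$\widehat\psi_n(\mathbf w)=\frac{c(h,K)}{k}\sum_{i=1}^nK\Bigl(\frac{1-\mathbf w^T\mathbf W_i}{h}\Bigr)1_{[R_i>R_{n-k:n}]},$$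 $$\widehat S=\bigl\{r\mathbf w:\ r\ge(\widehat\alpha\,\widehat\psi_n(\mathbf w))^{1/(\widehat\alpha+d)},\ \mathbf w\in\Theta\bigr\},\qquad \widehat{\nu(S)}=\widehat\alpha^{-\widehat\alpha/(\widehat\alpha+d)}\int_\Theta\widehat\psi_n(\mathbf w)^{d/(\widehat\alpha+d)}\,d\lambda(\mathbf w),$$ and define the estimated extreme risk region $$\widehat Q_n=R_{n-k:n}\Bigl(\frac{k\,\widehat{\nu(S)}}{np}\Bigr)^{1/\widehat\alpha}\,\widehat S.$$ If in addition $(\log np)/\sqrt k\to0$, $h\to0$ and $k/(c(h,K)\log k)\to\infty$ as $n\to\infty$, then, with $\triangle$ the symmetric difference, $$\frac{P(\widehat Q_n\triangle Q_n)}{p}\xrightarrow{\ \mathbb P\ }0\quad\text{as }n\to\infty,\qquad\text{and hence}\qquad\frac{P(\widehat Q_n)}{p}\xrightarrow{\ \mathbb P\ }1.$$ -/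

import Mathlib

open MeasureTheory ProbabilityTheory Filter Set Metric
open scoped Topology Pointwise symmDiff RealInnerProductSpace

noncomputable section

namespace ExtremeRisk

/-- `ℝ^d` with the Euclidean norm. -/
abbrev E (d : ℕ) := EuclideanSpace ℝ (Fin d)

/-- The unit hypersphere `Θ = {w : ‖w‖ = 1}` of `ℝ^d`. -/
abbrev Theta (d : ℕ) := sphere (0 : E d) 1

/-- Surface area `λ` on `Θ`, i.e. `λ(A) = d · vol {r w : 0 < r < 1, w ∈ A}`. This is the
`(d-1)`-dimensional Hausdorff measure in its usual normalization, for which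
`∫ g(z) dz = ∫₀^∞ ∫_Θ g(r w) dλ(w) r^{d-1} dr`. -/
def surf (d : ℕ) : Measure (Theta d) := (volume : Measure (E d)).toSphere

/-! ### The model -/

/-- `V`, a function on `(0, ∞)`, is (Lebesgue measurable, positive and) regularly varying at
infinity with index `ρ`. -/
structure RegularlyVarying (V : ℝ → ℝ) (ρ : ℝ) : Prop where
  aemeasurable : AEMeasurable V (volume.restrict (Ioi 0))
  pos : ∀ t, 0 < t → 0 < V t
  tendsto : ∀ x, 0 < x → Tendsto (fun t => V (t * x) / V t) atTop (𝓝 (x ^ ρ))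

/-- Multivariate regular variation of `P` at the density level, with index `α`: `P` has a
continuous positive density `f`, and `f(t z) / (t^{-d} V(t)) → q(z)` for every `z ≠ 0`, uniformly
on the unit sphere, where `q` is positive on `ℝ^d \ {0}` and `V` is regularly varying with
index `-α`, `α > 0`. -/
structure RegularlyVaryingDensity {d : ℕ} (P : Measure (E d)) (f q : E d → ℝ) (V : ℝ → ℝ)
    (α : ℝ) : Prop where
  alpha_pos : 0 < α
  density : P = volume.withDensity (fun z => ENNReal.ofReal (f z))
  continuous : Continuous f
  pos : ∀ z, 0 < f z
  q_pos : ∀ z, z ≠ 0 → 0 < q z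
  regVar : RegularlyVarying V (-α)
  tendsto : ∀ z, z ≠ 0 →
    Tendsto (fun t : ℝ => f (t • z) / (t ^ (-(d : ℝ)) * V t)) atTop (𝓝 (q z))
  tendstoUniformlyOn :
    TendstoUniformlyOn (fun (t : ℝ) z => f (t • z) / (t ^ (-(d : ℝ)) * V t)) q atTop
      (sphere 0 1)

/-- The distribution function `H(s) = P(‖X‖ ≤ s)` of the radius. -/
def radialCdf {d : ℕ} (P : Measure (E d)) (s : ℝ) : ℝ := P.real {z | ‖z‖ ≤ s}

/-- The tail quantile function `U(t) = H⁻¹(1 - 1/t)` of the radius, `t > 1`. -/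
def tailQuantile {d : ℕ} (P : Measure (E d)) (t : ℝ) : ℝ := sInf {s | 1 - 1 / t ≤ radialCdf P s}

/-- The risk region `{z : f(z) ≤ β}`. -/
def riskRegion {d : ℕ} (f : E d → ℝ) (β : ℝ) : Set (E d) := {z | f z ≤ β}

/-- An intermediate sequence: positive integers `k_n < n` (for large `n`) with `k_n → ∞` and
`k_n / n → 0`. -/
structure IntermediateSeq (k : ℕ → ℕ) : Prop where
  bounds : ∀ᶠ n in atTop, 0 < k n ∧ k n < n
  tendsto : Tendsto k atTop atTop
  ratio : Tendsto (fun n => (k n : ℝ) / n) atTop (𝓝 0)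

/-- The real random variables `Y_n` are bounded in probability, `Y_n = O_P(1)`. -/
def BoundedInProb {Ω : Type*} [MeasurableSpace Ω] (μ : Measure Ω) (Y : ℕ → Ω → ℝ) : Prop :=
  ∀ ε : ℝ, 0 < ε → ∃ M : ℝ, ∀ᶠ n in atTop, μ.real {ω | M < |Y n ω|} ≤ ε

/-! ### The estimator -/

/-- A kernel `K : [0,1] → [0,1]`, continuous and nonincreasing, with `K(0) = 1` and `K(1) = 0`,
extended by zero to `(1, ∞)`. Its values at negative arguments are never used. -/
structure IsKernel (K : ℝ → ℝ) : Prop where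
  continuousOn : ContinuousOn K (Icc 0 1)
  antitoneOn : AntitoneOn K (Icc 0 1)
  zero : K 0 = 1
  one : K 1 = 0
  eq_zero : ∀ u, 1 < u → K u = 0

/-- The spherical cap `C_w(h) = {v ∈ Θ : wᵀv ≥ 1 - h}`. -/
def cap {d : ℕ} (w : Theta d) (h : ℝ) : Set (Theta d) := {v | 1 - h ≤ ⟪(w : E d), (v : E d)⟫}

/-- The normalizing constant `c(h, K) = (∫_{C_w(h)} K((1 - vᵀw)/h) dλ(v))⁻¹`. It does not depend
on `w`, see `kernelConst_eq`. -/
def kernelConst {d : ℕ} (K : ℝ → ℝ) (h : ℝ) (w : Theta d) : ℝ :=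
  (∫ v in cap w h, K ((1 - ⟪(v : E d), (w : E d)⟫) / h) ∂(surf d))⁻¹

/-- The `j`-th order statistic `x_{j:n}` (the `j`-th smallest value, `1 ≤ j ≤ n`) of
`x_1, …, x_n`. -/
def orderStat {n : ℕ} (x : Fin n → ℝ) (j : ℕ) : ℝ :=
  if h : 1 ≤ j ∧ j ≤ n then x (Tuple.sort x ⟨j - 1, by omega⟩) else 0

/-- `Û(n/k) = R_{n-k:n}`, where `R_i = ‖x_i‖`. -/
def UHat {d n : ℕ} (k : ℕ) (x : Fin n → E d) : ℝ := orderStat (fun i => ‖x i‖) (n - k)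

open Classical in
/-- `ψ̂_n(w) = (c(h,K)/k) ∑_i K((1 - wᵀW_i)/h) 1[R_i > R_{n-k:n}]`, where `R_i = ‖x_i‖` and
`W_i = x_i / ‖x_i‖`. -/
def psiHat {d n : ℕ} (K : ℝ → ℝ) (h : ℝ) (k : ℕ) (x : Fin n → E d) (w : Theta d) : ℝ :=
  kernelConst K h w / k *
    ∑ i, if UHat k x < ‖x i‖ then K ((1 - ⟪(w : E d), ‖x i‖⁻¹ • x i⟫) / h) else 0

/-- `Ŝ = {r w : r ≥ (a ψ̂_n(w))^{1/(a+d)}, w ∈ Θ}`, where `a` is the estimate of `α`. -/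
def SHat {d n : ℕ} (K : ℝ → ℝ) (h : ℝ) (k : ℕ) (a : ℝ) (x : Fin n → E d) : Set (E d) :=
  {z | ∃ (r : ℝ) (w : Theta d), (a * psiHat K h k x w) ^ (1 / (a + d)) ≤ r ∧ z = r • (w : E d)}

/-- `a^{-a/(a+d)} ∫_Θ ψ̂_n(w)^{d/(a+d)} dλ(w)`, the estimate of `ν(S)`, where `a` is the estimate
of `α`. -/
def nuSHat {d n : ℕ} (K : ℝ → ℝ) (h : ℝ) (k : ℕ) (a : ℝ) (x : Fin n → E d) : ℝ :=
  a ^ (-a / (a + d)) * ∫ w, psiHat K h k x w ^ ((d : ℝ) / (a + d)) ∂(surf d)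

/-- The estimated extreme risk region `Q̂_n = Û(n/k) (k ν̂(S) / (n p))^{1/a} Ŝ`, where `a` is the
estimate of `α`. -/
def QHat {d n : ℕ} (K : ℝ → ℝ) (h : ℝ) (k : ℕ) (p a : ℝ) (x : Fin n → E d) : Set (E d) :=
  (UHat k x * (k * nuSHat K h k a x / (n * p)) ^ (1 / a)) • SHat K h k a x

/-! ### The constant `c(h, K)` does not depend on `w` -/

/-- A linear isometry of `ℝ^d`, restricted to the unit sphere. -/
def sphereEquiv {d : ℕ} (e : E d ≃ₗᵢ[ℝ] E d) : Theta d ≃ₜ Theta d where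
  toFun v := ⟨e v, by simp⟩
  invFun v := ⟨e.symm v, by simp⟩
  left_inv v := by ext1; simp
  right_inv v := by ext1; simp
  continuous_toFun := by fun_prop
  continuous_invFun := by fun_prop

theorem measurePreserving_sphereEquiv {d : ℕ} (e : E d ≃ₗᵢ[ℝ] E d) :
    MeasurePreserving (sphereEquiv e) (surf d) (surf d) := by
  refine ⟨(sphereEquiv e).continuous.measurable, ?_⟩
  ext s hs
  have hs' := (sphereEquiv e).continuous.measurable hs
  rw [Measure.map_apply (sphereEquiv e).continuous.measurable hs, surf,
    Measure.toSphere_apply' _ hs, Measure.toSphere_apply' _ hs']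
  congr 1
  have : Ioo (0 : ℝ) 1 • ((↑) '' (sphereEquiv e ⁻¹' s) : Set (E d))
      = e ⁻¹' (Ioo (0 : ℝ) 1 • ((↑) '' s : Set (E d))) := by
    ext z
    simp only [Set.mem_smul, mem_image, mem_preimage]
    constructor
    · rintro ⟨r, hr, _, ⟨v, hv, rfl⟩, rfl⟩
      exact ⟨r, hr, _, ⟨_, hv, rfl⟩, by simp [sphereEquiv]⟩
    · rintro ⟨r, hr, _, ⟨v, hv, rfl⟩, h⟩
      refine ⟨r, hr, _, ⟨(sphereEquiv e).symm v, by simpa using hv, rfl⟩, ?_⟩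
      apply e.injective
      rw [← h]
      simp [sphereEquiv]
  rw [this]
  exact e.measurePreserving.measure_preimage_emb e.toHomeomorph.measurableEmbedding _

theorem kernelConst_eq {d : ℕ} (K : ℝ → ℝ) (h : ℝ) (w w' : Theta d) :
    kernelConst K h w = kernelConst K h w' := by
  let e : E d ≃ₗᵢ[ℝ] E d := (ℝ ∙ ((w : E d) - w'))ᗮ.reflection
  have hw : e (w : E d) = w' := Submodule.reflection_sub (by simp)
  have hcap : sphereEquiv e ⁻¹' cap w' h = cap w h := by
    ext v
    simp [cap, sphereEquiv, ← hw, e.inner_map_map]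
  have key := (measurePreserving_sphereEquiv e).setIntegral_preimage_emb
    (sphereEquiv e).measurableEmbedding
    (fun v => K ((1 - ⟪(v : E d), (w' : E d)⟫) / h)) (cap w' h)
  rw [hcap] at key
  unfold kernelConst
  rw [← key]
  congr 2
  ext v
  simp [sphereEquiv, ← hw, e.inner_map_map]

end ExtremeRisk

end

open ExtremeRisk

/-! Condition (c) turns regular variation into a pure power law. The positive density makes
`tailQuantile` an exact inverse of the radial tail, so `s ^ α * P(‖z‖ > s)` converges. Comparing the
mass of the shell `t < ‖z‖ ≤ 2t` with the integral of `q` over a fixed annulus then forces `t ^ α *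
V t` to converge to some `l > 0`. Hence `f` is asymptotic, with uniformly small relative error far
out, to `g = l * q`, continuous, positive and homogeneous of degree `-(d + α)`
(`exists_homogeneousTail`). Polar coordinates compute everything about `g`: its mass outside the
ball of radius `t` is `tailMass * t ^ (-α)`, and its mass on `{g < b}` is `levelMass * b ^ (α / (d +
α))`. Since `{f ≤ b}` is trapped between `{g < b (1 ± ε)}` for small `b`, it follows that `p_n ~
levelMass * β_n ^ (α / (d + α))`.

On the statistical side, the random level `R_{n-k:n}` is trapped between two deterministic
thresholds exceeded by about `(1 ± δ) k` observations. With those thresholds the kernel sums are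
sums of independent bounded variables. A Chernoff bound with exponent proportional to `k / c(h, K)`,
a union bound over a net of the sphere of size polynomial in `1 / h`, and a small shift of the
kernel argument that absorbs the mesh together give uniform consistency of `psiHat` for `ψ = g / (α
* tailMass)` (`eventually_abs_psiHat_sub_le`). The net is affordable because `1 / h` is polynomially
bounded in `c(h, K)`, hence in `k`, while `k / c(h, K)` dominates `log k`.

Finally, the scale of the estimated region times `β_n ^ (1 / (d + α))` converges to `tailMass ^ (1 /
(d + α))` (`tendsto_scaleHat`); the error in the extrapolation exponent `1 / αhat` is harmless
because `log (n p) / √k → 0` and `log k / √k → 0`. By continuity, uniformly in the direction, `g` on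
the boundary of the estimated region is `β_n (1 + o(1))`. The true and the estimated regions
therefore both lie between `{g < β_n (1 - ε)}` and `{g < β_n (1 + ε)}`, and the shell between these
has `P`-mass at most a small multiple of `p_n`.

Convergence in probability is encoded by the filter `aas`, so limits combine by the usual filter
calculus and continuity arguments. -/

noncomputable section

namespace ExtremeRisk

/-! ### Convergence in probability as convergence along a filter -/

section AsymptoticallyAlmostSurely

variable {Ω : Type*} [MeasurableSpace Ω]

/-- The sets of pairs `(n, ω)` whose `n`-th sections have probability tending to one. -/
def aas (μ : Measure Ω) : Filter (ℕ × Ω) where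
  sets := {A | Tendsto (fun n => μ {ω | (n, ω) ∉ A}) atTop (𝓝 0)}
  univ_sets := by simp
  sets_of_superset := by
    intro A B hA hAB
    exact tendsto_of_tendsto_of_tendsto_of_le_of_le tendsto_const_nhds hA (fun _ => zero_le)
      (fun n => measure_mono fun ω hω h => hω (hAB h))
  inter_sets := by
    intro A B hA hB
    have h := hA.add hB
    rw [add_zero] at h
    refine tendsto_of_tendsto_of_tendsto_of_le_of_le tendsto_const_nhds h (fun _ => zero_le)
      (fun n => ?_)
    refine (measure_mono ?_).trans (measure_union_le _ _)
    intro ω hω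
    simp only [mem_inter_iff, mem_ofPred_eq, not_and_or] at hω
    exact hω

theorem eventually_aas {μ : Measure Ω} {p : ℕ × Ω → Prop} :
    (∀ᶠ x in aas μ, p x) ↔ Tendsto (fun n => μ {ω | ¬ p (n, ω)}) atTop (𝓝 0) := Iff.rfl

/-- Deterministic limits in `n` are transported to `aas` by composing with this map. -/
theorem tendsto_fst_aas (μ : Measure Ω) : Tendsto Prod.fst (aas μ) atTop := by
  rw [Filter.tendsto_atTop]
  intro N
  rw [eventually_aas]
  refine tendsto_const_nhds.congr' ?_
  filter_upwards [eventually_ge_atTop N] with n hn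
  simp [hn]

theorem eventually_aas_of_real_le {μ : Measure Ω} [IsFiniteMeasure μ] {p : ℕ × Ω → Prop}
    {u : ℕ → ℝ} (hu : Tendsto u atTop (𝓝 0))
    (h : ∀ᶠ n in atTop, μ.real {ω | ¬ p (n, ω)} ≤ u n) : ∀ᶠ x in aas μ, p x := by
  rw [eventually_aas]
  have h1 : Tendsto (fun n => μ.real {ω | ¬ p (n, ω)}) atTop (𝓝 0) :=
    tendsto_of_tendsto_of_tendsto_of_le_of_le' tendsto_const_nhds hu
      (Eventually.of_forall fun _ => measureReal_nonneg) h
  have h2 := ENNReal.tendsto_ofReal h1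
  simpa [ofReal_measureReal] using h2

theorem tendstoInMeasure_of_aas {μ : Measure Ω} {Y : ℕ → Ω → ℝ} {a : ℝ}
    (h : Tendsto (fun x : ℕ × Ω => Y x.1 x.2) (aas μ) (𝓝 a)) :
    TendstoInMeasure μ Y atTop (fun _ => a) := by
  intro ε hε
  have h1 := (EMetric.tendsto_nhds.1 h) ε hε
  rw [eventually_aas] at h1
  simpa using h1

/-- The rule `o(1) * O_P(1) = o_P(1)`. -/
theorem BoundedInProb.tendsto_mul_aas {μ : Measure Ω} [IsFiniteMeasure μ] {Y : ℕ → Ω → ℝ}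
    (hY : BoundedInProb μ Y) {b : ℕ → ℝ} (hb : Tendsto b atTop (𝓝 0)) :
    Tendsto (fun x : ℕ × Ω => b x.1 * Y x.1 x.2) (aas μ) (𝓝 0) := by
  rw [Metric.tendsto_nhds]
  intro δ hδ
  rw [eventually_aas, ← ENNReal.tendsto_toReal_iff (by simp) (by simp), Metric.tendsto_nhds]
  intro ε hε
  obtain ⟨M, hM⟩ := hY (ε / 2) (by positivity)
  have hb' : ∀ᶠ n in atTop, |b n| * (|M| + 1) < δ := by
    have : Tendsto (fun n => |b n| * (|M| + 1)) atTop (𝓝 0) := by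
      simpa using hb.abs.mul_const (|M| + 1)
    exact this.eventually_lt_const hδ
  filter_upwards [hM, hb'] with n hn hbn
  have hle : μ.real {ω | ¬ dist (b n * Y n ω) 0 < δ} ≤ μ.real {ω | M < |Y n ω|} := by
    refine measureReal_mono ?_
    intro ω hω
    by_contra hc
    simp only [mem_ofPred_eq, not_lt] at hc hω
    rw [dist_zero_right, Real.norm_eq_abs, abs_mul] at hω
    have : |b n| * |Y n ω| ≤ |b n| * (|M| + 1) := by
      gcongr
      linarith [le_abs_self M]
    linarith
  have h0 : (0 : ℝ) ≤ μ.real {ω | ¬ dist (b n * Y n ω) 0 < δ} := measureReal_nonneg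
  change |μ.real {ω | ¬ dist (b n * Y n ω) 0 < δ} - 0| < ε
  rw [sub_zero, abs_of_nonneg h0]
  linarith

end AsymptoticallyAlmostSurely

/-! ### A Chernoff bound -/

section Chernoff

variable {Ω S : Type*} [MeasurableSpace Ω] [MeasurableSpace S] {μ : Measure Ω}
  [IsProbabilityMeasure μ] {P : Measure S} {X : ℕ → Ω → S}

/-- Convexity puts `exp (s φ)` below the chord `1 + φ (exp s - 1)`, and `exp s ≤ 1 + s + s ^ 2` for
`|s| ≤ 1`. The resulting exponent is proportional to the mean of `φ`, which matters because the
events counted later are rare. -/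
theorem mgf_le_of_mem_Icc {P : Measure S} [IsProbabilityMeasure P] {φ : S → ℝ}
    (hφ : Measurable φ) (h0 : ∀ z, 0 ≤ φ z) (h1 : ∀ z, φ z ≤ 1) {s : ℝ} (hs : |s| ≤ 1) :
    ∫ z, Real.exp (s * φ z) ∂P ≤ Real.exp ((∫ z, φ z ∂P) * (s + s ^ 2)) := by
  have hint : Integrable φ P := Integrable.of_bound hφ.aestronglyMeasurable 1
    (Eventually.of_forall fun z => by rw [Real.norm_eq_abs, abs_of_nonneg (h0 z)]; exact h1 z)
  have hle : ∀ z, Real.exp (s * φ z) ≤ 1 + φ z * (s + s ^ 2) := by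
    intro z
    have hc := convexOn_exp.2 (mem_univ 0) (mem_univ s) (sub_nonneg.2 (h1 z)) (h0 z) (by ring)
    simp only [smul_eq_mul, mul_zero, zero_add, Real.exp_zero, mul_one] at hc
    have h2 := Real.abs_exp_sub_one_sub_id_le hs
    have h3 : Real.exp s ≤ 1 + s + s ^ 2 := by linarith [(abs_le.1 h2).2]
    have h4 := mul_le_mul_of_nonneg_left h3 (h0 z)
    rw [mul_comm s]
    linarith
  calc ∫ z, Real.exp (s * φ z) ∂P ≤ ∫ z, (1 + φ z * (s + s ^ 2)) ∂P := by
        refine integral_mono_of_nonneg (Eventually.of_forall fun z => (Real.exp_pos _).le)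
          ((integrable_const _).add (hint.mul_const _)) (Eventually.of_forall hle)
    _ = (∫ z, φ z ∂P) * (s + s ^ 2) + 1 := by
        rw [integral_add (integrable_const _) (hint.mul_const _), integral_mul_const]
        simp [add_comm]
    _ ≤ _ := Real.add_one_le_exp _

theorem mgf_sum_le (hXmeas : ∀ i, Measurable (X i)) (hXindep : iIndepFun X μ)
    (hXlaw : ∀ i, μ.map (X i) = P) {φ : S → ℝ} (hφ : Measurable φ) (h0 : ∀ z, 0 ≤ φ z)
    (h1 : ∀ z, φ z ≤ 1) (n : ℕ) {s : ℝ} (hs : |s| ≤ 1) :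
    mgf (fun ω => ∑ i : Fin n, φ (X i ω)) μ s
      ≤ Real.exp (n * (∫ z, φ z ∂P) * (s + s ^ 2)) := by
  have hP : IsProbabilityMeasure P := by
    rw [← hXlaw 0]
    exact Measure.isProbabilityMeasure_map (hXmeas 0).aemeasurable
  have hind : iIndepFun (fun (i : Fin n) ω => φ (X i ω)) μ :=
    (hXindep.precomp Fin.val_injective).comp (fun _ => φ) (fun _ => hφ)
  have hsum := hind.mgf_sum (t := s) (fun i => hφ.comp (hXmeas i)) Finset.univ
  have heq : (fun ω => ∑ i : Fin n, φ (X i ω)) = ∑ i : Fin n, fun ω => φ (X i ω) := by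
    ext ω; simp
  rw [heq, hsum]
  have hone : ∀ i : Fin n, mgf (fun ω => φ (X i ω)) μ s
      ≤ Real.exp ((∫ z, φ z ∂P) * (s + s ^ 2)) := by
    intro i
    have : mgf (fun ω => φ (X i ω)) μ s = ∫ z, Real.exp (s * φ z) ∂P := by
      rw [← hXlaw i, integral_map (hXmeas i).aemeasurable]
      · rfl
      · exact (by fun_prop : Measurable fun z => Real.exp (s * φ z)).aestronglyMeasurable
    rw [this]
    exact mgf_le_of_mem_Icc hφ h0 h1 hs
  refine (Finset.prod_le_prod (fun i _ => mgf_nonneg) (fun i _ => hone i)).trans ?_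
  rw [Finset.prod_const, Finset.card_univ, Fintype.card_fin, ← Real.exp_nat_mul]
  apply le_of_eq
  congr 1
  ring

/-- Chernoff's method with the mean in the role of the variance: the exponent is of order `L`, the
order of the mean, and does not degrade with `n`. -/
theorem measure_abs_sum_sub_ge_le (hXmeas : ∀ i, Measurable (X i)) (hXindep : iIndepFun X μ)
    (hXlaw : ∀ i, μ.map (X i) = P) {φ : S → ℝ} (hφ : Measurable φ) (h0 : ∀ z, 0 ≤ φ z)
    (h1 : ∀ z, φ z ≤ 1) (n : ℕ) {L B ε : ℝ} (hε : 0 < ε) (hεB : ε ≤ B)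
    (hB : n * (∫ z, φ z ∂P) ≤ B * L) :
    μ.real {ω | ε * L ≤ |(∑ i : Fin n, φ (X i ω)) - n * ∫ z, φ z ∂P|}
      ≤ 2 * Real.exp (-(ε ^ 2 / (4 * B)) * L) := by
  have hBpos : 0 < B := hε.trans_le hεB
  set m : ℝ := n * ∫ z, φ z ∂P with hm
  -- The minimizer of `-s ε L + B L s ^ 2`; `ε ≤ B` keeps it within the range `|s| ≤ 1` of the
  -- moment bound.
  set s : ℝ := ε / (2 * B) with hs
  have hs0 : 0 < s := by positivity
  have hs1 : |s| ≤ 1 := by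
    rw [abs_of_pos hs0, hs, div_le_one (by positivity)]; linarith
  have hint : ∀ t : ℝ, Integrable (fun ω => Real.exp (t * ∑ i : Fin n, φ (X i ω))) μ := by
    intro t
    refine Integrable.of_bound (C := Real.exp (|t| * n)) ?_ (Eventually.of_forall fun ω => ?_)
    · have := hXmeas
      exact (by fun_prop : Measurable fun ω =>
        Real.exp (t * ∑ i : Fin n, φ (X i ω))).aestronglyMeasurable
    · rw [Real.norm_eq_abs, abs_of_pos (Real.exp_pos _), Real.exp_le_exp]
      refine (le_abs_self _).trans ?_
      rw [abs_mul]
      gcongr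
      rw [abs_of_nonneg (Finset.sum_nonneg fun i _ => h0 _)]
      calc ∑ i : Fin n, φ (X i ω) ≤ ∑ i : Fin n, (1 : ℝ) := Finset.sum_le_sum fun i _ => h1 _
        _ = n := by simp
  have hkey : -s * (ε * L) + m * s ^ 2 ≤ -(ε ^ 2 / (4 * B)) * L := by
    have h2 : m * s ^ 2 ≤ B * L * s ^ 2 := by gcongr
    have h3 : -s * (ε * L) + B * L * s ^ 2 = -(ε ^ 2 / (4 * B)) * L := by
      rw [hs]; field_simp; ring
    linarith
  have hup : μ.real {ω | m + ε * L ≤ ∑ i : Fin n, φ (X i ω)}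
      ≤ Real.exp (-(ε ^ 2 / (4 * B)) * L) := by
    refine (measure_ge_le_exp_mul_mgf (t := s) _ hs0.le (hint s)).trans ?_
    refine (mul_le_mul_of_nonneg_left (mgf_sum_le hXmeas hXindep hXlaw hφ h0 h1 n hs1)
      (Real.exp_pos _).le).trans ?_
    rw [← Real.exp_add, Real.exp_le_exp, ← hm]
    linarith
  have hlo : μ.real {ω | ∑ i : Fin n, φ (X i ω) ≤ m - ε * L}
      ≤ Real.exp (-(ε ^ 2 / (4 * B)) * L) := by
    refine (measure_le_le_exp_mul_mgf (t := -s) _ (by linarith) (hint (-s))).trans ?_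
    refine (mul_le_mul_of_nonneg_left (mgf_sum_le hXmeas hXindep hXlaw hφ h0 h1 n
      (by rwa [abs_neg])) (Real.exp_pos _).le).trans ?_
    rw [← Real.exp_add, Real.exp_le_exp, ← hm]
    nlinarith
  calc _ ≤ μ.real ({ω | m + ε * L ≤ ∑ i : Fin n, φ (X i ω)} ∪
        {ω | ∑ i : Fin n, φ (X i ω) ≤ m - ε * L}) := by
        refine measureReal_mono ?_
        intro ω hω
        simp only [mem_ofPred_eq, le_abs] at hω
        rcases hω with h | h
        · left; simp only [mem_ofPred_eq]; linarith
        · right; simp only [mem_ofPred_eq]; linarith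
    _ ≤ _ := measureReal_union_le _ _
    _ ≤ _ := by linarith

end Chernoff

/-! ### Order statistics -/

theorem orderStat_le_of_card_le {n k : ℕ} {x : Fin n → ℝ} {t : ℝ} (hk : k < n)
    (h : (Finset.univ.filter fun i => t < x i).card ≤ k) : orderStat x (n - k) ≤ t := by
  have hj : 1 ≤ n - k ∧ n - k ≤ n := by omega
  rw [orderStat, dif_pos hj]
  by_contra hc
  push Not at hc
  have hmono := Tuple.monotone_sort x
  -- Positions are zero-based, so the `(n - k)`-th smallest value and those after it occupy `k + 1`
  -- positions, one too many.
  have hsub : (Finset.Ici (⟨n - k - 1, by omega⟩ : Fin n)).map (Tuple.sort x).toEmbedding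
      ⊆ Finset.univ.filter fun i => t < x i := by
    intro i hi
    simp only [Finset.mem_map, Finset.mem_Ici] at hi
    obtain ⟨j, hj, rfl⟩ := hi
    simp only [Finset.mem_filter, Finset.mem_univ, true_and]
    exact hc.trans_le (hmono hj)
  have := Finset.card_le_card hsub
  rw [Finset.card_map, Fin.card_Ici] at this
  simp only at this
  omega

theorem lt_orderStat_of_lt_card {n k : ℕ} {x : Fin n → ℝ} {t : ℝ} (hk : k < n)
    (h : k < (Finset.univ.filter fun i => t < x i).card) : t < orderStat x (n - k) := by
  have hj : 1 ≤ n - k ∧ n - k ≤ n := by omega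
  rw [orderStat, dif_pos hj]
  by_contra hc
  push Not at hc
  have hmono := Tuple.monotone_sort x
  -- Only `k` positions lie strictly after that of the order statistic, too few for the exceedances
  -- of `t`.
  have hsub : (Finset.univ.filter fun i => t < x i) ⊆
      (Finset.Ioi (⟨n - k - 1, by omega⟩ : Fin n)).map (Tuple.sort x).toEmbedding := by
    intro i hi
    simp only [Finset.mem_filter, Finset.mem_univ, true_and] at hi
    simp only [Finset.mem_map, Finset.mem_Ioi]
    refine ⟨(Tuple.sort x).symm i, ?_, by simp⟩
    by_contra hle
    push Not at hle
    have := hmono hle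
    simp only [Function.comp_apply, Equiv.apply_symm_apply] at this
    linarith
  have := Finset.card_le_card hsub
  rw [Finset.card_map, Fin.card_Ioi] at this
  simp only at this
  omega

/-! ### Densities with a homogeneous limit -/

theorem norm_inv_smul_mem_sphere {d : ℕ} {z : E d} (hz : z ≠ 0) :
    ‖z‖⁻¹ • z ∈ sphere (0 : E d) 1 := by
  simp [norm_smul, hz]

theorem nontrivial_E {d : ℕ} (hd : 0 < d) : Nontrivial (E d) := by
  have : Nonempty (Fin d) := ⟨⟨0, hd⟩⟩
  infer_instance

section Density

variable {d : ℕ} {P : Measure (E d)} {f : E d → ℝ}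

theorem integrable_density [IsFiniteMeasure P]
    (hP : P = volume.withDensity (fun z => ENNReal.ofReal (f z))) (hf : Continuous f)
    (hpos : ∀ z, 0 < f z) : Integrable f := by
  refine ⟨hf.aestronglyMeasurable, ?_⟩
  rw [hasFiniteIntegral_iff_ofReal (Eventually.of_forall fun z => (hpos z).le)]
  have h := measure_lt_top P univ
  rwa [hP, withDensity_apply _ MeasurableSet.univ, setLIntegral_univ] at h

theorem integral_eq_integral_density
    (hP : P = volume.withDensity (fun z => ENNReal.ofReal (f z))) (hf : Continuous f)
    (hpos : ∀ z, 0 < f z) (φ : E d → ℝ) : ∫ z, φ z ∂P = ∫ z, φ z * f z := by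
  rw [hP, integral_withDensity_eq_integral_toReal_smul (by fun_prop)
    (Eventually.of_forall fun z => ENNReal.ofReal_lt_top)]
  refine integral_congr_ae (Eventually.of_forall fun z => ?_)
  simp [ENNReal.toReal_ofReal (hpos z).le, mul_comm]

theorem real_eq_setIntegral_density
    (hP : P = volume.withDensity (fun z => ENNReal.ofReal (f z))) (hf : Continuous f)
    (hpos : ∀ z, 0 < f z) {s : Set (E d)} (hs : MeasurableSet s) :
    P.real s = ∫ z in s, f z := by
  rw [← integral_indicator_one hs, integral_eq_integral_density hP hf hpos,
    ← integral_indicator hs]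
  congr 1
  ext z
  by_cases hz : z ∈ s <;> simp [hz]

theorem isOpenPosMeasure_of_density
    (hP : P = volume.withDensity (fun z => ENNReal.ofReal (f z))) (hf : Continuous f)
    (hpos : ∀ z, 0 < f z) : P.IsOpenPosMeasure := by
  have hac : (volume : Measure (E d)) ≪ P := by
    rw [hP]
    refine withDensity_absolutelyContinuous' (by fun_prop) (Eventually.of_forall fun z => ?_)
    simpa using hpos z
  exact hac.isOpenPosMeasure

theorem tendsto_real_norm_gt [IsFiniteMeasure P] :
    Tendsto (fun s : ℝ => P.real {z | s < ‖z‖}) atTop (𝓝 0) := by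
  have h := tendsto_measure_iInter_atTop (μ := P) (s := fun s : ℝ => {z : E d | s < ‖z‖})
    (fun s => (measurableSet_lt measurable_const measurable_norm).nullMeasurableSet)
    (fun s t hst z hz => lt_of_le_of_lt hst hz) ⟨0, measure_ne_top _ _⟩
  have he : (⋂ s : ℝ, {z : E d | s < ‖z‖}) = ∅ := by
    ext z
    simp only [mem_iInter, mem_ofPred_eq, mem_empty_iff_false, iff_false, not_forall]
    exact ⟨‖z‖, lt_irrefl _⟩
  rw [he, measure_empty] at h
  exact (ENNReal.tendsto_toReal (by simp)).comp h

theorem radialCdf_eq [IsProbabilityMeasure P] (s : ℝ) :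
    radialCdf P s = 1 - P.real {z | s < ‖z‖} := by
  have hm : MeasurableSet {z : E d | s < ‖z‖} := measurableSet_lt measurable_const measurable_norm
  have := probReal_compl_eq_one_sub (μ := P) hm
  rw [← this, radialCdf]
  congr 1
  ext z
  simp

/-- Every nonempty open shell has positive mass. Strict monotonicity is what makes the generalized
inverse a true inverse. -/
theorem radialCdf_lt_of_lt [IsProbabilityMeasure P] [P.IsOpenPosMeasure] (hd : 0 < d) {s t : ℝ}
    (ht : 0 < t) (hst : s < t) : radialCdf P s < radialCdf P t := by
  have := nontrivial_E hd
  have hopen : IsOpen {z : E d | s < ‖z‖ ∧ ‖z‖ < t} :=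
    (isOpen_lt continuous_const continuous_norm).inter (isOpen_lt continuous_norm continuous_const)
  obtain ⟨r, hr1, hr2⟩ := exists_between (max_lt hst ht)
  obtain ⟨z, hz⟩ := exists_norm_eq (E d) ((le_max_right s 0).trans hr1.le)
  have hpos : 0 < P.real {z : E d | s < ‖z‖ ∧ ‖z‖ < t} := by
    rw [measureReal_def, ENNReal.toReal_pos_iff]
    refine ⟨hopen.measure_pos P ⟨z, ?_⟩, measure_lt_top _ _⟩
    rw [mem_ofPred_eq, hz]
    exact ⟨(le_max_left s 0).trans_lt hr1, hr2⟩
  have hdisj : Disjoint {z : E d | ‖z‖ ≤ s} {z : E d | s < ‖z‖ ∧ ‖z‖ < t} := by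
    rw [Set.disjoint_left]
    intro z hz hz'
    exact absurd hz'.1 (not_lt.2 hz)
  have h1 := measureReal_union (μ := P) hdisj hopen.measurableSet
  have h2 : P.real ({z : E d | ‖z‖ ≤ s} ∪ {z : E d | s < ‖z‖ ∧ ‖z‖ < t}) ≤ radialCdf P t := by
    refine measureReal_mono ?_
    rintro z (hz | hz)
    · exact hz.trans hst.le
    · exact hz.2.le
  rw [h1] at h2
  rw [radialCdf]
  linarith

theorem tailQuantile_one_div_tail [IsProbabilityMeasure P] [P.IsOpenPosMeasure] (hd : 0 < d)
    {s : ℝ} (hs : 0 < s) : tailQuantile P (1 / P.real {z | s < ‖z‖}) = s := by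
  have : {s' | 1 - 1 / (1 / P.real {z : E d | s < ‖z‖}) ≤ radialCdf P s'} = Ici s := by
    ext s'
    rw [one_div_one_div, ← radialCdf_eq, mem_ofPred_eq, mem_Ici]
    constructor
    · intro h
      by_contra hc
      exact absurd (radialCdf_lt_of_lt (P := P) hd hs (not_le.1 hc)) (not_lt.2 h)
    · intro h
      exact measureReal_mono fun z hz => le_trans hz h
  rw [tailQuantile, this, csInf_Ici]

theorem real_norm_gt_pos [IsFiniteMeasure P] [P.IsOpenPosMeasure] (hd : 0 < d) (s : ℝ) :
    0 < P.real {z : E d | s < ‖z‖} := by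
  have := nontrivial_E hd
  obtain ⟨z, hz⟩ := exists_norm_eq (E d) (by positivity : (0 : ℝ) ≤ |s| + 1)
  rw [measureReal_def, ENNReal.toReal_pos_iff]
  refine ⟨(isOpen_lt continuous_const continuous_norm).measure_pos P ⟨z, ?_⟩, measure_lt_top _ _⟩
  rw [mem_ofPred_eq, hz]
  linarith [le_abs_self s]

/-- Condition (c) is read along `t = 1 / P(‖z‖ > s)`, where the tail quantile is exactly `s`, and
then raised to the power `α`. -/
theorem tendsto_rpow_mul_tail [IsProbabilityMeasure P] [P.IsOpenPosMeasure] (hd : 0 < d)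
    {α c : ℝ} (hα : 0 < α) (hcpos : 0 < c)
    (hc : Tendsto (fun t : ℝ => tailQuantile P t / t ^ (1 / α)) atTop (𝓝 c)) :
    Tendsto (fun s : ℝ => s ^ α * P.real {z | s < ‖z‖}) atTop (𝓝 (c ^ α)) := by
  have hτ : Tendsto (fun s : ℝ => 1 / P.real {z : E d | s < ‖z‖}) atTop atTop := by
    simp only [one_div]
    refine Tendsto.inv_tendsto_nhdsGT_zero ?_
    exact tendsto_nhdsWithin_iff.2 ⟨tendsto_real_norm_gt,
      Eventually.of_forall fun s => real_norm_gt_pos hd s⟩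
  have h1 := (hc.comp hτ).rpow_const (p := α) (Or.inl hcpos.ne')
  refine h1.congr' ?_
  filter_upwards [eventually_gt_atTop 0] with s hs
  have hp := real_norm_gt_pos (P := P) hd s
  simp only [Function.comp_apply]
  rw [tailQuantile_one_div_tail hd hs, Real.div_rpow hs.le (by positivity),
    ← Real.rpow_mul (by positivity), one_div_mul_cancel hα.ne', Real.rpow_one]
  simp

end Density

/-- A probability density on `ℝ^d` that is asymptotic to a continuous positive function `g`,
homogeneous of degree `-(d + α)`. -/
structure HomogeneousTail {d : ℕ} (P : Measure (E d)) (f g : E d → ℝ) (α : ℝ) : Prop where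
  alpha_pos : 0 < α
  density : P = volume.withDensity (fun z => ENNReal.ofReal (f z))
  continuous : Continuous f
  pos : ∀ z, 0 < f z
  continuousOn : ContinuousOn g {0}ᶜ
  limit_pos : ∀ z, z ≠ 0 → 0 < g z
  homogeneous : ∀ z, z ≠ 0 → g z = ‖z‖ ^ (-(d + α)) * g (‖z‖⁻¹ • z)
  approx : ∀ ε, 0 < ε → ∃ T, 0 < T ∧ ∀ z, T ≤ ‖z‖ → |f z - g z| ≤ ε * ‖z‖ ^ (-(d + α))

/-! ### From regular variation to an exact homogeneous tail. -/

section RegularVariation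

variable {d : ℕ} {P : Measure (E d)} {f q : E d → ℝ} {V : ℝ → ℝ} {α : ℝ}

/-- Both sides are limits of `f (t u z)` normalized at `t`: directly, and by normalizing at `t u`
and using the regular variation of `V`. -/
theorem RegularlyVaryingDensity.limit_smul (ha : RegularlyVaryingDensity P f q V α) {u : ℝ}
    (hu : 0 < u) {z : E d} (hz : z ≠ 0) : q (u • z) = u ^ (-(d + α)) * q z := by
  have h1 := ha.tendsto (u • z) (smul_ne_zero hu.ne' hz)
  have h2 := ((ha.tendsto z hz).comp (tendsto_id.atTop_mul_const hu)).mul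
    ((ha.regVar.tendsto u hu).mul_const (u ^ (-(d : ℝ))))
  refine tendsto_nhds_unique h1 ?_
  have h3 : q z * (u ^ (-α) * u ^ (-(d : ℝ))) = u ^ (-(d + α)) * q z := by
    rw [← Real.rpow_add hu, mul_comm]; ring_nf
  rw [h3] at h2
  refine h2.congr' ?_
  filter_upwards [eventually_gt_atTop 0] with t ht
  have hV := ha.regVar.pos t ht
  have hV' := ha.regVar.pos (t * u) (by positivity)
  simp only [Function.comp_apply, id, smul_smul]
  rw [Real.mul_rpow ht.le hu.le]
  have hu' : 0 < u ^ (-(d : ℝ)) := by positivity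
  have ht' : 0 < t ^ (-(d : ℝ)) := by positivity
  field_simp

theorem RegularlyVaryingDensity.limit_eq (ha : RegularlyVaryingDensity P f q V α) {z : E d}
    (hz : z ≠ 0) : q z = ‖z‖ ^ (-(d + α)) * q (‖z‖⁻¹ • z) := by
  have hn : 0 < ‖z‖ := norm_pos_iff.2 hz
  rw [← ha.limit_smul hn (smul_ne_zero (by positivity) hz), smul_smul, mul_inv_cancel₀ hn.ne',
    one_smul]

/-- On the sphere `q` is a uniform limit of continuous functions; homogeneity extends continuity
radially. -/
theorem RegularlyVaryingDensity.continuousOn_limit (ha : RegularlyVaryingDensity P f q V α) :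
    ContinuousOn q {0}ᶜ := by
  have hs : ContinuousOn q (sphere 0 1) := by
    refine ha.tendstoUniformlyOn.continuousOn (Eventually.of_forall fun t => ?_).frequently
    have := ha.continuous
    fun_prop
  have h : ContinuousOn (fun z : E d => ‖z‖ ^ (-(d + α)) * q (‖z‖⁻¹ • z)) {0}ᶜ := by
    refine ContinuousOn.mul ?_ (hs.comp ?_ fun z hz => norm_inv_smul_mem_sphere hz)
    · exact continuous_norm.continuousOn.rpow_const fun z hz => Or.inl (norm_ne_zero_iff.2 hz)
    · exact (continuous_norm.continuousOn.inv₀ fun z hz => norm_ne_zero_iff.2 hz).smul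
        continuousOn_id
  exact h.congr fun z hz => ha.limit_eq hz

theorem RegularlyVaryingDensity.exists_limit_le (ha : RegularlyVaryingDensity P f q V α) :
    ∃ M, 0 < M ∧ ∀ z ∈ sphere (0 : E d) 1, q z ≤ M := by
  have hs : ContinuousOn q (sphere 0 1) := ha.continuousOn_limit.mono fun z hz => by
    rintro rfl
    simp at hz
  obtain ⟨M, hM⟩ := (isCompact_sphere (0 : E d) 1).bddAbove_image hs
  exact ⟨max M 1, by positivity, fun z hz => (hM (mem_image_of_mem _ hz)).trans (le_max_left _ _)⟩

end RegularVariation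

/-- The annulus `{z : 1 < ‖z‖ ≤ 2}`. -/
def annulus (d : ℕ) : Set (E d) := {z | 1 < ‖z‖ ∧ ‖z‖ ≤ 2}

theorem measurableSet_annulus (d : ℕ) : MeasurableSet (annulus d) :=
  (measurableSet_lt measurable_const measurable_norm).inter
    (measurableSet_le measurable_norm measurable_const)

theorem annulus_subset_closedBall (d : ℕ) : annulus d ⊆ closedBall 0 2 := fun z hz => by
  simpa using hz.2

theorem volume_annulus_lt_top (d : ℕ) : volume (annulus d) < ⊤ :=
  (measure_mono (annulus_subset_closedBall d)).trans_lt measure_closedBall_lt_top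

theorem volume_annulus_pos {d : ℕ} (hd : 0 < d) : 0 < volume (annulus d) := by
  have := nontrivial_E hd
  obtain ⟨z, hz⟩ := exists_norm_eq (E d) (by norm_num : (0 : ℝ) ≤ 3 / 2)
  have hopen : IsOpen {z : E d | 1 < ‖z‖ ∧ ‖z‖ < 2} :=
    (isOpen_lt continuous_const continuous_norm).inter (isOpen_lt continuous_norm continuous_const)
  refine (hopen.measure_pos volume ⟨z, ?_⟩).trans_le (measure_mono fun z hz => ⟨hz.1, hz.2.le⟩)
  rw [mem_ofPred_eq, hz]
  norm_num

theorem ne_zero_of_mem_annulus {d : ℕ} {z : E d} (hz : z ∈ annulus d) : z ≠ 0 :=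
  norm_pos_iff.1 (zero_lt_one.trans hz.1)

section RegularVariation

variable {d : ℕ} {P : Measure (E d)} {f q : E d → ℝ} {V : ℝ → ℝ} {α : ℝ}

/-- The dilation by `t` maps the annulus to the shell `t < ‖z‖ ≤ 2t`. This links the density on a
fixed compact region with the radial tail. -/
theorem setIntegral_annulus_density [IsFiniteMeasure P]
    (hP : P = volume.withDensity (fun z => ENNReal.ofReal (f z))) (hf : Continuous f)
    (hpos : ∀ z, 0 < f z) {t : ℝ} (ht : 0 < t) :
    ∫ y in annulus d, t ^ (d + α) * f (t • y)
      = t ^ α * (P.real {z | t < ‖z‖} - P.real {z | 2 * t < ‖z‖}) := by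
  have hset : t • annulus d = {z | t < ‖z‖} \ {z | 2 * t < ‖z‖} := by
    ext z
    rw [mem_smul_set_iff_inv_smul_mem₀ ht.ne']
    simp only [annulus, mem_ofPred_eq, norm_smul, norm_inv, Real.norm_eq_abs, abs_of_pos ht,
      Set.mem_sdiff, not_lt]
    rw [← div_eq_inv_mul, one_lt_div ht, div_le_iff₀ ht]
  have hm : ∀ s : ℝ, MeasurableSet {z : E d | s < ‖z‖} := fun s =>
    measurableSet_lt measurable_const measurable_norm
  rw [integral_const_mul, Measure.setIntegral_comp_smul_of_pos _ _ _ ht,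
    ← measureReal_sdiff (fun z hz => ?_) (hm _), ← hset, real_eq_setIntegral_density hP hf hpos,
    finrank_euclideanSpace_fin, Real.rpow_add ht, Real.rpow_natCast, smul_eq_mul]
  · have : t ^ d ≠ 0 := by positivity
    field_simp
  · rw [hset]
    exact (hm _).diff (hm _)
  · simp only [mem_ofPred_eq] at hz ⊢
    linarith

theorem RegularlyVaryingDensity.tendsto_setIntegral_annulus [IsProbabilityMeasure P]
    (ha : RegularlyVaryingDensity P f q V α) {C : ℝ}
    (hC : Tendsto (fun s : ℝ => s ^ α * P.real {z | s < ‖z‖}) atTop (𝓝 C)) :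
    Tendsto (fun t : ℝ => ∫ y in annulus d, t ^ (d + α) * f (t • y)) atTop
      (𝓝 (C - 2 ^ (-α) * C)) := by
  have h2 := (hC.comp (tendsto_id.const_mul_atTop (two_pos : (0 : ℝ) < 2))).const_mul
    ((2 : ℝ) ^ (-α))
  refine (hC.sub h2).congr' ?_
  filter_upwards [eventually_gt_atTop 0] with t ht
  rw [setIntegral_annulus_density ha.density ha.continuous ha.pos ht]
  simp only [Function.comp_apply, id]
  rw [Real.mul_rpow two_pos.le ht.le, Real.rpow_neg two_pos.le]
  have : (2 : ℝ) ^ α ≠ 0 := by positivity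
  field_simp

theorem RegularlyVaryingDensity.scaled_eq (ha : RegularlyVaryingDensity P f q V α) {t : ℝ}
    (ht : 0 < t) (y : E d) : t ^ (d + α) * f (t • y)
      = t ^ α * V t * (f (t • y) / (t ^ (-(d : ℝ)) * V t)) := by
  have := ha.regVar.pos t ht
  rw [Real.rpow_add ht, Real.rpow_neg ht.le]
  have : t ^ (d : ℝ) ≠ 0 := by positivity
  field_simp

theorem RegularlyVaryingDensity.integrableOn_annulus (ha : RegularlyVaryingDensity P f q V α) :
    IntegrableOn q (annulus d) := by
  have hc : IsCompact {z : E d | 1 ≤ ‖z‖ ∧ ‖z‖ ≤ 2} := by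
    refine (isCompact_closedBall (0 : E d) 2).of_isClosed_subset
      ((isClosed_le continuous_const continuous_norm).inter
        (isClosed_le continuous_norm continuous_const)) fun z hz => ?_
    simpa using hz.2
  refine IntegrableOn.mono_set (ContinuousOn.integrableOn_compact hc
    (ha.continuousOn_limit.mono fun z hz => ?_)) fun z hz => ⟨hz.1.le, hz.2⟩
  rintro rfl
  have := hz.1
  norm_num at this

theorem RegularlyVaryingDensity.setIntegral_annulus_pos (hd : 0 < d)
    (ha : RegularlyVaryingDensity P f q V α) : 0 < ∫ y in annulus d, q y := by
  rw [setIntegral_pos_iff_support_of_nonneg_ae _ ha.integrableOn_annulus]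
  · refine (volume_annulus_pos hd).trans_le (measure_mono fun z hz => ⟨?_, hz⟩)
    exact (ha.q_pos z (ne_zero_of_mem_annulus hz)).ne'
  · filter_upwards [ae_restrict_mem (measurableSet_annulus d)] with z hz
    exact (ha.q_pos z (ne_zero_of_mem_annulus hz)).le

/-- A Fatou-type argument. Truncating the normalized density at `q` supplies a dominating function,
so its integral tends to `κ = ∫ q > 0`. Multiplied by `t ^ α * V t`, the truncated integral stays
below a convergent quantity, which bounds `t ^ α * V t`. -/
theorem RegularlyVaryingDensity.eventually_rpow_mul_le [IsProbabilityMeasure P] (hd : 0 < d)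
    (ha : RegularlyVaryingDensity P f q V α) {C : ℝ}
    (hC : Tendsto (fun s : ℝ => s ^ α * P.real {z | s < ‖z‖}) atTop (𝓝 C)) :
    ∃ M, 0 < M ∧ ∀ᶠ t : ℝ in atTop, t ^ α * V t ≤ M := by
  have hqpos := ha.setIntegral_annulus_pos hd
  set κ := ∫ y in annulus d, q y with hκ
  have hmin : Tendsto (fun t : ℝ => ∫ y in annulus d,
      min (f (t • y) / (t ^ (-(d : ℝ)) * V t)) (q y)) atTop (𝓝 κ) := by
    refine tendsto_integral_filter_of_dominated_convergence q ?_ ?_ ha.integrableOn_annulus ?_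
    · refine Eventually.of_forall fun t => ?_
      have := ha.continuous
      exact (by fun_prop : Continuous fun y : E d =>
        f (t • y) / (t ^ (-(d : ℝ)) * V t)).aestronglyMeasurable.inf
          ha.integrableOn_annulus.aestronglyMeasurable
    · filter_upwards [eventually_gt_atTop 0] with t ht
      filter_upwards [ae_restrict_mem (measurableSet_annulus d)] with y hy
      have h1 := ha.q_pos y (ne_zero_of_mem_annulus hy)
      have h2 := ha.regVar.pos t ht
      have h3 := ha.pos (t • y)
      rw [Real.norm_eq_abs, abs_of_pos (lt_min (by positivity) h1)]
      exact min_le_right _ _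
    · filter_upwards [ae_restrict_mem (measurableSet_annulus d)] with y hy
      have := (ha.tendsto y (ne_zero_of_mem_annulus hy)).min (tendsto_const_nhds (x := q y))
      rwa [min_self] at this
  have hI := ha.tendsto_setIntegral_annulus hC
  set D := C - 2 ^ (-α) * C
  refine ⟨2 * (|D| + 1) / κ, by positivity, ?_⟩
  filter_upwards [eventually_gt_atTop 0, hmin.eventually_const_lt (half_lt_self hqpos),
    hI.eventually_lt_const (lt_of_le_of_lt (le_abs_self D) (lt_add_one _))] with t ht h1 h2
  have hV := ha.regVar.pos t ht
  have hL : 0 < t ^ α * V t := by positivity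
  have hle : t ^ α * V t * ∫ y in annulus d, min (f (t • y) / (t ^ (-(d : ℝ)) * V t)) (q y)
      ≤ ∫ y in annulus d, t ^ (d + α) * f (t • y) := by
    rw [← integral_const_mul]
    refine integral_mono_of_nonneg ?_ ?_ ?_
    · filter_upwards [ae_restrict_mem (measurableSet_annulus d)] with y hy
      have h1 := ha.q_pos y (ne_zero_of_mem_annulus hy)
      have h3 := ha.pos (t • y)
      exact mul_nonneg hL.le (le_min (by positivity) h1.le)
    · have := ha.continuous
      exact ((by fun_prop : Continuous fun y : E d => t ^ (d + α) * f (t • y)).continuousOn.integrableOn_compact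
        (isCompact_closedBall 0 2)).mono_set (annulus_subset_closedBall d)
    · refine Eventually.of_forall fun y => ?_
      simp only
      rw [ha.scaled_eq ht]
      exact mul_le_mul_of_nonneg_left (min_le_left _ _) hL.le
  rw [le_div_iff₀ hqpos]
  nlinarith

/-- The boundedness of `t ^ α * V t` now permits dominated convergence without truncation: the
annulus integral of the scaled density differs by `o(1)` from `t ^ α * V t * ∫ q`. The former
converges to `(1 - 2 ^ (-α)) C`, so the limit is read off after division by `∫ q`. -/
theorem RegularlyVaryingDensity.exists_tendsto_rpow_mul [IsProbabilityMeasure P] (hd : 0 < d)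
    (ha : RegularlyVaryingDensity P f q V α) {C : ℝ} (hCpos : 0 < C)
    (hC : Tendsto (fun s : ℝ => s ^ α * P.real {z | s < ‖z‖}) atTop (𝓝 C)) :
    ∃ l, 0 < l ∧ Tendsto (fun t : ℝ => t ^ α * V t) atTop (𝓝 l) := by
  obtain ⟨M, hM0, hM⟩ := ha.eventually_rpow_mul_le hd hC
  obtain ⟨B, hB0, hB⟩ := ha.exists_limit_le
  have hqpos := ha.setIntegral_annulus_pos hd
  have hunif := (Metric.tendstoUniformlyOn_iff.1 ha.tendstoUniformlyOn) 1 one_pos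
  obtain ⟨T, hT⟩ := eventually_atTop.1 (hunif.and (hM.and (eventually_gt_atTop 0)))
  have hqB : ∀ y ∈ annulus d, q y ≤ B := by
    intro y hy
    have hy0 := ne_zero_of_mem_annulus hy
    rw [ha.limit_eq hy0]
    have h1 : ‖y‖ ^ (-(d + α)) ≤ 1 := Real.rpow_le_one_of_one_le_of_nonpos hy.1.le
      (by have := ha.alpha_pos; have : (0 : ℝ) ≤ d := Nat.cast_nonneg d; linarith)
    have h2 := ha.q_pos _ (smul_ne_zero (inv_ne_zero (norm_ne_zero_iff.2 hy0)) hy0)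
    have h3 := hB _ (norm_inv_smul_mem_sphere hy0)
    nlinarith
  have hdiff : Tendsto (fun t : ℝ => ∫ y in annulus d,
      (t ^ (d + α) * f (t • y) - t ^ α * V t * q y)) atTop (𝓝 (∫ y in annulus d, 0)) := by
    refine tendsto_integral_filter_of_dominated_convergence (fun _ => M * (B + 1) + M * B)
      ?_ ?_ ?_ ?_
    · refine Eventually.of_forall fun t => ?_
      have := ha.continuous
      exact (by fun_prop : Continuous fun y : E d =>
        t ^ (d + α) * f (t • y)).aestronglyMeasurable.sub
          (ha.integrableOn_annulus.aestronglyMeasurable.const_mul _)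
    · filter_upwards [eventually_ge_atTop T] with t ht
      filter_upwards [ae_restrict_mem (measurableSet_annulus d)] with y hy
      have hy0 := ne_zero_of_mem_annulus hy
      have hn : 0 < ‖y‖ := norm_pos_iff.2 hy0
      obtain ⟨-, ht2, ht3⟩ := hT t ht
      -- Uniformity is available on the unit sphere only, so `t • y` is viewed as the point at
      -- radius `t ‖y‖` in direction `y / ‖y‖`; since `‖y‖ > 1`, this radius is still beyond `T`.
      obtain ⟨hs1, hs2, hs3⟩ := hT (t * ‖y‖) (by nlinarith [hy.1])
      have hw := norm_inv_smul_mem_sphere hy0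
      have e1 := hs1 _ hw
      rw [smul_smul, mul_assoc, mul_inv_cancel₀ hn.ne', mul_one, Real.dist_eq] at e1
      have e2 := hB _ hw
      have e3 : f (t • y) / ((t * ‖y‖) ^ (-(d : ℝ)) * V (t * ‖y‖)) ≤ B + 1 := by
        have := (abs_lt.1 e1).1; linarith
      have hVs := ha.regVar.pos _ hs3
      have hVt := ha.regVar.pos _ ht3
      have hf := ha.pos (t • y)
      have e4 : t ^ (d + α) * f (t • y) ≤ M * (B + 1) := by
        have h5 := ha.scaled_eq hs3 (‖y‖⁻¹ • y)
        rw [smul_smul, mul_assoc, mul_inv_cancel₀ hn.ne', mul_one] at h5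
        have h6 : t ^ (d + α) ≤ (t * ‖y‖) ^ (d + α) := by
          have := ha.alpha_pos
          have : (0 : ℝ) ≤ d := Nat.cast_nonneg d
          exact Real.rpow_le_rpow ht3.le (by nlinarith [hy.1]) (by linarith)
        calc t ^ (d + α) * f (t • y) ≤ (t * ‖y‖) ^ (d + α) * f (t • y) := by gcongr
          _ = _ := h5
          _ ≤ M * (B + 1) := by gcongr
      have e5 : t ^ α * V t * q y ≤ M * B := by
        have := hqB y hy
        have := ha.q_pos y hy0
        gcongr
      have e6 : 0 ≤ t ^ (d + α) * f (t • y) := by positivity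
      have e7 : 0 ≤ t ^ α * V t * q y := by
        have := ha.q_pos y hy0
        positivity
      rw [Real.norm_eq_abs, abs_le]
      constructor <;> nlinarith
    · exact integrableOn_const (volume_annulus_lt_top d).ne
    · filter_upwards [ae_restrict_mem (measurableSet_annulus d)] with y hy
      have hlim := (ha.tendsto y (ne_zero_of_mem_annulus hy)).sub_const (q y)
      rw [sub_self] at hlim
      have hbd : IsBoundedUnder (· ≤ ·) atTop (fun t : ℝ => ‖t ^ α * V t‖) := by
        refine ⟨M, ?_⟩
        rw [eventually_map]
        filter_upwards [hM, eventually_gt_atTop 0] with t h1 h2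
        have := ha.regVar.pos t h2
        rwa [Real.norm_eq_abs, abs_of_pos (by positivity)]
      refine (hlim.zero_mul_isBoundedUnder_le hbd).congr' ?_
      filter_upwards [eventually_gt_atTop 0] with t ht
      rw [ha.scaled_eq ht]
      ring
  rw [integral_zero] at hdiff
  have hI := ha.tendsto_setIntegral_annulus hC
  have hα := ha.alpha_pos
  have hlt : (2 : ℝ) ^ (-α) < 1 := Real.rpow_lt_one_of_one_lt_of_neg one_lt_two (by linarith)
  refine ⟨(C - 2 ^ (-α) * C) / ∫ y in annulus d, q y, div_pos (by nlinarith) hqpos, ?_⟩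
  have h := (hI.sub hdiff).div_const (∫ y in annulus d, q y)
  rw [sub_zero] at h
  refine h.congr fun t => ?_
  have hint : IntegrableOn (fun y : E d => t ^ (d + α) * f (t • y)) (annulus d) := by
    have := ha.continuous
    exact ((by fun_prop : Continuous fun y : E d => t ^ (d + α) * f (t • y)).continuousOn.integrableOn_compact
      (isCompact_closedBall 0 2)).mono_set (annulus_subset_closedBall d)
  rw [integral_sub hint (ha.integrableOn_annulus.const_mul _), integral_const_mul (t ^ α * V t) q]
  field_simp
  ring

theorem RegularlyVaryingDensity.exists_homogeneousTail [IsProbabilityMeasure P] (hd : 0 < d)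
    (ha : RegularlyVaryingDensity P f q V α) {C : ℝ} (hCpos : 0 < C)
    (hC : Tendsto (fun s : ℝ => s ^ α * P.real {z | s < ‖z‖}) atTop (𝓝 C)) :
    ∃ g, HomogeneousTail P f g α := by
  obtain ⟨l, hl0, hl⟩ := ha.exists_tendsto_rpow_mul hd hCpos hC
  obtain ⟨M, hM0, hM⟩ := ha.eventually_rpow_mul_le hd hC
  obtain ⟨B, hB0, hB⟩ := ha.exists_limit_le
  refine ⟨fun z => l * q z, ha.alpha_pos, ha.density, ha.continuous, ha.pos,
    continuousOn_const.mul ha.continuousOn_limit, fun z hz => mul_pos hl0 (ha.q_pos z hz),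
    fun z hz => ?_, fun ε hε => ?_⟩
  · rw [ha.limit_eq hz]; ring
  -- With `L = t ^ α * V t ≤ M` and `q ≤ B` on the sphere, the error `L a - l q = L (a - q) + (L -
  -- l) q` is split into two halves of `ε`.
  have hunif := (Metric.tendstoUniformlyOn_iff.1 ha.tendstoUniformlyOn) (ε / (2 * M))
    (by positivity)
  have hl' := (Metric.tendsto_nhds.1 hl) (ε / (2 * B)) (by positivity)
  obtain ⟨T, hT⟩ := eventually_atTop.1 (hunif.and (hM.and hl'))
  refine ⟨max T 1, by positivity, fun z hz => ?_⟩
  have hn : 0 < ‖z‖ := zero_lt_one.trans_le ((le_max_right _ _).trans hz)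
  have hz0 : z ≠ 0 := norm_pos_iff.1 hn
  obtain ⟨h1, h2, h3⟩ := hT ‖z‖ ((le_max_left _ _).trans hz)
  have hw := norm_inv_smul_mem_sphere hz0
  have e1 := h1 _ hw
  have e2 := hB _ hw
  have e0 := ha.q_pos _ (smul_ne_zero (inv_ne_zero (norm_ne_zero_iff.2 hz0)) hz0)
  have e3 := ha.scaled_eq hn (‖z‖⁻¹ • z)
  rw [smul_smul, mul_inv_cancel₀ hn.ne', one_smul] at e1 e3
  rw [Real.dist_eq] at e1 h3
  set a := f z / (‖z‖ ^ (-(d : ℝ)) * V ‖z‖)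
  set w := ‖z‖⁻¹ • z
  have hV := ha.regVar.pos _ hn
  have e4 : f z = ‖z‖ ^ (-(d + α)) * (‖z‖ ^ α * V ‖z‖ * a) := by
    rw [← e3, ← mul_assoc, ← Real.rpow_add hn]; simp
  rw [ha.limit_eq hz0, e4]
  have hp : 0 < ‖z‖ ^ (-(d + α)) := by positivity
  have e5 : ‖z‖ ^ (-(d + α)) * (‖z‖ ^ α * V ‖z‖ * a) - l * (‖z‖ ^ (-(d + α)) * q w)
      = (‖z‖ ^ α * V ‖z‖ * (a - q w) + (‖z‖ ^ α * V ‖z‖ - l) * q w) * ‖z‖ ^ (-(d + α)) := by ring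
  rw [e5, abs_mul, abs_of_pos hp]
  refine mul_le_mul_of_nonneg_right ?_ hp.le
  refine (abs_add_le _ _).trans ?_
  rw [abs_mul _ (a - q w), abs_mul _ (q w), abs_of_pos e0,
    abs_of_pos (by positivity : 0 < ‖z‖ ^ α * V ‖z‖)]
  have e6 : ‖z‖ ^ α * V ‖z‖ * |a - q w| ≤ M * (ε / (2 * M)) := by
    rw [abs_sub_comm] at e1
    gcongr
  have e7 : |‖z‖ ^ α * V ‖z‖ - l| * q w ≤ ε / (2 * B) * B := by gcongr
  have e8 : M * (ε / (2 * M)) + ε / (2 * B) * B = ε := by field_simp; ring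
  linarith

end RegularVariation

/-! ### Polar coordinates -/

theorem lintegral_polar {d : ℕ} (hd : 0 < d) {Φ : E d → ENNReal} (hΦ : Measurable Φ) :
    ∫⁻ z, Φ z = ∫⁻ w : Theta d, (∫⁻ r in Ioi (0 : ℝ),
      Φ (r • (w : E d)) * ENNReal.ofReal (r ^ (d - 1))) ∂(surf d) := by
  have := nontrivial_E hd
  have hmp := (volume : Measure (E d)).measurePreserving_homeomorphUnitSphereProd
  have hΨ : Measurable fun x : Theta d × Ioi (0 : ℝ) => Φ ((x.2 : ℝ) • (x.1 : E d)) := by fun_prop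
  calc ∫⁻ z, Φ z = ∫⁻ z in ({0}ᶜ : Set (E d)), Φ z := by
        rw [restrict_compl_singleton]
    _ = ∫⁻ z : ({0}ᶜ : Set (E d)), Φ z ∂(volume.comap Subtype.val) :=
        (lintegral_subtype_comap (measurableSet_singleton _).compl Φ).symm
    _ = ∫⁻ x, Φ ((x.2 : ℝ) • (x.1 : E d))
          ∂((volume : Measure (E d)).toSphere.prod
            (Measure.volumeIoiPow (Module.finrank ℝ (E d) - 1))) := by
        rw [← hmp.lintegral_comp hΨ]
        refine lintegral_congr fun z => ?_
        have hz : ‖(z : E d)‖ ≠ 0 := norm_ne_zero_iff.2 z.2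
        simp [smul_smul, mul_inv_cancel₀ hz]
    _ = _ := by
        rw [lintegral_prod _ hΨ.aemeasurable, surf]
        refine lintegral_congr fun w => ?_
        rw [Measure.volumeIoiPow, lintegral_withDensity_eq_lintegral_mul _ (by fun_prop)
          (by fun_prop), finrank_euclideanSpace_fin,
          ← lintegral_subtype_comap measurableSet_Ioi
            fun r : ℝ => Φ (r • (w : E d)) * ENNReal.ofReal (r ^ (d - 1))]
        refine lintegral_congr fun r => ?_
        simp [mul_comm]

/-- The points outside of the star-shaped region with radial function `ρ`. -/
def outside {d : ℕ} (ρ : E d → ℝ) : Set (E d) := {z | z ≠ 0 ∧ ρ (‖z‖⁻¹ • z) < ‖z‖}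

theorem measurableSet_outside {d : ℕ} {ρ : E d → ℝ} (hρ : Measurable ρ) :
    MeasurableSet (outside ρ) :=
  (measurableSet_singleton (0 : E d)).compl.inter (measurableSet_lt (by fun_prop) measurable_norm)

theorem outside_const {d : ℕ} {t : ℝ} (ht : 0 < t) :
    outside (fun _ : E d => t) = {z | t < ‖z‖} := by
  ext z
  simp only [outside, mem_ofPred_eq, and_iff_right_iff_imp]
  exact fun h => norm_pos_iff.1 (ht.trans h)

theorem normalize_smul {d : ℕ} {r : ℝ} (hr : 0 < r) (w : Theta d) :
    ‖r • (w : E d)‖ = r ∧ ‖r • (w : E d)‖⁻¹ • (r • (w : E d)) = w := by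
  have h : ‖r • (w : E d)‖ = r := by simp [norm_smul, abs_of_pos hr]
  exact ⟨h, by rw [h, smul_smul, inv_mul_cancel₀ hr.ne', one_smul]⟩

/-- In polar coordinates the radial integrand is `r ^ (-(d + α)) * r ^ (d - 1) = r ^ (-α - 1)`, and
its integral over `(ρ w, ∞)` is `ρ w ^ (-α) / α`. -/
theorem lintegral_outside {d : ℕ} (hd : 0 < d) {α : ℝ} (hα : 0 < α) {k ρ : E d → ℝ}
    (hk : Measurable k) (hρ : Measurable ρ) (hk0 : ∀ w ∈ sphere (0 : E d) 1, 0 ≤ k w)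
    (hρ0 : ∀ w ∈ sphere (0 : E d) 1, 0 < ρ w) :
    ∫⁻ z in outside ρ, ENNReal.ofReal (k (‖z‖⁻¹ • z) * ‖z‖ ^ (-(d + α)))
      = ∫⁻ w : Theta d, ENNReal.ofReal (k w * (ρ w ^ (-α) / α)) ∂(surf d) := by
  rw [← lintegral_indicator (measurableSet_outside hρ), lintegral_polar hd
    ((by fun_prop : Measurable fun z : E d =>
      ENNReal.ofReal (k (‖z‖⁻¹ • z) * ‖z‖ ^ (-(d + α)))).indicator (measurableSet_outside hρ))]
  refine lintegral_congr fun w => ?_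
  have hw := hρ0 w w.2
  have hkw := hk0 w w.2
  have hint : IntegrableOn (fun r : ℝ => k w * r ^ (-α - 1)) (Ioi (ρ w)) :=
    (integrableOn_Ioi_rpow_of_lt (by linarith) hw).const_mul _
  have hval : ∫ r in Ioi (ρ w), k w * r ^ (-α - 1) = k w * (ρ w ^ (-α) / α) := by
    rw [integral_const_mul, integral_Ioi_rpow_of_lt (by linarith) hw, sub_add_cancel, neg_div_neg_eq]
  rw [← hval, ofReal_integral_eq_lintegral_ofReal hint]
  · rw [← lintegral_indicator measurableSet_Ioi, ← lintegral_indicator measurableSet_Ioi]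
    refine lintegral_congr fun r => ?_
    by_cases hr : 0 < r
    · obtain ⟨h1, h2⟩ := normalize_smul hr w
      have hr0 : r • (w : E d) ≠ 0 := norm_pos_iff.1 (by rwa [h1])
      rw [indicator_of_mem (show r ∈ Ioi 0 from hr)]
      by_cases hrw : ρ w < r
      · rw [indicator_of_mem (show r ∈ Ioi (ρ w) from hrw), indicator_of_mem, h2, h1,
          ← ENNReal.ofReal_mul (by positivity), mul_assoc, ← Real.rpow_natCast, ← Real.rpow_add hr,
          Nat.cast_pred hd]
        · congr 3; ring
        · refine ⟨hr0, ?_⟩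
          rwa [h2, h1]
      · rw [indicator_of_notMem (show r ∉ Ioi (ρ w) from hrw), indicator_of_notMem, zero_mul]
        rintro ⟨-, h⟩
        rw [h2, h1] at h
        exact hrw h
    · rw [indicator_of_notMem (show r ∉ Ioi 0 from hr), indicator_of_notMem]
      exact fun h => hr (hw.trans h)
  · filter_upwards [ae_restrict_mem measurableSet_Ioi] with r hr
    have : 0 < r := hw.trans hr
    positivity

section Outside

variable {d : ℕ} {α : ℝ} {k ρ : E d → ℝ}

theorem setIntegral_outside (hd : 0 < d) (hα : 0 < α)
    (hk : Measurable k) (hρ : Measurable ρ) (hk0 : ∀ w ∈ sphere (0 : E d) 1, 0 ≤ k w)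
    (hρ0 : ∀ w ∈ sphere (0 : E d) 1, 0 < ρ w) :
    ∫ z in outside ρ, k (‖z‖⁻¹ • z) * ‖z‖ ^ (-(d + α))
      = ∫ w : Theta d, k w * (ρ w ^ (-α) / α) ∂(surf d) := by
  rw [integral_eq_lintegral_of_nonneg_ae, integral_eq_lintegral_of_nonneg_ae,
    lintegral_outside hd hα hk hρ hk0 hρ0]
  · refine Eventually.of_forall fun w => ?_
    have := hρ0 w w.2
    have := hk0 w w.2
    simp only [Pi.zero_apply]
    positivity
  · exact (by fun_prop : Measurable fun w : Theta d =>
      k w * (ρ w ^ (-α) / α)).aestronglyMeasurable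
  · filter_upwards [ae_restrict_mem (measurableSet_outside hρ)] with z hz
    have := hk0 _ (norm_inv_smul_mem_sphere hz.1)
    simp only [Pi.zero_apply]
    positivity
  · exact (by fun_prop : Measurable fun z : E d =>
      k (‖z‖⁻¹ • z) * ‖z‖ ^ (-(d + α))).aestronglyMeasurable

theorem integrableOn_outside (hd : 0 < d) (hα : 0 < α)
    (hk : Measurable k) (hρ : Measurable ρ) (hk0 : ∀ w ∈ sphere (0 : E d) 1, 0 ≤ k w)
    (hρ0 : ∀ w ∈ sphere (0 : E d) 1, 0 < ρ w)
    (hint : Integrable (fun w : Theta d => k w * (ρ w ^ (-α) / α)) (surf d)) :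
    IntegrableOn (fun z => k (‖z‖⁻¹ • z) * ‖z‖ ^ (-(d + α))) (outside ρ) := by
  refine ⟨(by fun_prop : Measurable fun z : E d =>
      k (‖z‖⁻¹ • z) * ‖z‖ ^ (-(d + α))).aestronglyMeasurable, ?_⟩
  rw [hasFiniteIntegral_iff_ofReal, lintegral_outside hd hα hk hρ hk0 hρ0,
    ← hasFiniteIntegral_iff_ofReal]
  · exact hint.2
  · refine Eventually.of_forall fun w => ?_
    have := hρ0 w w.2
    have := hk0 w w.2
    simp only [Pi.zero_apply]
    positivity
  · filter_upwards [ae_restrict_mem (measurableSet_outside hρ)] with z hz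
    have := hk0 _ (norm_inv_smul_mem_sphere hz.1)
    simp only [Pi.zero_apply]
    positivity

end Outside

instance isFiniteMeasure_surf (d : ℕ) : IsFiniteMeasure (surf d) := by
  unfold surf; infer_instance

instance isOpenPosMeasure_surf (d : ℕ) : (surf d).IsOpenPosMeasure := by
  unfold surf; infer_instance

/-- A continuous function on the sphere is integrable. -/
theorem integrable_surf_of_continuous {d : ℕ} {φ : Theta d → ℝ} (hφ : Continuous φ) :
    Integrable φ (surf d) := by
  simpa using hφ.continuousOn.integrableOn_compact (μ := surf d) isCompact_univ

/-! ### Tails, level sets and risk regions under a homogeneous tail. -/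

namespace HomogeneousTail

variable {d : ℕ} {P : Measure (E d)} {f g : E d → ℝ} {α : ℝ}

theorem measurable_limit (H : HomogeneousTail P f g α) : Measurable g :=
  measurable_of_continuousOn_compl_singleton 0 H.continuousOn

theorem sphere_ne_zero {w : E d} (hw : w ∈ sphere (0 : E d) 1) : w ≠ 0 := by
  rintro rfl
  simp at hw

theorem pos_on_sphere (H : HomogeneousTail P f g α) {w : E d} (hw : w ∈ sphere (0 : E d) 1) :
    0 < g w := H.limit_pos w (sphere_ne_zero hw)

theorem continuous_sphere (H : HomogeneousTail P f g α) : Continuous fun w : Theta d => g w :=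
  H.continuousOn.comp_continuous continuous_subtype_val fun w => sphere_ne_zero w.2

theorem exists_le_limit (H : HomogeneousTail P f g α) :
    ∃ m, 0 < m ∧ ∀ w ∈ sphere (0 : E d) 1, m ≤ g w := by
  rcases (sphere (0 : E d) 1).eq_empty_or_nonempty with h | h
  · exact ⟨1, one_pos, by simp [h]⟩
  obtain ⟨w, hw, hmin⟩ := (isCompact_sphere (0 : E d) 1).exists_isMinOn h
    (H.continuousOn.mono fun z hz => sphere_ne_zero hz)
  exact ⟨g w, H.pos_on_sphere hw, fun v hv => hmin hv⟩

/-- Compactness gives `g ≥ m` on the sphere, hence `g z ≥ m ‖z‖ ^ (-(d + α))`, so the absolute error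
becomes a relative one. -/
theorem rel_approx (H : HomogeneousTail P f g α) {ε : ℝ} (hε : 0 < ε) :
    ∃ T, 0 < T ∧ ∀ z, T ≤ ‖z‖ → |f z - g z| ≤ ε * g z := by
  obtain ⟨m, hm, hmg⟩ := H.exists_le_limit
  obtain ⟨T, hT, hTz⟩ := H.approx (ε * m) (by positivity)
  refine ⟨T, hT, fun z hz => (hTz z hz).trans ?_⟩
  have hz0 : z ≠ 0 := norm_pos_iff.1 (hT.trans_le hz)
  rw [H.homogeneous z hz0]
  have := hmg _ (norm_inv_smul_mem_sphere hz0)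
  have hp : 0 < ‖z‖ ^ (-(d + α)) := by
    have := norm_pos_iff.2 hz0
    positivity
  calc ε * m * ‖z‖ ^ (-(d + α)) = ε * (‖z‖ ^ (-(d + α)) * m) := by ring
    _ ≤ _ := by gcongr

/-- Far away from the origin, integrals of `f` are close to integrals of `g`. -/
theorem abs_setIntegral_sub_le {ε T : ℝ}
    (hT : ∀ z, T ≤ ‖z‖ → |f z - g z| ≤ ε * g z) {s : Set (E d)} (hs : MeasurableSet s)
    (hsT : ∀ z ∈ s, T ≤ ‖z‖) {φ : E d → ℝ} (hφ0 : ∀ z, 0 ≤ φ z)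
    (hf : IntegrableOn (fun z => φ z * f z) s) (hg : IntegrableOn (fun z => φ z * g z) s) :
    |(∫ z in s, φ z * f z) - ∫ z in s, φ z * g z| ≤ ε * ∫ z in s, φ z * g z := by
  rw [← integral_sub hf hg, ← integral_const_mul, ← Real.norm_eq_abs]
  refine norm_integral_le_of_norm_le (hg.const_mul _) ?_
  filter_upwards [ae_restrict_mem hs] with z hz
  rw [← mul_sub, Real.norm_eq_abs, abs_mul, abs_of_nonneg (hφ0 z)]
  calc φ z * |f z - g z| ≤ φ z * (ε * g z) :=
        mul_le_mul_of_nonneg_left (hT z (hsT z hz)) (hφ0 z)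
    _ = _ := by ring

/-- The expectation of a function of the direction of `z`, over `‖z‖ > t`. -/
theorem abs_integral_indicator_sub_le [IsProbabilityMeasure P] (H : HomogeneousTail P f g α)
    (hd : 0 < d) {ε : ℝ} (hε : 0 < ε) : ∃ T, 0 < T ∧ ∀ t, T ≤ t → ∀ φ : E d → ℝ, Measurable φ →
      (∀ z, 0 ≤ φ z) → (∀ z, φ z ≤ 1) →
      |(∫ z, {z | t < ‖z‖}.indicator (fun z => φ (‖z‖⁻¹ • z)) z ∂P)
          - t ^ (-α) / α * ∫ w : Theta d, φ w * g w ∂(surf d)|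
        ≤ ε * (t ^ (-α) / α * ∫ w : Theta d, φ w * g w ∂(surf d)) := by
  obtain ⟨T, hT, hTz⟩ := H.rel_approx hε
  refine ⟨T, hT, fun t ht φ hφ hφ0 hφ1 => ?_⟩
  have ht0 : 0 < t := hT.trans_le ht
  have hgm := H.measurable_limit
  have hm : MeasurableSet {z : E d | t < ‖z‖} := measurableSet_lt measurable_const measurable_norm
  have hk0 : ∀ w ∈ sphere (0 : E d) 1, 0 ≤ φ w * g w :=
    fun w hw => mul_nonneg (hφ0 w) (H.pos_on_sphere hw).le
  have hintS : Integrable (fun w : Theta d => φ w * g w) (surf d) := by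
    refine (integrable_surf_of_continuous H.continuous_sphere).bdd_mul (c := 1)
      (by fun_prop : Measurable fun w : Theta d => φ w).aestronglyMeasurable
      (Eventually.of_forall fun w => ?_)
    rw [Real.norm_eq_abs, abs_of_nonneg (hφ0 _)]
    exact hφ1 _
  have heq : EqOn (fun z => φ (‖z‖⁻¹ • z) * g (‖z‖⁻¹ • z) * ‖z‖ ^ (-(d + α)))
      (fun z => φ (‖z‖⁻¹ • z) * g z) {z : E d | t < ‖z‖} := by
    intro z hz
    simp only
    rw [H.homogeneous z (norm_pos_iff.1 (ht0.trans hz))]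
    ring
  have h1 := setIntegral_outside hd H.alpha_pos (k := fun w => φ w * g w) (by fun_prop)
    (measurable_const (a := t)) hk0 (fun _ _ => ht0)
  have h2 := integrableOn_outside hd H.alpha_pos (k := fun w => φ w * g w) (by fun_prop)
    (measurable_const (a := t)) hk0 (fun _ _ => ht0) (hintS.mul_const _)
  rw [outside_const ht0] at h1 h2
  rw [setIntegral_congr_fun hm heq, integral_mul_const, mul_comm (∫ w : Theta d, _ ∂_)] at h1
  have h3 : IntegrableOn (fun z => φ (‖z‖⁻¹ • z) * g z) {z : E d | t < ‖z‖} :=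
    h2.congr_fun heq hm
  have h4 : IntegrableOn (fun z => φ (‖z‖⁻¹ • z) * f z) {z : E d | t < ‖z‖} := by
    refine ((integrable_density H.density H.continuous H.pos).bdd_mul (c := 1)
      (by fun_prop : Measurable fun z : E d => φ (‖z‖⁻¹ • z)).aestronglyMeasurable
      (Eventually.of_forall fun z => ?_)).integrableOn
    rw [Real.norm_eq_abs, abs_of_nonneg (hφ0 _)]
    exact hφ1 _
  have h5 := abs_setIntegral_sub_le hTz hm (fun z hz => ht.trans (le_of_lt hz))
    (φ := fun z => φ (‖z‖⁻¹ • z)) (fun z => hφ0 _) h4 h3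
  rw [h1] at h5
  rw [integral_eq_integral_density H.density H.continuous H.pos]
  have h6 : ∫ z, {z : E d | t < ‖z‖}.indicator (fun z => φ (‖z‖⁻¹ • z)) z * f z
      = ∫ z in {z : E d | t < ‖z‖}, φ (‖z‖⁻¹ • z) * f z := by
    rw [← integral_indicator hm]
    refine integral_congr_ae (Eventually.of_forall fun z => ?_)
    by_cases hz : z ∈ {z : E d | t < ‖z‖} <;> simp only [hz, not_false_eq_true,
      indicator_of_mem, indicator_of_notMem, zero_mul]
  rwa [h6]

theorem tendsto_tail [IsProbabilityMeasure P] (H : HomogeneousTail P f g α) (hd : 0 < d) :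
    Tendsto (fun t : ℝ => t ^ α * P.real {z | t < ‖z‖}) atTop
      (𝓝 (α⁻¹ * ∫ w : Theta d, g w ∂(surf d))) := by
  have hI : 0 ≤ ∫ w : Theta d, g w ∂(surf d) :=
    integral_nonneg fun w => (H.pos_on_sphere w.2).le
  set I := ∫ w : Theta d, g w ∂(surf d)
  have hα := H.alpha_pos
  rw [Metric.tendsto_atTop]
  intro ε hε
  obtain ⟨T, hT, h⟩ := H.abs_integral_indicator_sub_le hd
    (show 0 < ε / (α⁻¹ * I + 1) by positivity)
  refine ⟨T, fun t ht => ?_⟩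
  have ht0 : 0 < t := hT.trans_le ht
  have := h t ht (fun _ => 1) measurable_const (by simp) (by simp)
  simp only [one_mul] at this
  have h1 : ∫ z, {z : E d | t < ‖z‖}.indicator (fun _ => (1 : ℝ)) z ∂P = P.real {z | t < ‖z‖} :=
    integral_indicator_one (measurableSet_lt measurable_const measurable_norm)
  rw [h1] at this
  have ht1 : 0 < t ^ α := by positivity
  have h2 := mul_le_mul_of_nonneg_left this ht1.le
  have h3 : t ^ α * (t ^ (-α) / α * I) = α⁻¹ * I := by
    rw [Real.rpow_neg ht0.le]; field_simp
  rw [← abs_of_pos ht1, ← abs_mul, abs_of_pos ht1, mul_sub, h3, mul_left_comm, h3] at h2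
  rw [Real.dist_eq]
  refine h2.trans_lt ?_
  have h4 : 0 ≤ α⁻¹ * I := by positivity
  rw [div_mul_eq_mul_div, div_lt_iff₀ (by linarith)]
  nlinarith

/-- The sublevel set `{z ≠ 0 : g(z) < b}` of the limiting density. -/
def level (g : E d → ℝ) (b : ℝ) : Set (E d) := {z | z ≠ 0 ∧ g z < b}

theorem measurableSet_level (H : HomogeneousTail P f g α) (b : ℝ) : MeasurableSet (level g b) :=
  (measurableSet_singleton (0 : E d)).compl.inter
    (measurableSet_lt H.measurable_limit measurable_const)

theorem dim_add_pos (H : HomogeneousTail P f g α) : 0 < (d : ℝ) + α := by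
  have := H.alpha_pos
  positivity

/-- Along each ray `g` is a decreasing power, so `g < b` is solved explicitly for the radius. -/
theorem level_eq_outside (H : HomogeneousTail P f g α) {b : ℝ} (hb : 0 < b) :
    level g b = outside fun w => (g w / b) ^ (1 / (d + α)) := by
  ext z
  simp only [level, outside, mem_ofPred_eq]
  refine and_congr_right fun hz => ?_
  have hn := norm_pos_iff.2 hz
  have hg := H.pos_on_sphere (norm_inv_smul_mem_sphere hz)
  rw [H.homogeneous z hz, Real.rpow_neg hn.le, ← div_eq_inv_mul, div_lt_comm₀ (by positivity) hb,
    one_div, Real.rpow_inv_lt_iff_of_pos (by positivity) hn.le H.dim_add_pos]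

/-- The mass `ν{g ≤ 1} = α⁻¹ ∫_Θ g^{d/(d+α)} dλ`. -/
def levelMass (g : E d → ℝ) (α : ℝ) : ℝ :=
  α⁻¹ * ∫ w : Theta d, g w ^ ((d : ℝ) / (d + α)) ∂(surf d)

theorem levelMass_pos (H : HomogeneousTail P f g α) (hd : 0 < d) : 0 < levelMass g α := by
  have := nontrivial_E hd
  have hα := H.alpha_pos
  refine mul_pos (by positivity) ?_
  have hc : Continuous fun w : Theta d => g w ^ ((d : ℝ) / (d + α)) :=
    H.continuous_sphere.rpow_const fun w => Or.inl (H.pos_on_sphere w.2).ne'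
  rw [integral_pos_iff_support_of_nonneg (fun w => by
    have := H.pos_on_sphere w.2; simp only [Pi.zero_apply]; positivity)
    (integrable_surf_of_continuous hc)]
  have hs : (Function.support fun w : Theta d => g w ^ ((d : ℝ) / (d + α))) = univ := by
    ext w
    have := H.pos_on_sphere w.2
    simp only [Function.mem_support, mem_univ, iff_true]
    positivity
  rw [hs, Measure.measure_univ_pos, surf]
  exact Measure.toSphere_ne_zero _

/-- The boundary radius `(g w / b) ^ (1 / (d + α))` is inserted into the polar formula; the exponent
of `g w` becomes `1 - α / (d + α) = d / (d + α)`. -/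
theorem integrableOn_level (H : HomogeneousTail P f g α) (hd : 0 < d) {b : ℝ} (hb : 0 < b) :
    IntegrableOn g (level g b) ∧
      ∫ z in level g b, g z = b ^ (α / (d + α)) * levelMass g α := by
  have hgm := H.measurable_limit
  have hm := H.measurableSet_level b
  have hα := H.alpha_pos
  have hdα := H.dim_add_pos
  have hρ0 : ∀ w ∈ sphere (0 : E d) 1, 0 < (g w / b) ^ (1 / (d + α)) := fun w hw => by
    have := H.pos_on_sphere hw
    positivity
  have heq : EqOn (fun z => g (‖z‖⁻¹ • z) * ‖z‖ ^ (-(d + α))) g (level g b) := by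
    intro z hz
    simp only
    rw [H.homogeneous z hz.1]
    ring
  have hval : ∀ w : Theta d, g w * (((g w / b) ^ (1 / (d + α))) ^ (-α) / α)
      = b ^ (α / (d + α)) * (α⁻¹ * g w ^ ((d : ℝ) / (d + α))) := by
    intro w
    have hg := H.pos_on_sphere w.2
    rw [← Real.rpow_mul (by positivity), Real.div_rpow hg.le hb.le,
      show 1 / (d + α) * -α = -(α / (d + α)) by ring, Real.rpow_neg hb.le,
      show (d : ℝ) / (d + α) = 1 + -(α / (d + α)) by field_simp; ring, Real.rpow_add hg,
      Real.rpow_one]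
    have : b ^ (α / (d + α)) ≠ 0 := by positivity
    field_simp
  have hc : Continuous fun w : Theta d => g w ^ ((d : ℝ) / (d + α)) :=
    H.continuous_sphere.rpow_const fun w => Or.inl (H.pos_on_sphere w.2).ne'
  have h1 := setIntegral_outside hd H.alpha_pos hgm
    (by fun_prop : Measurable fun w => (g w / b) ^ (1 / (d + α)))
    (fun w hw => (H.pos_on_sphere hw).le) hρ0
  have h2 := integrableOn_outside hd H.alpha_pos hgm
    (by fun_prop : Measurable fun w => (g w / b) ^ (1 / (d + α)))
    (fun w hw => (H.pos_on_sphere hw).le) hρ0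
    (by simp_rw [hval]; exact ((integrable_surf_of_continuous hc).const_mul _).const_mul _)
  rw [← H.level_eq_outside hb] at h1 h2
  refine ⟨h2.congr_fun heq hm, ?_⟩
  rw [← setIntegral_congr_fun hm heq, h1]
  simp_rw [hval]
  rw [integral_const_mul, integral_const_mul, levelMass]

/-- On a punctured ball `g` is bounded below by a positive constant, so low level sets avoid it and
the tail approximation applies on all of them. -/
theorem eventually_level_far (H : HomogeneousTail P f g α) (T : ℝ) :
    ∀ᶠ b in 𝓝[>] (0 : ℝ), ∀ z ∈ level g b, T ≤ ‖z‖ := by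
  obtain ⟨m, hm, hmg⟩ := H.exists_le_limit
  have hb : ∀ᶠ b in 𝓝[>] (0 : ℝ), b < m * (|T| + 1) ^ (-(d + α)) :=
    nhdsWithin_le_nhds (eventually_lt_nhds (by positivity))
  filter_upwards [hb] with b hb z hz
  by_contra hc
  have hn := norm_pos_iff.2 hz.1
  have h1 : ‖z‖ ≤ |T| + 1 := by linarith [le_abs_self T, not_le.1 hc]
  have h2 : (|T| + 1) ^ (-(d + α)) ≤ ‖z‖ ^ (-(d + α)) :=
    Real.rpow_le_rpow_of_nonpos hn h1 (by linarith [H.dim_add_pos])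
  have h3 := hmg _ (norm_inv_smul_mem_sphere hz.1)
  have h4 := hz.2
  rw [H.homogeneous z hz.1] at h4
  have h6 := H.pos_on_sphere (norm_inv_smul_mem_sphere hz.1)
  have h5 : m * (|T| + 1) ^ (-(d + α)) ≤ g (‖z‖⁻¹ • z) * ‖z‖ ^ (-(d + α)) := by gcongr
  linarith

theorem tendsto_real_level [IsProbabilityMeasure P] (H : HomogeneousTail P f g α) (hd : 0 < d) :
    Tendsto (fun b : ℝ => P.real (level g b) / b ^ (α / (d + α))) (𝓝[>] 0)
      (𝓝 (levelMass g α)) := by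
  have hM := H.levelMass_pos hd
  rw [Metric.tendsto_nhds]
  intro ε hε
  obtain ⟨T, hT, hTz⟩ := H.rel_approx (show 0 < ε / (2 * levelMass g α) by positivity)
  filter_upwards [H.eventually_level_far T, self_mem_nhdsWithin] with b hb hb0
  have hb0' : 0 < b := hb0
  have hm := H.measurableSet_level b
  obtain ⟨h1, h2⟩ := H.integrableOn_level hd hb0
  have h3 := abs_setIntegral_sub_le hTz hm hb (φ := fun _ => 1) (by simp)
    (by simpa using (integrable_density H.density H.continuous H.pos).integrableOn)
    (by simpa using h1)
  simp only [one_mul] at h3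
  rw [← real_eq_setIntegral_density H.density H.continuous H.pos hm, h2] at h3
  have hp : 0 < b ^ (α / (d + α)) := by positivity
  rw [Real.dist_eq, div_sub' hp.ne', abs_div, abs_of_pos hp, div_lt_iff₀ hp]
  refine h3.trans_lt ?_
  have : ε / (2 * levelMass g α) * (b ^ (α / (d + α)) * levelMass g α)
      = ε * b ^ (α / (d + α)) / 2 := by field_simp
  rw [this]
  exact half_lt_self (by positivity)

/-- The continuous positive `f` has a positive minimum on the ball of radius `T`, so for small `b`
both regions lie beyond `T`. The relative error `ε / 2` suffices since `(1 + ε / 2) (1 - ε) ≤ 1 < (1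
+ ε) (1 - ε / 2)`, the second by `ε < 1`. -/
theorem eventually_riskRegion_subset (H : HomogeneousTail P f g α) {ε : ℝ} (hε : 0 < ε)
    (hε1 : ε < 1) : ∀ᶠ b in 𝓝[>] (0 : ℝ),
      level g (b * (1 - ε)) ⊆ riskRegion f b ∧ riskRegion f b ⊆ level g (b * (1 + ε)) := by
  obtain ⟨T, hT, hTz⟩ := H.rel_approx (half_pos hε)
  obtain ⟨z₀, -, hz₀⟩ := (isCompact_closedBall (0 : E d) T).exists_isMinOn
    ⟨0, by simpa using hT.le⟩ H.continuous.continuousOn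
  have h1 : ∀ᶠ b in 𝓝[>] (0 : ℝ), b < f z₀ :=
    nhdsWithin_le_nhds (eventually_lt_nhds (H.pos z₀))
  filter_upwards [H.eventually_level_far T, h1, self_mem_nhdsWithin] with b hb hbf hb0
  have hb0' : 0 < b := hb0
  constructor
  · intro z hz
    have hzb : z ∈ level g b := ⟨hz.1, hz.2.trans_le (by nlinarith)⟩
    have h2 := (abs_le.1 (hTz z (hb z hzb))).2
    have h3 := hz.2
    change f z ≤ b
    have h4 : (1 + ε / 2) * g z ≤ (1 + ε / 2) * (b * (1 - ε)) := by gcongr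
    have h5 : (1 + ε / 2) * (b * (1 - ε)) = b - b * (ε / 2 + ε ^ 2 / 2) := by ring
    have h6 : 0 ≤ b * (ε / 2 + ε ^ 2 / 2) := by positivity
    linarith
  · intro z hz
    have hz' : f z ≤ b := hz
    have hzT : T ≤ ‖z‖ := by
      by_contra hc
      have : f z₀ ≤ f z := hz₀ (by simpa using (not_le.1 hc).le)
      linarith
    have hz0 : z ≠ 0 := norm_pos_iff.1 (hT.trans_le hzT)
    refine ⟨hz0, ?_⟩
    have h2 := (abs_le.1 (hTz z hzT)).1
    have h3 := H.limit_pos z hz0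
    have h4 : g z * (1 - ε / 2) ≤ b := by linarith
    have h5 : b < b * ((1 + ε) * (1 - ε / 2)) := by nlinarith [mul_pos hε (sub_pos.2 hε1)]
    have h6 : 0 < 1 - ε / 2 := by linarith
    nlinarith

theorem tendsto_real_level_mul [IsProbabilityMeasure P] (H : HomogeneousTail P f g α)
    (hd : 0 < d) {x : ℝ} (hx : 0 < x) : Tendsto
      (fun b : ℝ => P.real (level g (b * x)) / b ^ (α / (d + α))) (𝓝[>] 0)
      (𝓝 (levelMass g α * x ^ (α / (d + α)))) := by
  have h1 : Tendsto (fun b : ℝ => b * x) (𝓝[>] 0) (𝓝[>] 0) := by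
    refine tendsto_nhdsWithin_iff.2 ⟨?_, ?_⟩
    · have : Tendsto (fun b : ℝ => b * x) (𝓝 0) (𝓝 (0 * x)) := tendsto_id.mul_const x
      rw [zero_mul] at this
      exact this.mono_left nhdsWithin_le_nhds
    · filter_upwards [self_mem_nhdsWithin] with b hb
      exact mul_pos hb hx
  refine (((H.tendsto_real_level hd).comp h1).mul_const (x ^ (α / (d + α)))).congr' ?_
  filter_upwards [self_mem_nhdsWithin] with b hb
  have hb' : 0 < b := hb
  simp only [Function.comp_apply]
  rw [Real.mul_rpow hb'.le hx.le]
  have : x ^ (α / (d + α)) ≠ 0 := by positivity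
  field_simp

/-- The sandwich between the levels `b (1 ± ε)` gives bounds `levelMass * (1 ± ε) ^ (α / (d + α))`,
which close up as `ε → 0`. -/
theorem tendsto_real_riskRegion [IsProbabilityMeasure P] (H : HomogeneousTail P f g α)
    (hd : 0 < d) : Tendsto (fun b : ℝ => P.real (riskRegion f b) / b ^ (α / (d + α))) (𝓝[>] 0)
      (𝓝 (levelMass g α)) := by
  have hcont : ∀ s : ℝ, Tendsto (fun ε : ℝ => levelMass g α * (1 + s * ε) ^ (α / (d + α)))
      (𝓝[>] 0) (𝓝 (levelMass g α)) := by
    intro s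
    have : ContinuousAt (fun ε : ℝ => levelMass g α * (1 + s * ε) ^ (α / (d + α))) 0 := by
      refine continuousAt_const.mul (ContinuousAt.rpow_const (by fun_prop) (Or.inl (by simp)))
    have h2 := this.tendsto.mono_left (nhdsWithin_le_nhds (s := Ioi 0))
    simpa using h2
  rw [tendsto_order]
  constructor
  · intro a ha
    obtain ⟨ε, h1, h2, h3⟩ := (((hcont (-1)).eventually_const_lt ha).and
      ((eventually_nhdsWithin_of_eventually_nhds (eventually_lt_nhds one_pos)).and
        (eventually_mem_nhdsWithin (s := Ioi 0)))).exists
    have h3' : 0 < ε := h3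
    filter_upwards [H.eventually_riskRegion_subset h3' h2, self_mem_nhdsWithin,
      (H.tendsto_real_level_mul hd (x := 1 - ε) (by linarith)).eventually_const_lt
        (by rwa [neg_one_mul, ← sub_eq_add_neg] at h1)] with b hb hb0 hb1
    have hb0' : 0 < b := hb0
    refine hb1.trans_le ?_
    gcongr
    · exact measure_ne_top _ _
    · exact hb.1
  · intro a ha
    obtain ⟨ε, h1, h2, h3⟩ := (((hcont 1).eventually_lt_const ha).and
      ((eventually_nhdsWithin_of_eventually_nhds (eventually_lt_nhds one_pos)).and
        (eventually_mem_nhdsWithin (s := Ioi 0)))).exists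
    have h3' : 0 < ε := h3
    filter_upwards [H.eventually_riskRegion_subset h3' h2, self_mem_nhdsWithin,
      (H.tendsto_real_level_mul hd (x := 1 + ε) (by linarith)).eventually_lt_const (by rwa [one_mul] at h1)] with b hb hb0 hb1
    have hb0' : 0 < b := hb0
    refine lt_of_le_of_lt ?_ hb1
    gcongr
    · exact measure_ne_top _ _
    · exact hb.2

/-- The thresholds of risk regions of vanishing probability tend to zero. -/
theorem tendsto_threshold [IsProbabilityMeasure P] [P.IsOpenPosMeasure]
    (H : HomogeneousTail P f g α) (hd : 0 < d) {p β : ℕ → ℝ} (hppos : ∀ n, 0 < p n)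
    (hp : Tendsto p atTop (𝓝 0)) (hβ : ∀ n, P.real (riskRegion f (β n)) = p n) :
    Tendsto β atTop (𝓝[>] 0) := by
  have hpos : ∀ n, 0 < β n := by
    intro n
    by_contra hc
    have : riskRegion f (β n) = ∅ := by
      ext z
      simp only [riskRegion, mem_ofPred_eq, mem_empty_iff_false, iff_false, not_le]
      exact (not_lt.1 hc).trans_lt (H.pos z)
    have h1 := hβ n
    rw [this, measureReal_empty] at h1
    exact (hppos n).ne h1
  refine tendsto_nhdsWithin_iff.2 ⟨?_, Eventually.of_forall hpos⟩
  rw [tendsto_order]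
  refine ⟨fun a ha => Eventually.of_forall fun n => ha.trans (hpos n), fun a ha => ?_⟩
  have hM := H.levelMass_pos hd
  obtain ⟨b, h1, h2, h3⟩ := ((((H.tendsto_real_riskRegion hd).eventually_const_lt hM).and
    ((eventually_mem_nhdsWithin (s := Ioi 0)).and
      (eventually_nhdsWithin_of_eventually_nhds (eventually_lt_nhds ha)))).exists)
  have h2' : 0 < b := h2
  have h4 : 0 < P.real (riskRegion f b) := by
    have : 0 < b ^ (α / (d + α)) := by positivity
    exact (div_pos_iff_of_pos_right this).1 h1
  filter_upwards [hp.eventually_lt_const h4] with n hn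
  by_contra hc
  have : P.real (riskRegion f b) ≤ P.real (riskRegion f (β n)) :=
    measureReal_mono fun z (hz : f z ≤ b) => show f z ≤ β n by linarith [not_lt.1 hc]
  rw [hβ n] at this
  linarith

end HomogeneousTail

/-! ### Kernels -/

/-- The kernel, extended by `K 0` to negative arguments. -/
def kernelExt (K : ℝ → ℝ) (u : ℝ) : ℝ := K (max u 0)

namespace IsKernel

variable {K : ℝ → ℝ}

theorem kernelExt_eq {u : ℝ} (hu : 0 ≤ u) : kernelExt K u = K u := by
  rw [kernelExt, max_eq_left hu]

theorem kernelExt_of_one_le (hK : IsKernel K) {u : ℝ} (hu : 1 ≤ u) : kernelExt K u = 0 := by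
  rw [kernelExt_eq (zero_le_one.trans hu)]
  rcases hu.eq_or_lt with h | h
  · rw [← h, hK.one]
  · exact hK.eq_zero u h

theorem kernelExt_eq_proj (hK : IsKernel K) (u : ℝ) :
    kernelExt K u = K (projIcc 0 1 zero_le_one u) := by
  rw [coe_projIcc]
  rcases le_total u 1 with h | h
  · rw [min_eq_right h, kernelExt, max_comm]
  · rw [hK.kernelExt_of_one_le h, min_eq_left h, max_eq_right zero_le_one, hK.one]

theorem antitone_kernelExt (hK : IsKernel K) : Antitone (kernelExt K) := by
  intro u v huv
  rw [hK.kernelExt_eq_proj, hK.kernelExt_eq_proj]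
  exact hK.antitoneOn (projIcc 0 1 zero_le_one u).2 (projIcc 0 1 zero_le_one v).2
    (monotone_projIcc zero_le_one huv)

theorem kernelExt_nonneg (hK : IsKernel K) (u : ℝ) : 0 ≤ kernelExt K u := by
  rw [← hK.kernelExt_of_one_le (le_max_right u 1)]
  exact hK.antitone_kernelExt (le_max_left _ _)

theorem kernelExt_le_one (hK : IsKernel K) (u : ℝ) : kernelExt K u ≤ 1 := by
  have h : kernelExt K (min u 0) = 1 := by
    rw [kernelExt, max_eq_right (min_le_right _ _), hK.zero]
  rw [← h]
  exact hK.antitone_kernelExt (min_le_left _ _)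

/-- The extension is `K` composed with the projection onto `[0, 1]`: uniformly continuous by
compactness, after a Lipschitz map. -/
theorem uniformContinuous_kernelExt (hK : IsKernel K) : UniformContinuous (kernelExt K) := by
  have h1 : UniformContinuous fun x : Icc (0 : ℝ) 1 => K x :=
    CompactSpace.uniformContinuous_of_continuous
      (continuousOn_iff_continuous_domRestrict.1 hK.continuousOn)
  have h2 : UniformContinuous (projIcc (0 : ℝ) 1 zero_le_one) :=
    (LipschitzWith.projIcc zero_le_one).uniformContinuous
  rw [show kernelExt K = (fun x : Icc (0 : ℝ) 1 => K x) ∘ projIcc 0 1 zero_le_one from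
    funext hK.kernelExt_eq_proj]
  exact h1.comp h2

theorem continuous_kernelExt (hK : IsKernel K) : Continuous (kernelExt K) :=
  hK.uniformContinuous_kernelExt.continuous

theorem exists_half_le (hK : IsKernel K) :
    ∃ x, 0 < x ∧ x ≤ 1 ∧ ∀ u, u ≤ x → 1 / 2 ≤ kernelExt K u := by
  have h0 : kernelExt K 0 = 1 := by simp [kernelExt, hK.zero]
  have h := (hK.continuous_kernelExt.tendsto 0).eventually_const_lt
    (show (1 / 2 : ℝ) < kernelExt K 0 by rw [h0]; norm_num)
  obtain ⟨ε, hε, hb⟩ := Metric.eventually_nhds_iff.1 h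
  refine ⟨min (ε / 2) 1, by positivity, min_le_right _ _, fun u hu => ?_⟩
  refine le_trans (hb (y := ε / 2) ?_).le (hK.antitone_kernelExt (hu.trans (min_le_left _ _)))
  rw [dist_zero_right, Real.norm_eq_abs, abs_of_pos (half_pos hε)]
  exact half_lt_self hε

end IsKernel

/-! ### Spherical caps -/

section Caps

variable {d : ℕ}

theorem norm_theta (w : Theta d) : ‖(w : E d)‖ = 1 := by simp

theorem norm_sub_sq_theta (v w : Theta d) :
    ‖(v : E d) - w‖ ^ 2 = 2 * (1 - ⟪(w : E d), (v : E d)⟫) := by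
  rw [norm_sub_sq_real, norm_theta, norm_theta, real_inner_comm]
  ring

theorem mem_cap_iff {v w : Theta d} {h : ℝ} : v ∈ cap w h ↔ ‖(v : E d) - w‖ ^ 2 ≤ 2 * h := by
  rw [norm_sub_sq_theta, cap, mem_ofPred_eq]
  constructor <;> intro <;> linarith

theorem measurableSet_cap (w : Theta d) (h : ℝ) : MeasurableSet (cap w h) :=
  (isClosed_le continuous_const (by fun_prop)).measurableSet

theorem surf_cap_eq (w w' : Theta d) (h : ℝ) :
    (surf d).real (cap w h) = (surf d).real (cap w' h) := by
  let e : E d ≃ₗᵢ[ℝ] E d := (ℝ ∙ ((w : E d) - w'))ᗮ.reflection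
  have hw : e (w : E d) = w' := Submodule.reflection_sub (by simp)
  have hcap : sphereEquiv e ⁻¹' cap w' h = cap w h := by
    ext v
    simp [cap, sphereEquiv, ← hw, e.inner_map_map]
  rw [measureReal_def, measureReal_def, ← hcap, (measurePreserving_sphereEquiv e).measure_preimage
    (measurableSet_cap _ _).nullMeasurableSet]

theorem surf_cap_pos (w : Theta d) {h : ℝ} (hh : 0 < h) : 0 < (surf d).real (cap w h) := by
  have hopen : IsOpen {v : Theta d | 1 - h < ⟪(w : E d), (v : E d)⟫} :=
    isOpen_lt continuous_const (by fun_prop)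
  rw [measureReal_def, ENNReal.toReal_pos_iff]
  refine ⟨(hopen.measure_pos (surf d) ⟨w, ?_⟩).trans_le
    (measure_mono fun v hv => le_of_lt (mem_ofPred_eq ▸ hv)), measure_lt_top _ _⟩
  rw [mem_ofPred_eq, real_inner_self_eq_norm_sq, norm_theta]
  linarith

theorem exists_finite_cover_unitBall {r : ℝ} (hr : 0 < r) :
    ∃ S : Finset (E d), ∀ z, ‖z‖ ≤ 1 → ∃ s ∈ S, ‖z - s‖ ≤ r := by
  obtain ⟨t, -, htf, ht⟩ := finite_cover_balls_of_compact (isCompact_closedBall (0 : E d) 1) hr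
  refine ⟨htf.toFinset, fun z hz => ?_⟩
  have := ht (show z ∈ closedBall 0 1 by simpa using hz)
  simp only [mem_iUnion, exists_prop, mem_ball, dist_eq_norm] at this
  obtain ⟨s, hs, hzs⟩ := this
  exact ⟨s, by simpa using hs, hzs.le⟩

/-- Doubling without computing any area: a cap of chordal radius `R = 2 √h` is covered by a number
of balls that depends only on `x` and `d`, each nonempty trace on the sphere lies in a small cap
about one of its own points, and all caps of equal height have equal area. -/
theorem exists_surf_cap_le {x : ℝ} (hx : 0 < x) : ∃ D, 0 < D ∧ ∀ (h : ℝ) (w : Theta d), 0 < h →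
    (surf d).real (cap w (2 * h)) ≤ D * (surf d).real (cap w (x * h)) := by
  classical
  -- Chosen so that the diameter of a piece, `2 * 2 √h * √(x / 8)`, has square exactly `2 (x h)`,
  -- the squared chordal radius of `cap _ (x * h)`.
  have hη : 0 < √(x / 8) := Real.sqrt_pos.2 (by positivity)
  obtain ⟨S, hS⟩ := exists_finite_cover_unitBall (d := d) hη
  refine ⟨S.card + 1, by positivity, fun h w hh => ?_⟩
  set R := 2 * √h with hR
  have hRpos : 0 < R := by positivity
  have hcover : cap w (2 * h) ⊆
      ⋃ s ∈ S, {v : Theta d | ‖(v : E d) - (w + R • s)‖ ≤ R * √(x / 8)} := by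
    intro v hv
    rw [mem_cap_iff] at hv
    have h1 : ‖(v : E d) - w‖ ≤ R := by
      refine abs_le_of_sq_le_sq' ?_ hRpos.le |>.2
      rw [hR, mul_pow, Real.sq_sqrt hh.le]
      linarith
    obtain ⟨s, hs, hvs⟩ := hS (R⁻¹ • ((v : E d) - w)) (by
      rw [norm_smul, norm_inv, Real.norm_eq_abs, abs_of_pos hRpos, inv_mul_le_one₀ hRpos]
      exact h1)
    simp only [mem_iUnion, exists_prop]
    refine ⟨s, hs, ?_⟩
    have h2 : (v : E d) - (w + R • s) = R • (R⁻¹ • ((v : E d) - w) - s) := by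
      rw [smul_sub, smul_smul, mul_inv_cancel₀ hRpos.ne', one_smul]
      abel
    rw [mem_ofPred_eq, h2, norm_smul, Real.norm_eq_abs, abs_of_pos hRpos]
    gcongr
  have hpiece : ∀ s ∈ S, (surf d).real {v : Theta d | ‖(v : E d) - (w + R • s)‖ ≤ R * √(x / 8)}
      ≤ (surf d).real (cap w (x * h)) := by
    intro s _
    rcases {v : Theta d | ‖(v : E d) - (w + R • s)‖ ≤ R * √(x / 8)}.eq_empty_or_nonempty
      with he | ⟨v₀, hv₀⟩
    · rw [he, measureReal_empty]
      exact measureReal_nonneg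
    · rw [surf_cap_eq w v₀]
      refine measureReal_mono fun v hv => ?_
      rw [mem_cap_iff]
      rw [mem_ofPred_eq] at hv hv₀
      have h3 : ‖(v : E d) - v₀‖ ≤ 2 * (R * √(x / 8)) := by
        have := norm_sub_le ((v : E d) - (w + R • s)) ((v₀ : E d) - (w + R • s))
        rw [sub_sub_sub_cancel_right] at this
        linarith
      calc ‖(v : E d) - v₀‖ ^ 2 ≤ (2 * (R * √(x / 8))) ^ 2 := by gcongr
        _ = 2 * (x * h) := by
          rw [mul_pow, mul_pow, hR, mul_pow, Real.sq_sqrt hh.le, Real.sq_sqrt (by positivity)]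
          ring
  calc (surf d).real (cap w (2 * h))
      ≤ (surf d).real (⋃ s ∈ S, {v : Theta d | ‖(v : E d) - (w + R • s)‖ ≤ R * √(x / 8)}) :=
        measureReal_mono hcover (measure_ne_top _ _)
    _ ≤ ∑ s ∈ S, (surf d).real {v : Theta d | ‖(v : E d) - (w + R • s)‖ ≤ R * √(x / 8)} :=
        measureReal_biUnion_finset_le _ _
    _ ≤ ∑ s ∈ S, (surf d).real (cap w (x * h)) := Finset.sum_le_sum hpiece
    _ = S.card * (surf d).real (cap w (x * h)) := by rw [Finset.sum_const, nsmul_eq_mul]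
    _ ≤ _ := by
        gcongr
        linarith

/-- Each ball of radius `2 ^ (-j)` is covered by a rescaled copy of one fixed cover with mesh `1 /
2`, so every halving multiplies the count by at most `M`. -/
theorem exists_dyadic_cover_unitBall : ∃ M : ℕ, 0 < M ∧ ∀ j : ℕ, ∃ S : Finset (E d),
    S.card ≤ M ^ j ∧ ∀ z, ‖z‖ ≤ 1 → ∃ s ∈ S, ‖z - s‖ ≤ (1 / 2) ^ j := by
  classical
  obtain ⟨S₁, hS₁⟩ := exists_finite_cover_unitBall (d := d) (show (0 : ℝ) < 1 / 2 by norm_num)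
  refine ⟨S₁.card + 1, by positivity, fun j => ?_⟩
  induction j with
  | zero => exact ⟨{0}, by simp, fun z hz => ⟨0, by simp, by simpa using hz⟩⟩
  | succ j ih =>
    obtain ⟨S, hc, hS⟩ := ih
    refine ⟨(S ×ˢ S₁).image fun x => x.1 + ((1 / 2 : ℝ) ^ j) • x.2, ?_, fun z hz => ?_⟩
    · refine Finset.card_image_le.trans ?_
      rw [Finset.card_product, pow_succ]
      gcongr
      omega
    · obtain ⟨s, hs, hzs⟩ := hS z hz
      have hp : (0 : ℝ) < (1 / 2) ^ j := by positivity
      obtain ⟨s', hs', hzs'⟩ := hS₁ (((1 / 2 : ℝ) ^ j)⁻¹ • (z - s)) (by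
        rw [norm_smul, norm_inv, Real.norm_eq_abs, abs_of_pos hp, inv_mul_le_one₀ hp]
        exact hzs)
      refine ⟨s + ((1 / 2 : ℝ) ^ j) • s', Finset.mem_image.2 ⟨(s, s'), by simp [hs, hs'], rfl⟩, ?_⟩
      have h2 : z - (s + ((1 / 2 : ℝ) ^ j) • s')
          = ((1 / 2 : ℝ) ^ j) • (((1 / 2 : ℝ) ^ j)⁻¹ • (z - s) - s') := by
        rw [smul_sub, smul_smul, mul_inv_cancel₀ hp.ne', one_smul]
        abel
      rw [h2, norm_smul, Real.norm_eq_abs, abs_of_pos hp, pow_succ]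
      gcongr

/-- The sphere has nets of mesh `r` of polynomial size in `1 / r`. -/
theorem exists_sphere_net (w₀ : Theta d) : ∃ a b : ℝ, 0 ≤ b ∧ ∀ r, 0 < r → r ≤ 1 →
    ∃ N : Finset (Theta d), (N.card : ℝ) ≤ Real.exp (a + b * Real.log (1 / r)) ∧
      ∀ w : Theta d, ∃ v ∈ N, ‖(w : E d) - v‖ ≤ r := by
  classical
  obtain ⟨M, hM, hS⟩ := exists_dyadic_cover_unitBall (d := d)
  have hlM : 0 ≤ Real.log M := Real.log_natCast_nonneg M
  refine ⟨2 * Real.log M, Real.log M / Real.log 2, by positivity, fun r hr hr1 => ?_⟩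
  have hl2 : 0 < Real.log 2 := Real.log_pos one_lt_two
  have hlr : 0 ≤ Real.log (1 / r) := Real.log_nonneg (by rwa [le_div_iff₀ hr, one_mul])
  set j := ⌈Real.log (1 / r) / Real.log 2⌉₊ + 1 with hj
  have hj1 : (j : ℝ) ≤ Real.log (1 / r) / Real.log 2 + 2 := by
    have := Nat.ceil_lt_add_one (show 0 ≤ Real.log (1 / r) / Real.log 2 by positivity)
    rw [hj]; push_cast; linarith
  have hj2 : 2 * (1 / 2 : ℝ) ^ j ≤ r := by
    have h1 : Real.log (1 / r) / Real.log 2 ≤ ⌈Real.log (1 / r) / Real.log 2⌉₊ := Nat.le_ceil _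
    rw [div_le_iff₀ hl2, ← Real.log_pow, Real.log_le_log_iff (by positivity) (by positivity),
      div_le_iff₀ hr] at h1
    rw [hj, pow_succ, one_div, inv_pow]
    field_simp
    linarith
  obtain ⟨S, hc, hcov⟩ := hS j
  -- The centres need not lie on the sphere; each is replaced by a nearby sphere point, which
  -- doubles the mesh, whence the factor 2 in `hj2`. Centres with no such point go to the dummy
  -- `w₀`.
  let pick : E d → Theta d := fun s =>
    if h : ∃ v : Theta d, ‖(v : E d) - s‖ ≤ (1 / 2) ^ j then h.choose else w₀
  refine ⟨S.image pick, ?_, fun w => ?_⟩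
  · calc ((S.image pick).card : ℝ) ≤ (M : ℝ) ^ j := by
          exact_mod_cast Finset.card_image_le.trans hc
      _ = Real.exp (j * Real.log M) := by
          rw [mul_comm, Real.exp_mul, Real.exp_log (by exact_mod_cast hM), Real.rpow_natCast]
      _ ≤ _ := by
          rw [Real.exp_le_exp]
          have := mul_le_mul_of_nonneg_right hj1 hlM
          refine this.trans (le_of_eq ?_)
          ring
  · obtain ⟨s, hs, hws⟩ := hcov w (norm_theta w).le
    have h : ∃ v : Theta d, ‖(v : E d) - s‖ ≤ (1 / 2) ^ j := ⟨w, hws⟩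
    refine ⟨pick s, Finset.mem_image_of_mem _ hs, ?_⟩
    have hp : pick s = h.choose := dif_pos h
    have h1 := h.choose_spec
    rw [← hp] at h1
    have := norm_sub_le ((w : E d) - s) ((pick s : E d) - s)
    rw [sub_sub_sub_cancel_right] at this
    linarith

/-- The cone over the cap fits in a box with one side `2 √(2h)` and the others `2`: the first
coordinate is at least `1 - h`, so the square of the second, available as `d ≥ 2`, is at most `1 -
(1 - h) ^ 2 ≤ 2 h`. Any power of `h` would do for the later use. -/
theorem exists_surf_cap_le_sqrt (hd : 2 ≤ d) : ∃ B, 0 < B ∧ ∀ (h : ℝ) (w : Theta d), 0 < h →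
    h < 1 → (surf d).real (cap w h) ≤ B * √h := by
  refine ⟨d * (2 ^ d * √2), by positivity, fun h w hh hh1 => ?_⟩
  let i₀ : Fin d := ⟨0, by omega⟩
  let i₁ : Fin d := ⟨1, by omega⟩
  have hne : i₀ ≠ i₁ := by simp [i₀, i₁]
  let e : Theta d := ⟨EuclideanSpace.single i₀ 1, by simp⟩
  let b : Fin d → ℝ := fun i => if i = i₁ then √(2 * h) else 1
  have hb0 : ∀ i, 0 ≤ b i := fun i => by
    simp only [b]; split_ifs <;> positivity
  have hsub : Ioo (0 : ℝ) 1 • ((↑) '' cap e h : Set (E d))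
      ⊆ (MeasurableEquiv.toLp 2 (Fin d → ℝ)).symm ⁻¹' (Icc (-b) b) := by
    rintro _ ⟨r, hr, _, ⟨v, hv, rfl⟩, rfl⟩
    have hv' : 1 - h ≤ (v : E d) i₀ := by
      have : 1 - h ≤ ⟪(e : E d), (v : E d)⟫ := hv
      simpa [e, EuclideanSpace.inner_single_left] using this
    have hsum : ∑ i, (v : E d) i ^ 2 = 1 := by
      rw [← EuclideanSpace.real_norm_sq_eq, norm_theta, one_pow]
    have hvi : ∀ i, |(v : E d) i| ≤ b i := by
      intro i
      refine abs_le_of_sq_le_sq ?_ (hb0 i)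
      simp only [b]
      split_ifs with hi
      · rw [Real.sq_sqrt (by positivity), hi]
        have h2 : (v : E d) i₀ ^ 2 + (v : E d) i₁ ^ 2 ≤ ∑ i, (v : E d) i ^ 2 := by
          rw [← Finset.sum_pair hne (f := fun i => (v : E d) i ^ 2)]
          exact Finset.sum_le_sum_of_subset_of_nonneg (Finset.subset_univ _)
            fun i _ _ => sq_nonneg _
        nlinarith
      · have h2 := Finset.single_le_sum (f := fun i => (v : E d) i ^ 2)
          (fun i _ => sq_nonneg _) (Finset.mem_univ i)
        simp only at h2
        linarith
    have hrv : ∀ i, |r * (v : E d) i| ≤ b i := fun i => by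
      rw [abs_mul, abs_of_pos hr.1]
      calc r * |(v : E d) i| ≤ 1 * b i := by
            gcongr
            · exact hr.2.le
            · exact hvi i
        _ = b i := one_mul _
    constructor
    · intro i
      exact (abs_le.1 (hrv i)).1
    · intro i
      exact (abs_le.1 (hrv i)).2
  have hvol : volume (Ioo (0 : ℝ) 1 • ((↑) '' cap e h : Set (E d)))
      ≤ ENNReal.ofReal (2 ^ d * √(2 * h)) := by
    refine (measure_mono hsub).trans (le_of_eq ?_)
    rw [(EuclideanSpace.volume_preserving_symm_measurableEquiv_toLp (Fin d)).measure_preimage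
      measurableSet_Icc.nullMeasurableSet, Real.volume_Icc_pi,
      ← ENNReal.ofReal_prod_of_nonneg fun i _ => by
        have := hb0 i; simp only [Pi.neg_apply]; linarith]
    congr 1
    have h3 : ∀ i, b i - (-b) i = 2 * b i := fun i => by simp only [Pi.neg_apply]; ring
    simp_rw [h3]
    rw [Finset.prod_mul_distrib]
    simp [b, Finset.prod_ite_eq']
  rw [surf_cap_eq w e, measureReal_def, surf, Measure.toSphere_apply' _ (measurableSet_cap _ _),
    finrank_euclideanSpace_fin, ENNReal.toReal_mul, ENNReal.toReal_natCast]
  have h4 := ENNReal.toReal_mono ENNReal.ofReal_ne_top hvol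
  rw [ENNReal.toReal_ofReal (by positivity), Real.sqrt_mul two_pos.le] at h4
  calc (d : ℝ) * (volume (Ioo (0 : ℝ) 1 • ((↑) '' cap e h : Set (E d)))).toReal
      ≤ d * (2 ^ d * (√2 * √h)) := by gcongr
    _ = _ := by ring

end Caps

/-! ### Zonal integrals of the kernel -/

/-- The kernel centred at `w`, with bandwidth `h` and with its argument shifted by `s`. -/
def shiftedKernel {d : ℕ} (K : ℝ → ℝ) (h s : ℝ) (w : Theta d) (z : E d) : ℝ :=
  kernelExt K ((1 - ⟪(w : E d), z⟫) / h - s)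

section Zonal

variable {d : ℕ} {K : ℝ → ℝ}

theorem one_sub_inner_nonneg (v w : Theta d) : 0 ≤ 1 - ⟪(w : E d), (v : E d)⟫ := by
  have := norm_sub_sq_theta v w
  nlinarith [sq_nonneg ‖(v : E d) - w‖]

namespace IsKernel

theorem continuous_shiftedKernel (hK : IsKernel K) (h s : ℝ) (w : Theta d) :
    Continuous (shiftedKernel K h s w) := by
  have := hK.continuous_kernelExt
  unfold shiftedKernel
  fun_prop

theorem integrable_shiftedKernel (hK : IsKernel K) (h s : ℝ) (w : Theta d) :
    Integrable (fun v : Theta d => shiftedKernel K h s w v) (surf d) :=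
  integrable_surf_of_continuous
    ((hK.continuous_shiftedKernel h s w).comp continuous_subtype_val)

theorem shiftedKernel_eq_zero (hK : IsKernel K) {h s : ℝ} (hh : 0 < h) (hs : |s| ≤ 1)
    {v w : Theta d} (hv : v ∉ cap w (2 * h)) : shiftedKernel K h s w v = 0 := by
  refine hK.kernelExt_of_one_le ?_
  have h1 : 2 * h < 1 - ⟪(w : E d), (v : E d)⟫ := by
    simp only [cap, mem_ofPred_eq, not_le] at hv
    linarith
  have h2 : 2 < (1 - ⟪(w : E d), (v : E d)⟫) / h := by rwa [lt_div_iff₀ hh]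
  linarith [(abs_le.1 hs).2]

theorem kernelConst_eq_inv (hK : IsKernel K) {h : ℝ} (hh : 0 < h) (w : Theta d) :
    kernelConst K h w = (∫ v : Theta d, shiftedKernel K h 0 w v ∂(surf d))⁻¹ := by
  rw [kernelConst, ← integral_indicator (measurableSet_cap _ _)]
  congr 2
  ext v
  rw [shiftedKernel, sub_zero]
  by_cases hv : v ∈ cap w h
  · rw [indicator_of_mem hv, real_inner_comm, kernelExt_eq]
    exact div_nonneg (one_sub_inner_nonneg v w) hh.le
  · rw [indicator_of_notMem hv, hK.kernelExt_of_one_le]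
    rw [le_div_iff₀ hh]
    simp only [cap, mem_ofPred_eq, not_le] at hv
    linarith

/-- Doubling: the cap of twice the bandwidth is comparable with the integral of the kernel. -/
theorem exists_surf_cap_le_integral (hK : IsKernel K) : ∃ D, 0 < D ∧ ∀ (h : ℝ) (w : Theta d),
    0 < h → (surf d).real (cap w (2 * h))
      ≤ D * ∫ v : Theta d, shiftedKernel K h 0 w v ∂(surf d) := by
  obtain ⟨x, hx, hx1, hKx⟩ := hK.exists_half_le
  obtain ⟨D, hD, hcap⟩ := exists_surf_cap_le (d := d) hx
  refine ⟨D * 2, by positivity, fun h w hh => (hcap h w hh).trans ?_⟩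
  rw [mul_assoc]
  gcongr
  have h1 : (surf d).real (cap w (x * h)) * (1 / 2)
      ≤ ∫ v : Theta d, shiftedKernel K h 0 w v ∂(surf d) := by
    have h2 : ∫ v : Theta d, (cap w (x * h)).indicator (fun _ => (1 / 2 : ℝ)) v ∂(surf d)
        = (surf d).real (cap w (x * h)) * (1 / 2) := by
      rw [integral_indicator (measurableSet_cap _ _), setIntegral_const, smul_eq_mul]
    rw [← h2]
    refine integral_mono ((integrable_const _).indicator (measurableSet_cap _ _))
      (hK.integrable_shiftedKernel h 0 w) fun v => ?_
    by_cases hv : v ∈ cap w (x * h)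
    · rw [indicator_of_mem hv]
      refine hKx _ ?_
      rw [sub_zero, div_le_iff₀ hh]
      have : 1 - x * h ≤ ⟪(w : E d), (v : E d)⟫ := hv
      linarith
    · rw [indicator_of_notMem hv]
      exact hK.kernelExt_nonneg _
  linarith

theorem integral_shiftedKernel_pos (hK : IsKernel K) {h : ℝ} (hh : 0 < h) (w : Theta d) :
    0 < ∫ v : Theta d, shiftedKernel K h 0 w v ∂(surf d) := by
  obtain ⟨D, hD, hcap⟩ := hK.exists_surf_cap_le_integral (d := d)
  have h1 := (surf_cap_pos w (show 0 < 2 * h by positivity)).trans_le (hcap h w hh)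
  exact pos_of_mul_pos_right h1 hD.le

theorem kernelConst_pos (hK : IsKernel K) {h : ℝ} (hh : 0 < h) (w : Theta d) :
    0 < kernelConst K h w := by
  rw [hK.kernelConst_eq_inv hh]
  exact inv_pos.2 (hK.integral_shiftedKernel_pos hh w)

/-- A small shift of the argument of the kernel has little influence on its integral. -/
theorem exists_abs_kernelConst_mul_sub_le (hK : IsKernel K) {ε : ℝ} (hε : 0 < ε) :
    ∃ η, 0 < η ∧ η ≤ 1 ∧ ∀ (h s : ℝ) (w : Theta d), 0 < h → |s| ≤ η →
      |kernelConst K h w * (∫ v : Theta d, shiftedKernel K h s w v ∂(surf d)) - 1| ≤ ε := by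
  obtain ⟨D, hD, hcap⟩ := hK.exists_surf_cap_le_integral (d := d)
  obtain ⟨δ, hδ, hu⟩ := Metric.uniformContinuous_iff.1 hK.uniformContinuous_kernelExt (ε / D)
    (by positivity)
  refine ⟨min (δ / 2) 1, by positivity, min_le_right _ _, fun h s w hh hs => ?_⟩
  have hI := hK.integral_shiftedKernel_pos hh w
  have hs1 : |s| ≤ 1 := hs.trans (min_le_right _ _)
  have hsδ : |s| < δ := (hs.trans (min_le_left _ _)).trans_lt (half_lt_self hδ)
  have hdiff : |(∫ v : Theta d, shiftedKernel K h s w v ∂(surf d))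
      - ∫ v : Theta d, shiftedKernel K h 0 w v ∂(surf d)|
        ≤ (surf d).real (cap w (2 * h)) * (ε / D) := by
    rw [← integral_sub (hK.integrable_shiftedKernel h s w) (hK.integrable_shiftedKernel h 0 w)]
    have h2 : ∫ v : Theta d, (cap w (2 * h)).indicator (fun _ => ε / D) v ∂(surf d)
        = (surf d).real (cap w (2 * h)) * (ε / D) := by
      rw [integral_indicator (measurableSet_cap _ _), setIntegral_const, smul_eq_mul]
    rw [← h2, ← Real.norm_eq_abs]
    refine norm_integral_le_of_norm_le
      ((integrable_const _).indicator (measurableSet_cap _ _)) (Eventually.of_forall fun v => ?_)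
    by_cases hv : v ∈ cap w (2 * h)
    · rw [indicator_of_mem hv, ← dist_eq_norm]
      refine (hu ?_).le
      rwa [sub_zero, dist_eq_norm, sub_sub_cancel_left, norm_neg]
    · rw [indicator_of_notMem hv, hK.shiftedKernel_eq_zero hh hs1 hv,
        hK.shiftedKernel_eq_zero hh (by simp) hv]
      simp
  rw [hK.kernelConst_eq_inv hh, inv_mul_eq_div, div_sub_one hI.ne', abs_div, abs_of_pos hI,
    div_le_iff₀ hI]
  refine hdiff.trans ?_
  calc (surf d).real (cap w (2 * h)) * (ε / D)
      ≤ (D * ∫ v : Theta d, shiftedKernel K h 0 w v ∂(surf d)) * (ε / D) := by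
        gcongr
        exact hcap h w hh
    _ = _ := by field_simp

/-- The kernel is at most one and vanishes off the cap, so its integral is `O(√h)`. This controls
`log (1 / h)`, hence the size of the nets, by `log c(h, K)`. -/
theorem exists_one_le_kernelConst_mul_sqrt (hK : IsKernel K) (hd : 2 ≤ d) :
    ∃ B, 0 < B ∧ ∀ (h : ℝ) (w : Theta d), 0 < h → h < 1 → 1 ≤ B * (kernelConst K h w * √h) := by
  obtain ⟨B, hB, hcap⟩ := exists_surf_cap_le_sqrt hd
  refine ⟨B, hB, fun h w hh hh1 => ?_⟩
  have hI := hK.integral_shiftedKernel_pos hh w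
  have h1 : ∫ v : Theta d, shiftedKernel K h 0 w v ∂(surf d) ≤ (surf d).real (cap w h) := by
    have h2 : ∫ v : Theta d, (cap w h).indicator (fun _ => (1 : ℝ)) v ∂(surf d)
        = (surf d).real (cap w h) := integral_indicator_one (measurableSet_cap _ _)
    rw [← h2]
    refine integral_mono (hK.integrable_shiftedKernel h 0 w)
      ((integrable_const _).indicator (measurableSet_cap _ _)) fun v => ?_
    by_cases hv : v ∈ cap w h
    · rw [indicator_of_mem hv]
      exact hK.kernelExt_le_one _
    · rw [indicator_of_notMem hv]
      refine (hK.kernelExt_of_one_le ?_).le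
      rw [sub_zero, le_div_iff₀ hh]
      simp only [cap, mem_ofPred_eq, not_le] at hv
      linarith
  rw [hK.kernelConst_eq_inv hh, ← div_eq_inv_mul, mul_div_assoc', le_div_iff₀ hI, one_mul]
  exact h1.trans (hcap h w hh hh1)

end IsKernel

end Zonal

/-! ### Expected kernel sums -/

/-- The shifted kernel applied to the direction of `z`, provided that `‖z‖ > t`. -/
def exceedKernel {d : ℕ} (K : ℝ → ℝ) (h s : ℝ) (w : Theta d) (t : ℝ) (z : E d) : ℝ :=
  {z : E d | t < ‖z‖}.indicator (fun z => shiftedKernel K h s w (‖z‖⁻¹ • z)) z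

section ExceedKernel

variable {d : ℕ} {K : ℝ → ℝ}

namespace IsKernel

theorem measurable_exceedKernel (hK : IsKernel K) (h s : ℝ) (w : Theta d) (t : ℝ) :
    Measurable (exceedKernel K h s w t) := by
  have := (hK.continuous_shiftedKernel h s w).measurable
  exact (by fun_prop : Measurable fun z : E d => shiftedKernel K h s w (‖z‖⁻¹ • z)).indicator
    (measurableSet_lt measurable_const measurable_norm)

theorem exceedKernel_nonneg (hK : IsKernel K) (h s : ℝ) (w : Theta d) (t : ℝ) (z : E d) :
    0 ≤ exceedKernel K h s w t z :=
  indicator_nonneg (fun _ _ => hK.kernelExt_nonneg _) z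

theorem exceedKernel_le_one (hK : IsKernel K) (h s : ℝ) (w : Theta d) (t : ℝ) (z : E d) :
    exceedKernel K h s w t z ≤ 1 :=
  indicator_le' (fun _ _ => hK.kernelExt_le_one _) (fun _ _ => zero_le_one) z

end IsKernel

end ExceedKernel

namespace HomogeneousTail

variable {d : ℕ} {P : Measure (E d)} {f g : E d → ℝ} {α : ℝ} {K : ℝ → ℝ}

theorem exists_limit_le (H : HomogeneousTail P f g α) :
    ∃ G, 0 < G ∧ ∀ w : Theta d, g w ≤ G := by
  obtain ⟨G, hG⟩ := (isCompact_range H.continuous_sphere).bddAbove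
  exact ⟨max G 1, by positivity, fun w => (hG (mem_range_self w)).trans (le_max_left _ _)⟩

theorem exists_abs_limit_sub_le (H : HomogeneousTail P f g α) {ε : ℝ} (hε : 0 < ε) :
    ∃ δ, 0 < δ ∧ ∀ v w : Theta d, ‖(v : E d) - w‖ < δ → |g v - g w| ≤ ε := by
  have hu := CompactSpace.uniformContinuous_of_continuous H.continuous_sphere
  obtain ⟨δ, hδ, h⟩ := Metric.uniformContinuous_iff.1 hu ε hε
  refine ⟨δ, hδ, fun v w hvw => (h ?_).le⟩
  rwa [Subtype.dist_eq, dist_eq_norm]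

/-- Three errors are controlled uniformly in `w`: replacing `f` by `g` beyond radius `t`, replacing
`g v` by `g w` on the support of the kernel, and the effect of the shift `s` on the kernel integral.
-/
theorem exists_abs_mean_sub_le [IsProbabilityMeasure P] (H : HomogeneousTail P f g α)
    (hK : IsKernel K) (hd : 0 < d) {ε : ℝ} (hε : 0 < ε) :
    ∃ η, 0 < η ∧ η ≤ 1 ∧ ∃ T, 0 < T ∧ ∃ h₀, 0 < h₀ ∧
      ∀ (t h s : ℝ) (w : Theta d), T ≤ t → 0 < h → h < h₀ → |s| ≤ η →
        |kernelConst K h w * (∫ z, exceedKernel K h s w t z ∂P) - t ^ (-α) / α * g w|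
          ≤ ε * t ^ (-α) := by
  obtain ⟨G, hG, hgG⟩ := H.exists_limit_le
  have hα := H.alpha_pos
  -- The errors add up to `ε₁ * ((2 G + 2) + (2 + G))`, relative to `t ^ (-α) / α`.
  set ε₁ := min 1 (ε * α / (3 * G + 4)) with hε₁
  have hε₁0 : 0 < ε₁ := by positivity
  have hε₁1 : ε₁ ≤ 1 := min_le_left _ _
  have hε₁2 : ε₁ * (3 * G + 4) ≤ ε * α := by
    rw [← le_div_iff₀ (by positivity)]
    exact min_le_right _ _
  obtain ⟨η, hη, hη1, hshift⟩ := hK.exists_abs_kernelConst_mul_sub_le (d := d) hε₁0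
  obtain ⟨T, hT, hmean⟩ := H.abs_integral_indicator_sub_le hd hε₁0
  obtain ⟨δ, hδ, hosc⟩ := H.exists_abs_limit_sub_le hε₁0
  -- On `cap w (2 * h)`, which contains the support of the shifted kernel, `‖v - w‖ ^ 2 ≤ 4 h < δ ^
  -- 2`.
  refine ⟨η, hη, hη1, T, hT, δ ^ 2 / 4, by positivity, fun t h s w ht hh hh₀ hs => ?_⟩
  have ht0 : 0 < t := hT.trans_le ht
  have hc := hK.kernelConst_pos hh w
  set c := kernelConst K h w
  have h1 := hshift h s w hh hs
  have hφ0 : ∀ z, 0 ≤ shiftedKernel K h s w z := fun z => hK.kernelExt_nonneg _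
  have h2 := hmean t ht (shiftedKernel K h s w) (hK.continuous_shiftedKernel h s w).measurable
    hφ0 (fun z => hK.kernelExt_le_one _)
  have hφI := hK.integrable_shiftedKernel h s w
  have hφgI : Integrable (fun v : Theta d => shiftedKernel K h s w v * g v) (surf d) :=
    integrable_surf_of_continuous
      (((hK.continuous_shiftedKernel h s w).comp continuous_subtype_val).mul H.continuous_sphere)
  have h3 : |(∫ v : Theta d, shiftedKernel K h s w v * g v ∂(surf d))
      - g w * ∫ v : Theta d, shiftedKernel K h s w v ∂(surf d)|
        ≤ ε₁ * ∫ v : Theta d, shiftedKernel K h s w v ∂(surf d) := by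
    rw [← integral_const_mul, ← integral_const_mul, ← integral_sub hφgI (hφI.const_mul _),
      ← Real.norm_eq_abs]
    refine norm_integral_le_of_norm_le (hφI.const_mul _) (Eventually.of_forall fun v => ?_)
    by_cases hv : v ∈ cap w (2 * h)
    · rw [mem_cap_iff] at hv
      have hvw : ‖(v : E d) - w‖ < δ := lt_of_pow_lt_pow_left₀ 2 hδ.le (by linarith)
      have h5 := hosc v w hvw
      rw [mul_comm (g w), ← mul_sub, Real.norm_eq_abs, abs_mul, abs_of_nonneg (hφ0 v), mul_comm]
      exact mul_le_mul_of_nonneg_right h5 (hφ0 v)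
    · rw [hK.shiftedKernel_eq_zero hh (hs.trans hη1) hv]
      simp
  set I := ∫ v : Theta d, shiftedKernel K h s w v ∂(surf d)
  set J := ∫ v : Theta d, shiftedKernel K h s w v * g v ∂(surf d)
  set m := ∫ z, exceedKernel K h s w t z ∂P with hm
  change |m - t ^ (-α) / α * J| ≤ ε₁ * (t ^ (-α) / α * J) at h2
  set τ := t ^ (-α) / α with hτ
  have hτ0 : 0 < τ := by positivity
  have e1 : |c * m - τ * (c * J)| ≤ ε₁ * (τ * (c * J)) := by
    have := mul_le_mul_of_nonneg_left h2 hc.le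
    rw [← abs_of_pos hc, ← abs_mul, abs_of_pos hc] at this
    calc |c * m - τ * (c * J)| = |c * (m - τ * J)| := by congr 1; ring
      _ ≤ _ := this
      _ = _ := by ring
  have e2 : |c * J - g w * (c * I)| ≤ ε₁ * (c * I) := by
    have := mul_le_mul_of_nonneg_left h3 hc.le
    rw [← abs_of_pos hc, ← abs_mul, abs_of_pos hc] at this
    calc |c * J - g w * (c * I)| = |c * (J - g w * I)| := by congr 1; ring
      _ ≤ _ := this
      _ = _ := by ring
  have hgw := hgG w
  have hgw0 := H.pos_on_sphere w.2
  set a := c * I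
  set b := c * J
  have ha2 : a ≤ 2 := by linarith [(abs_le.1 h1).2]
  have ha0 : 0 ≤ a := by linarith [(abs_le.1 h1).1]
  have hb2 : b ≤ 2 * G + 2 := by
    have := (abs_le.1 e2).2
    nlinarith
  calc |c * m - τ * g w| = |(c * m - τ * b) + τ * ((b - g w * a) + g w * (a - 1))| := by
        congr 1; ring
    _ ≤ |c * m - τ * b| + τ * (|b - g w * a| + g w * |a - 1|) := by
        refine (abs_add_le _ _).trans ?_
        rw [abs_mul, abs_of_pos hτ0]
        gcongr
        refine (abs_add_le _ _).trans ?_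
        rw [abs_mul, abs_of_pos hgw0]
    _ ≤ ε₁ * (τ * (2 * G + 2)) + τ * (ε₁ * 2 + G * ε₁) := by
        refine add_le_add (e1.trans (by gcongr)) ?_
        gcongr
        exact e2.trans (by gcongr)
    _ = τ * (ε₁ * (3 * G + 4)) := by ring
    _ ≤ τ * (ε * α) := by gcongr
    _ = ε * t ^ (-α) := by rw [hτ]; field_simp

/-- The mass `ν{‖z‖ > 1} = α⁻¹ ∫_Θ g dλ`. -/
def tailMass (g : E d → ℝ) (α : ℝ) : ℝ := α⁻¹ * ∫ w : Theta d, g w ∂(surf d)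

theorem tailMass_pos (H : HomogeneousTail P f g α) (hd : 0 < d) : 0 < tailMass g α := by
  have := nontrivial_E hd
  have hα := H.alpha_pos
  refine mul_pos (by positivity) ?_
  rw [integral_pos_iff_support_of_nonneg (fun w => (H.pos_on_sphere w.2).le)
    (integrable_surf_of_continuous H.continuous_sphere)]
  have hs : (Function.support fun w : Theta d => g w) = univ := by
    ext w
    simpa using (H.pos_on_sphere w.2).ne'
  rw [hs, Measure.measure_univ_pos, surf]
  exact Measure.toSphere_ne_zero _

end HomogeneousTail

/-! ### Thresholds -/

/-- The threshold that is exceeded by about `x k` among `n` observations. -/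
def threshold (C α n k x : ℝ) : ℝ := (n * C / (k * x)) ^ (1 / α)

section Threshold

variable {C α : ℝ} {k : ℕ → ℕ}

theorem IntermediateSeq.tendsto_div (hb : IntermediateSeq k) :
    Tendsto (fun n : ℕ => (n : ℝ) / k n) atTop atTop := by
  have h : Tendsto (fun n : ℕ => ((k n : ℝ) / n)⁻¹) atTop atTop := by
    refine Tendsto.inv_tendsto_nhdsGT_zero (tendsto_nhdsWithin_iff.2 ⟨hb.ratio, ?_⟩)
    filter_upwards [hb.bounds] with n hn
    have h1 : (0 : ℝ) < k n := by exact_mod_cast hn.1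
    have h2 : (0 : ℝ) < n := by exact_mod_cast hn.1.trans hn.2
    exact div_pos h1 h2
  exact h.congr fun n => inv_div _ _

theorem tendsto_threshold_atTop (hb : IntermediateSeq k) (hα : 0 < α) (hC : 0 < C) {x : ℝ}
    (hx : 0 < x) : Tendsto (fun n : ℕ => threshold C α n (k n) x) atTop atTop := by
  refine (tendsto_rpow_atTop (one_div_pos.2 hα)).comp ?_
  refine (hb.tendsto_div.atTop_mul_const (div_pos hC hx)).congr fun n => ?_
  rw [div_mul_div_comm]

theorem threshold_rpow_neg {n k x : ℝ} (hα : 0 < α) (hC : 0 < C) (hn : 0 < n) (hk : 0 < k)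
    (hx : 0 < x) : threshold C α n k x ^ (-α) = k * x / (n * C) := by
  rw [threshold, ← Real.rpow_mul (by positivity), one_div_mul_eq_div, neg_div, div_self hα.ne',
    Real.rpow_neg_one, inv_div]

theorem threshold_rpow {n k x : ℝ} (hα : 0 < α) (hC : 0 < C) (hn : 0 < n) (hk : 0 < k)
    (hx : 0 < x) : threshold C α n k x ^ α = n * C / (k * x) := by
  rw [threshold, ← Real.rpow_mul (by positivity), one_div_mul_cancel hα.ne', Real.rpow_one]

end Threshold

/-! ### The intermediate order statistic and uniform consistency of the spectral density estimator.
-/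

section Sample

variable {d : ℕ} {Ω : Type*} [MeasurableSpace Ω] {μ : Measure Ω} [IsProbabilityMeasure μ]
  {P : Measure (E d)} [IsProbabilityMeasure P] {f g : E d → ℝ} {α : ℝ}
  {X : ℕ → Ω → E d} {k : ℕ → ℕ} {K : ℝ → ℝ} {h : ℕ → ℝ} {w₀ : Theta d}

open HomogeneousTail

/-- The number of exceedances of a deterministic threshold. -/
theorem eventually_abs_count_sub_le (H : HomogeneousTail P f g α) (hd : 0 < d)
    (hXmeas : ∀ i, Measurable (X i)) (hXindep : iIndepFun X μ) (hXlaw : ∀ i, μ.map (X i) = P)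
    (hb : IntermediateSeq k) {x ε : ℝ} (hx : 0 < x) (hε : 0 < ε) :
    ∀ᶠ p in aas μ, |((Finset.univ.filter fun i : Fin p.1 =>
      threshold (tailMass g α) α p.1 (k p.1) x < ‖X i p.2‖).card : ℝ) - x * k p.1|
        ≤ ε * k p.1 := by
  have hα := H.alpha_pos
  have hC := H.tailMass_pos hd
  set C := tailMass g α
  set t : ℕ → ℝ := fun n => threshold C α n (k n) x with ht
  have hmean : Tendsto (fun n : ℕ => n * P.real {z | t n < ‖z‖} / k n) atTop (𝓝 x) := by
    have h1 := ((H.tendsto_tail hd).comp (tendsto_threshold_atTop hb hα hC hx)).mul_const (x / C)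
    rw [show α⁻¹ * (∫ w : Theta d, g w ∂(surf d)) = C from rfl, mul_div_cancel₀ _ hC.ne'] at h1
    refine h1.congr' ?_
    filter_upwards [hb.bounds] with n hn
    have hk : (0 : ℝ) < k n := by exact_mod_cast hn.1
    have hn0 : (0 : ℝ) < n := by exact_mod_cast hn.1.trans hn.2
    simp only [Function.comp_apply]
    rw [threshold_rpow hα hC hn0 hk hx]
    field_simp
    rfl
  have hm1 := (Metric.tendsto_nhds.1 hmean) (min (ε / 2) 1) (by positivity)
  have hktop : Tendsto (fun n => (k n : ℝ)) atTop atTop :=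
    tendsto_natCast_atTop_atTop.comp hb.tendsto
  set B := max (ε / 2) (x + 1) with hB
  have hBpos : 0 < B := by positivity
  refine eventually_aas_of_real_le
    (u := fun n => 2 * Real.exp (-((ε / 2) ^ 2 / (4 * B)) * (k n : ℝ))) ?_ ?_
  · rw [show (0 : ℝ) = 2 * 0 by ring]
    refine (Real.tendsto_exp_atBot.comp ?_).const_mul 2
    exact hktop.const_mul_atTop_of_neg (neg_lt_zero.2 (by positivity))
  filter_upwards [hm1, hb.bounds] with n hn1 hn2
  have hk : (0 : ℝ) < k n := by exact_mod_cast hn2.1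
  rw [Real.dist_eq] at hn1
  have hms : MeasurableSet {z : E d | t n < ‖z‖} :=
    measurableSet_lt measurable_const measurable_norm
  have hn3 : |n * P.real {z | t n < ‖z‖} - x * k n| ≤ ε / 2 * k n := by
    have := hn1.le.trans (min_le_left _ _)
    rwa [div_sub' hk.ne', abs_div, abs_of_pos hk, div_le_iff₀ hk, mul_comm (k n : ℝ)] at this
  have hn4 : n * P.real {z | t n < ‖z‖} ≤ B * k n := by
    have := (abs_lt.1 (hn1.trans_le (min_le_right _ _))).2
    have h5 : n * P.real {z | t n < ‖z‖} / k n ≤ B := by linarith [le_max_right (ε / 2) (x + 1)]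
    rwa [div_le_iff₀ hk] at h5
  have hint : ∫ z, {z : E d | t n < ‖z‖}.indicator (fun _ => (1 : ℝ)) z ∂P
      = P.real {z | t n < ‖z‖} := integral_indicator_one hms
  have key := measure_abs_sum_sub_ge_le hXmeas hXindep hXlaw
    (φ := {z : E d | t n < ‖z‖}.indicator fun _ => (1 : ℝ))
    (measurable_const.indicator hms) (indicator_nonneg fun _ _ => zero_le_one)
    (indicator_le' (fun _ _ => le_rfl) fun _ _ => zero_le_one) n (L := k n) (B := B)
    (half_pos hε) (le_max_left _ _) (by rwa [hint])
  refine le_trans (measureReal_mono fun ω hω => ?_) key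
  simp only [mem_ofPred_eq, not_le] at hω ⊢
  rw [hint]
  have hcard : (∑ i : Fin n, {z : E d | t n < ‖z‖}.indicator (fun _ => (1 : ℝ)) (X i ω))
      = (Finset.univ.filter fun i : Fin n => t n < ‖X i ω‖).card := by
    rw [Finset.card_filter]
    push_cast
    refine Finset.sum_congr rfl fun i _ => ?_
    simp [indicator_apply]
  rw [hcard]
  by_contra hc
  push Not at hc
  have := abs_sub_le ((Finset.univ.filter fun i : Fin n => t n < ‖X i ω‖).card : ℝ)
    (n * P.real {z | t n < ‖z‖}) (x * k n)
  linarith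

/-- The count of exceedances is within `δ k / 2` of `(1 + δ) k` at the lower threshold and of `(1 -
δ) k` at the upper one, hence above and below `k` respectively, which locates the order statistic.
-/
theorem eventually_threshold_lt_UHat (H : HomogeneousTail P f g α) (hd : 0 < d)
    (hXmeas : ∀ i, Measurable (X i)) (hXindep : iIndepFun X μ) (hXlaw : ∀ i, μ.map (X i) = P)
    (hb : IntermediateSeq k) {δ : ℝ} (hδ : 0 < δ) (hδ1 : δ < 1) :
    ∀ᶠ p in aas μ, threshold (tailMass g α) α p.1 (k p.1) (1 + δ)
        < UHat (k p.1) (fun i : Fin p.1 => X i p.2) ∧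
      UHat (k p.1) (fun i : Fin p.1 => X i p.2)
        ≤ threshold (tailMass g α) α p.1 (k p.1) (1 - δ) := by
  filter_upwards [(tendsto_fst_aas μ).eventually hb.bounds,
    eventually_abs_count_sub_le H hd hXmeas hXindep hXlaw hb (x := 1 + δ) (by linarith)
      (half_pos hδ),
    eventually_abs_count_sub_le H hd hXmeas hXindep hXlaw hb (x := 1 - δ) (by linarith)
      (half_pos hδ)] with p hp h1 h2
  have hk : (0 : ℝ) < k p.1 := by exact_mod_cast hp.1
  constructor
  · refine lt_orderStat_of_lt_card hp.2 ?_
    have h3 := (abs_le.1 h1).1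
    have : (k p.1 : ℝ) < (Finset.univ.filter fun i : Fin p.1 =>
        threshold (tailMass g α) α p.1 (k p.1) (1 + δ) < ‖X i p.2‖).card := by
      nlinarith
    exact_mod_cast this
  · refine orderStat_le_of_card_le hp.2 ?_
    have h3 := (abs_le.1 h2).2
    have : ((Finset.univ.filter fun i : Fin p.1 =>
        threshold (tailMass g α) α p.1 (k p.1) (1 - δ) < ‖X i p.2‖).card : ℝ) ≤ k p.1 := by
      nlinarith
    exact_mod_cast this

/-- The exceedance level `R_{n-k:n}`, in units of `(n/k)^{1/α}`. -/
theorem tendsto_UHat (H : HomogeneousTail P f g α) (hd : 0 < d)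
    (hXmeas : ∀ i, Measurable (X i)) (hXindep : iIndepFun X μ) (hXlaw : ∀ i, μ.map (X i) = P)
    (hb : IntermediateSeq k) :
    Tendsto (fun p : ℕ × Ω => UHat (k p.1) (fun i : Fin p.1 => X i p.2)
      / ((p.1 : ℝ) / k p.1) ^ (1 / α)) (aas μ) (𝓝 (tailMass g α ^ (1 / α))) := by
  have hC := H.tailMass_pos hd
  have hα := H.alpha_pos
  set C := tailMass g α
  have hcont : ∀ s : ℝ, Tendsto (fun δ : ℝ => (C / (1 + s * δ)) ^ (1 / α)) (𝓝[>] 0)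
      (𝓝 (C ^ (1 / α))) := by
    intro s
    have : ContinuousAt (fun δ : ℝ => (C / (1 + s * δ)) ^ (1 / α)) 0 := by
      refine ContinuousAt.rpow_const ?_ (Or.inl (by simp [hC.ne']))
      exact continuousAt_const.div (by fun_prop) (by simp)
    have h2 := this.tendsto.mono_left (nhdsWithin_le_nhds (s := Ioi 0))
    simpa using h2
  have hthr : ∀ n : ℕ, 0 < k n → k n < n → ∀ x : ℝ, 0 < x →
      threshold C α n (k n) x / ((n : ℝ) / k n) ^ (1 / α) = (C / x) ^ (1 / α) := by
    intro n h1 h2 x hx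
    have hk : (0 : ℝ) < k n := by exact_mod_cast h1
    have hn0 : (0 : ℝ) < n := by exact_mod_cast h1.trans h2
    rw [threshold, ← Real.div_rpow (by positivity) (by positivity)]
    congr 1
    field_simp
  rw [tendsto_order]
  constructor
  · intro a ha
    obtain ⟨δ, h1, h2, h3⟩ := (((hcont 1).eventually_const_lt ha).and
      ((eventually_nhdsWithin_of_eventually_nhds (eventually_lt_nhds one_pos)).and
        (eventually_mem_nhdsWithin (s := Ioi 0)))).exists
    have h3' : 0 < δ := h3
    filter_upwards [(tendsto_fst_aas μ).eventually hb.bounds,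
      eventually_threshold_lt_UHat H hd hXmeas hXindep hXlaw hb h3' h2] with p hp hU
    have hk : (0 : ℝ) < k p.1 := by exact_mod_cast hp.1
    have hn0 : (0 : ℝ) < p.1 := by exact_mod_cast hp.1.trans hp.2
    rw [one_mul, ← hthr p.1 hp.1 hp.2 _ (by linarith)] at h1
    refine h1.trans ?_
    gcongr
    exact hU.1
  · intro a ha
    obtain ⟨δ, h1, h2, h3⟩ := (((hcont (-1)).eventually_lt_const ha).and
      ((eventually_nhdsWithin_of_eventually_nhds (eventually_lt_nhds one_pos)).and
        (eventually_mem_nhdsWithin (s := Ioi 0)))).exists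
    have h3' : 0 < δ := h3
    filter_upwards [(tendsto_fst_aas μ).eventually hb.bounds,
      eventually_threshold_lt_UHat H hd hXmeas hXindep hXlaw hb h3' h2] with p hp hU
    have hk : (0 : ℝ) < k p.1 := by exact_mod_cast hp.1
    have hn0 : (0 : ℝ) < p.1 := by exact_mod_cast hp.1.trans hp.2
    rw [neg_one_mul, ← sub_eq_add_neg, ← hthr p.1 hp.1 hp.2 _ (by linarith)] at h1
    refine lt_of_le_of_lt ?_ h1
    gcongr
    exact hU.2

/-- The condition on the bandwidth makes exponential bounds beat the size of a net. -/
theorem tendsto_net_mul_exp (hK : IsKernel K) (hd : 2 ≤ d) (hktop : Tendsto k atTop atTop)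
    (hh : ∀ n, 0 < h n ∧ h n < 1)
    (hkc : Tendsto (fun n => (k n : ℝ) / (kernelConst K (h n) w₀ * Real.log (k n))) atTop atTop)
    {a b κ : ℝ} (hb0 : 0 ≤ b) (hκ : 0 < κ) :
    Tendsto (fun n => Real.exp (a + b * Real.log (1 / h n))
      * (2 * Real.exp (-κ * (k n / kernelConst K (h n) w₀)))) atTop (𝓝 0) := by
  obtain ⟨B, hB, hcB⟩ := hK.exists_one_le_kernelConst_mul_sqrt hd
  have hlog : Tendsto (fun n => Real.log (k n)) atTop atTop :=
    Real.tendsto_log_atTop.comp (tendsto_natCast_atTop_atTop.comp hktop)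
  have hmain : Tendsto (fun n => 2 * Real.exp (a + 2 * b * Real.log B - Real.log (k n)))
      atTop (𝓝 0) := by
    rw [show (0 : ℝ) = 2 * 0 by ring]
    refine (Real.tendsto_exp_atBot.comp ?_).const_mul 2
    exact tendsto_atBot_add_const_left _ _ (tendsto_neg_atTop_atBot.comp hlog)
  refine tendsto_of_tendsto_of_tendsto_of_le_of_le' tendsto_const_nhds hmain
    (Eventually.of_forall fun n => by positivity) ?_
  -- The bound by `1` gives `c ≤ k`, hence `log (1 / h) ≤ 2 log B + 2 log k`. The bound `(2 b + 1) /
  -- κ` makes the exponent at least `(2 b + 1) log k`: the part `2 b` pays for the net and the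
  -- remaining `log k` gives decay like `1 / k`.
  filter_upwards [hlog.eventually_ge_atTop 1, hkc.eventually_ge_atTop 1,
    hkc.eventually_ge_atTop ((2 * b + 1) / κ)] with n h1 h2 h3
  obtain ⟨hn0, hn1⟩ := hh n
  have hc := hK.kernelConst_pos hn0 w₀
  have hBc := hcB (h n) w₀ hn0 hn1
  set c := kernelConst K (h n) w₀
  have hl0 : 0 < Real.log (k n) := by linarith
  rw [le_div_iff₀ (by positivity)] at h2 h3
  have hck : c ≤ k n := by nlinarith
  have hlc : Real.log c ≤ Real.log (k n) := Real.log_le_log hc hck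
  have hlh : Real.log (1 / h n) ≤ 2 * Real.log B + 2 * Real.log c := by
    have h4 := Real.log_nonneg hBc
    rw [Real.log_mul hB.ne' (by positivity), Real.log_mul hc.ne' (by positivity),
      Real.log_sqrt hn0.le] at h4
    rw [one_div, Real.log_inv]
    linarith
  have h5 : (2 * b + 1) * Real.log (k n) ≤ κ * (k n / c) := by
    rw [mul_div_assoc', le_div_iff₀ hc]
    have h6 := mul_le_mul_of_nonneg_left h3 hκ.le
    calc (2 * b + 1) * Real.log (k n) * c
        = κ * ((2 * b + 1) / κ * (c * Real.log (k n))) := by field_simp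
      _ ≤ _ := h6
  rw [mul_left_comm, ← Real.exp_add]
  gcongr
  have h7 := mul_le_mul_of_nonneg_left hlh hb0
  have h8 := mul_le_mul_of_nonneg_left hlc hb0
  linarith

/-- Kernel sums over exceedances of a deterministic threshold, uniformly over the points of a
net. -/
theorem exists_eventually_abs_sum_sub_le (H : HomogeneousTail P f g α) (hK : IsKernel K)
    (hd : 2 ≤ d)
    (hXmeas : ∀ i, Measurable (X i)) (hXindep : iIndepFun X μ) (hXlaw : ∀ i, μ.map (X i) = P)
    (hb : IntermediateSeq k) (hh : ∀ n, 0 < h n ∧ h n < 1) (hh0 : Tendsto h atTop (𝓝 0))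
    (hkc : Tendsto (fun n => (k n : ℝ) / (kernelConst K (h n) w₀ * Real.log (k n))) atTop atTop)
    {x ε : ℝ} (hx : 0 < x) (hε : 0 < ε) :
    ∃ η, 0 < η ∧ η ≤ 1 ∧ ∀ (s : ℝ) (N : ℕ → Finset (Theta d)) (a b : ℝ), |s| ≤ η → 0 ≤ b →
      (∀ n, ((N n).card : ℝ) ≤ Real.exp (a + b * Real.log (1 / h n))) →
      ∀ᶠ p in aas μ, ∀ v ∈ N p.1,
        |kernelConst K (h p.1) w₀ / k p.1 * (∑ i : Fin p.1, exceedKernel K (h p.1) s v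
            (threshold (tailMass g α) α p.1 (k p.1) x) (X i p.2))
          - x * (g v / (α * tailMass g α))| ≤ ε := by
  have hα := H.alpha_pos
  have hd0 : 0 < d := by omega
  have hC := H.tailMass_pos hd0
  set C := tailMass g α
  obtain ⟨G, hG, hgG⟩ := H.exists_limit_le
  -- After multiplication by `n / k` and `t ^ (-α) = k x / (n C)`, the bias becomes `ε / 2`; the
  -- other half is left to the random fluctuation.
  set ε₁ := ε / 2 * C / x with hε₁
  obtain ⟨η, hη, hη1, T, hT, h₀, hh₀, hmean⟩ :=
    H.exists_abs_mean_sub_le hK hd0 (show 0 < ε₁ by positivity)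
  refine ⟨η, hη, hη1, fun s N a b hs hb0 hN => ?_⟩
  set B := max (ε / 2) (x / C * (G / α + ε₁)) with hB
  have hBpos : 0 < B := by positivity
  set κ := (ε / 2) ^ 2 / (4 * B) with hκ
  have hκpos : 0 < κ := by positivity
  refine eventually_aas_of_real_le (tendsto_net_mul_exp hK hd hb.tendsto hh hkc hb0 hκpos
    (a := a)) ?_
  filter_upwards [hb.bounds, hh0.eventually_lt_const hh₀,
    (tendsto_threshold_atTop hb hα hC hx).eventually_ge_atTop T] with n hn hhn htn
  have hk : (0 : ℝ) < k n := by exact_mod_cast hn.1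
  have hn0 : (0 : ℝ) < n := by exact_mod_cast hn.1.trans hn.2
  have hc := hK.kernelConst_pos (hh n).1 w₀
  set c := kernelConst K (h n) w₀
  set t := threshold C α n (k n) x with ht
  have hone : ∀ v : Theta d, μ.real {ω | ¬ |c / k n * (∑ i : Fin n,
      exceedKernel K (h n) s v t (X i ω)) - x * (g v / (α * C))| ≤ ε}
        ≤ 2 * Real.exp (-κ * (k n / c)) := by
    intro v
    have h1 := hmean t (h n) s v htn (hh n).1 hhn hs
    rw [kernelConst_eq K (h n) v w₀, threshold_rpow_neg hα hC hn0 hk hx] at h1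
    set m := ∫ z, exceedKernel K (h n) s v t z ∂P with hm
    have h2 : |c / k n * (n * m) - x * (g v / (α * C))| ≤ ε / 2 := by
      have e1 : c / k n * (n * m) - x * (g v / (α * C))
          = n / k n * (c * m - k n * x / (n * C) / α * g v) := by field_simp
      rw [e1, abs_mul, abs_of_pos (div_pos hn0 hk)]
      calc n / k n * |c * m - k n * x / (n * C) / α * g v|
          ≤ n / k n * (ε₁ * (k n * x / (n * C))) := by gcongr
        _ = ε / 2 := by rw [hε₁]; field_simp
    -- The mean of the kernel sum is of order `k / c`, so the Chernoff bound is used with `L = k /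
    -- c`.
    have h3 : n * m ≤ B * (k n / c) := by
      have e1 := (abs_le.1 h1).2
      have e2 : c * m ≤ k n * x / (n * C) * (G / α + ε₁) := by
        have : k n * x / (n * C) / α * g v ≤ k n * x / (n * C) / α * G := by
          gcongr
          exact hgG v
        calc c * m ≤ ε₁ * (k n * x / (n * C)) + k n * x / (n * C) / α * g v := by linarith
          _ ≤ ε₁ * (k n * x / (n * C)) + k n * x / (n * C) / α * G := by linarith
          _ = _ := by ring
      calc n * m = n / c * (c * m) := by field_simp
        _ ≤ n / c * (k n * x / (n * C) * (G / α + ε₁)) := by gcongr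
        _ = x / C * (G / α + ε₁) * (k n / c) := by field_simp
        _ ≤ _ := by
          gcongr
          exact le_max_right _ _
    have key := measure_abs_sum_sub_ge_le hXmeas hXindep hXlaw
      (hK.measurable_exceedKernel (h n) s v t) (hK.exceedKernel_nonneg (h n) s v t)
      (hK.exceedKernel_le_one (h n) s v t) n (half_pos hε) (le_max_left _ _) h3
    refine le_trans (measureReal_mono fun ω hω => ?_) key
    simp only [mem_ofPred_eq, not_le] at hω ⊢
    by_contra hcon
    push Not at hcon
    set S := ∑ i : Fin n, exceedKernel K (h n) s v t (X i ω)
    have h4 : |c / k n * S - c / k n * (n * m)| ≤ ε / 2 := by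
      rw [← mul_sub, abs_mul, abs_of_pos (div_pos hc hk)]
      calc c / k n * |S - n * m| ≤ c / k n * (ε / 2 * (k n / c)) := by gcongr
        _ = ε / 2 := by field_simp
    have := abs_sub_le (c / k n * S) (c / k n * (n * m)) (x * (g v / (α * C)))
    linarith
  calc _ ≤ μ.real (⋃ v ∈ N n, {ω | ¬ |c / k n * (∑ i : Fin n,
        exceedKernel K (h n) s v t (X i ω)) - x * (g v / (α * C))| ≤ ε}) := by
        refine measureReal_mono (fun ω hω => ?_) (measure_ne_top _ _)
        simp only [mem_ofPred_eq, not_forall] at hω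
        obtain ⟨v, hv, hω⟩ := hω
        simp only [mem_iUnion, exists_prop]
        exact ⟨v, hv, hω⟩
    _ ≤ ∑ v ∈ N n, μ.real {ω | ¬ |c / k n * (∑ i : Fin n,
        exceedKernel K (h n) s v t (X i ω)) - x * (g v / (α * C))| ≤ ε} :=
        measureReal_biUnion_finset_le _ _
    _ ≤ ∑ v ∈ N n, 2 * Real.exp (-κ * (k n / c)) := Finset.sum_le_sum fun v _ => hone v
    _ = (N n).card * (2 * Real.exp (-κ * (k n / c))) := by rw [Finset.sum_const, nsmul_eq_mul]
    _ ≤ _ := by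
        gcongr
        exact hN n

-- Moving the centre from `w` to `v` changes the kernel argument by at most `η`, which the shift
-- compensates because the kernel is nonincreasing; lowering the threshold only adds nonnegative
-- terms. The bound frees the estimator of its random level and of the continuum of centres.
open Classical in
theorem kernel_le_exceedKernel (hK : IsKernel K) {h η t u : ℝ} (hh : 0 < h) (htu : t ≤ u)
    {v w : Theta d} (hvw : ‖(w : E d) - v‖ ≤ η * h) (z : E d) :
    (if u < ‖z‖ then K ((1 - ⟪(w : E d), ‖z‖⁻¹ • z⟫) / h) else 0)
      ≤ exceedKernel K h η v t z := by
  split_ifs with hz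
  · have hz1 : ‖‖z‖⁻¹ • z‖ ≤ 1 := by
      rw [norm_smul, norm_inv, norm_norm]
      exact inv_mul_le_one
    have hwz : ⟪(w : E d), ‖z‖⁻¹ • z⟫ ≤ 1 := by
      refine (real_inner_le_norm _ _).trans ?_
      rwa [norm_theta, one_mul]
    have hu0 : 0 ≤ (1 - ⟪(w : E d), ‖z‖⁻¹ • z⟫) / h := div_nonneg (by linarith) hh.le
    have hdiff : ⟪(w : E d), ‖z‖⁻¹ • z⟫ - ⟪(v : E d), ‖z‖⁻¹ • z⟫ ≤ η * h := by
      rw [← inner_sub_left]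
      refine (real_inner_le_norm _ _).trans ?_
      nlinarith [norm_nonneg ((w : E d) - v)]
    rw [exceedKernel, indicator_of_mem (show z ∈ {z : E d | t < ‖z‖} from htu.trans_lt hz),
      ← IsKernel.kernelExt_eq (K := K) hu0]
    refine hK.antitone_kernelExt ?_
    rw [sub_le_iff_le_add, div_add' _ _ _ hh.ne']
    gcongr
    linarith
  · exact hK.exceedKernel_nonneg _ _ _ _ _

open Classical in
theorem exceedKernel_le_kernel (hK : IsKernel K) {h η t u : ℝ} (hh : 0 < h) (hut : u ≤ t)
    {v w : Theta d} (hvw : ‖(w : E d) - v‖ ≤ η * h) (z : E d) :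
    exceedKernel K h (-η) v t z
      ≤ if u < ‖z‖ then K ((1 - ⟪(w : E d), ‖z‖⁻¹ • z⟫) / h) else 0 := by
  have hz1 : ‖‖z‖⁻¹ • z‖ ≤ 1 := by
    rw [norm_smul, norm_inv, norm_norm]
    exact inv_mul_le_one
  have hwz : ⟪(w : E d), ‖z‖⁻¹ • z⟫ ≤ 1 := by
    refine (real_inner_le_norm _ _).trans ?_
    rwa [norm_theta, one_mul]
  have hu0 : 0 ≤ (1 - ⟪(w : E d), ‖z‖⁻¹ • z⟫) / h := div_nonneg (by linarith) hh.le
  have hdiff : ⟪(v : E d), ‖z‖⁻¹ • z⟫ - ⟪(w : E d), ‖z‖⁻¹ • z⟫ ≤ η * h := by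
    rw [← inner_sub_left]
    refine (real_inner_le_norm _ _).trans ?_
    rw [norm_sub_rev]
    nlinarith [norm_nonneg ((w : E d) - v)]
  by_cases hz : t < ‖z‖
  · rw [if_pos (hut.trans_lt hz), exceedKernel,
      indicator_of_mem (show z ∈ {z : E d | t < ‖z‖} from hz),
      ← IsKernel.kernelExt_eq (K := K) hu0]
    refine hK.antitone_kernelExt ?_
    rw [sub_neg_eq_add, div_add' _ _ _ hh.ne']
    gcongr
    linarith
  · rw [exceedKernel, indicator_of_notMem (show z ∉ {z : E d | t < ‖z‖} from hz)]
    split_ifs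
    · rw [← IsKernel.kernelExt_eq (K := K) hu0]
      exact hK.kernelExt_nonneg _
    · exact le_rfl

/-- Uniform consistency of the estimator of the spectral density. -/
theorem eventually_abs_psiHat_sub_le (H : HomogeneousTail P f g α) (hK : IsKernel K)
    (hd : 2 ≤ d)
    (hXmeas : ∀ i, Measurable (X i)) (hXindep : iIndepFun X μ) (hXlaw : ∀ i, μ.map (X i) = P)
    (hb : IntermediateSeq k) (hh : ∀ n, 0 < h n ∧ h n < 1) (hh0 : Tendsto h atTop (𝓝 0))
    (hkc : Tendsto (fun n => (k n : ℝ) / (kernelConst K (h n) w₀ * Real.log (k n))) atTop atTop)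
    {ε : ℝ} (hε : 0 < ε) :
    ∀ᶠ p in aas μ, ∀ w : Theta d,
      |psiHat K (h p.1) (k p.1) (fun i : Fin p.1 => X i p.2) w - g w / (α * tailMass g α)|
        ≤ ε := by
  have hα := H.alpha_pos
  have hd0 : 0 < d := by omega
  have hC := H.tailMass_pos hd0
  obtain ⟨G, hG, hgG⟩ := H.exists_limit_le
  set A := α * tailMass g α with hA
  have hApos : 0 < A := by positivity
  -- The factor `1 ± δ` in the limit of the kernel sums may cost at most `ε / 4`.
  set δ := min (1 / 2) (ε / 4 * (A / G)) with hδ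
  have hδ0 : 0 < δ := by positivity
  have hδ1 : δ < 1 := (min_le_left _ _).trans_lt (by norm_num)
  have hδ2 : ∀ w : Theta d, δ * (g w / A) ≤ ε / 4 := by
    intro w
    have h1 : g w / A ≤ G / A := by
      gcongr
      exact hgG w
    calc δ * (g w / A) ≤ ε / 4 * (A / G) * (G / A) := by
          have := H.pos_on_sphere w.2
          gcongr
          exact min_le_right _ _
      _ = ε / 4 := by field_simp
  obtain ⟨η₁, hη₁, hη₁1, hup⟩ := exists_eventually_abs_sum_sub_le H hK hd hXmeas hXindep hXlaw hb
    hh hh0 hkc (x := 1 + δ) (by linarith) (show 0 < ε / 4 by positivity)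
  obtain ⟨η₂, hη₂, hη₂1, hlo⟩ := exists_eventually_abs_sum_sub_le H hK hd hXmeas hXindep hXlaw hb
    hh hh0 hkc (x := 1 - δ) (by linarith) (show 0 < ε / 4 by positivity)
  set η := min η₁ η₂ with hη
  have hη0 : 0 < η := by positivity
  have hη1 : η ≤ 1 := (min_le_left _ _).trans hη₁1
  obtain ⟨a, b, hb0, hnet⟩ := exists_sphere_net w₀
  choose! N hNcard hNcov using hnet
  have hcard : ∀ n, ((N (η * h n)).card : ℝ)
      ≤ Real.exp ((a + b * Real.log (1 / η)) + b * Real.log (1 / h n)) := by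
    intro n
    refine (hNcard _ (mul_pos hη0 (hh n).1) (by nlinarith [(hh n).1, (hh n).2])).trans
      (le_of_eq ?_)
    have : Real.log (1 / (η * h n)) = Real.log (1 / η) + Real.log (1 / h n) := by
      rw [← Real.log_mul (by positivity) (one_div_pos.2 (hh n).1).ne']
      congr 1
      field_simp
    rw [this]
    ring_nf
  obtain ⟨r, hr, hosc⟩ := H.exists_abs_limit_sub_le (show 0 < ε / 8 * A by positivity)
  filter_upwards [hup η (fun n => N (η * h n)) _ b (by rw [abs_of_pos hη0]; exact min_le_left _ _)
      hb0 hcard,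
    hlo (-η) (fun n => N (η * h n)) _ b
      (by rw [abs_neg, abs_of_pos hη0]; exact min_le_right _ _) hb0 hcard,
    eventually_threshold_lt_UHat H hd0 hXmeas hXindep hXlaw hb hδ0 hδ1,
    (tendsto_fst_aas μ).eventually hb.bounds,
    (tendsto_fst_aas μ).eventually (hh0.eventually_lt_const hr)] with p h1 h2 hU hk hhr w
  obtain ⟨hp0, hp1⟩ := hh p.1
  have hkp : (0 : ℝ) < k p.1 := by exact_mod_cast hk.1
  have hc := hK.kernelConst_pos hp0 w₀
  obtain ⟨v, hv, hwv⟩ := hNcov (η * h p.1) (mul_pos hη0 hp0) (by nlinarith) w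
  have hvr : ‖(v : E d) - w‖ < r := by
    rw [norm_sub_rev]
    nlinarith
  have hgv : |g v / A - g w / A| ≤ ε / 8 := by
    rw [← sub_div, abs_div, abs_of_pos hApos, div_le_iff₀ hApos]
    exact hosc v w hvr
  have e1 := (abs_le.1 (h1 v hv)).2
  have e2 := (abs_le.1 (h2 v hv)).1
  have e3 := abs_le.1 hgv
  have e4 := hδ2 w
  have hup' : psiHat K (h p.1) (k p.1) (fun i : Fin p.1 => X i p.2) w
      ≤ kernelConst K (h p.1) w₀ / k p.1 * (∑ i : Fin p.1, exceedKernel K (h p.1) η v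
            (threshold (tailMass g α) α p.1 (k p.1) (1 + δ)) (X i p.2)) := by
    rw [psiHat, kernelConst_eq K (h p.1) w w₀]
    gcongr
    exact kernel_le_exceedKernel hK hp0 hU.1.le hwv _
  have hlo' : kernelConst K (h p.1) w₀ / k p.1 * (∑ i : Fin p.1, exceedKernel K (h p.1) (-η) v
            (threshold (tailMass g α) α p.1 (k p.1) (1 - δ)) (X i p.2))
      ≤ psiHat K (h p.1) (k p.1) (fun i : Fin p.1 => X i p.2) w := by
    rw [psiHat, kernelConst_eq K (h p.1) w w₀]
    gcongr
    exact exceedKernel_le_kernel hK hp0 hU.2 hwv _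
  -- The budget: `ε / 4` at the net point, `δ * (g w / A) ≤ ε / 4`, and at most `(1 + δ) * ε / 8 ≤ ε
  -- / 4` for replacing `g v` by `g w`.
  rw [abs_le]
  constructor <;> nlinarith

end Sample

/-! ### The estimators as elements of the space of continuous functions -/

section Continuity

variable {d : ℕ} {K : ℝ → ℝ}

/-- The kernel argument is never negative, so `K` may be replaced by its continuous extension. This
makes `psiHat` a point of `C(Theta d, ℝ)`, whose norm expresses uniform consistency. -/
theorem continuous_psiHat (hK : IsKernel K) {n : ℕ} {h : ℝ} (hh : 0 < h) (k : ℕ)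
    (x : Fin n → E d) : Continuous (psiHat K h k x) := by
  classical
  rcases isEmpty_or_nonempty (Theta d) with he | ⟨⟨w₀⟩⟩
  · exact continuous_of_discreteTopology
  have heq : psiHat K h k x = fun w : Theta d => kernelConst K h w₀ / k *
      ∑ i, if UHat k x < ‖x i‖ then kernelExt K ((1 - ⟪(w : E d), ‖x i‖⁻¹ • x i⟫) / h) else 0 := by
    ext w
    rw [psiHat, kernelConst_eq K h w w₀]
    congr 1
    refine Finset.sum_congr rfl fun i _ => ?_
    split_ifs
    · rw [IsKernel.kernelExt_eq]
      refine div_nonneg (sub_nonneg.2 ((real_inner_le_norm _ _).trans ?_)) hh.le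
      rw [norm_theta, one_mul, norm_smul, norm_inv, norm_norm]
      exact inv_mul_le_one
    · rfl
  rw [heq]
  have := hK.continuous_kernelExt
  refine continuous_const.mul (continuous_finsetSum _ fun i _ => ?_)
  split_ifs
  · fun_prop
  · exact continuous_const

/-- The plug-in formula for the mass of the region `S`. -/
def plugInMass (a : ℝ) (φ : C(Theta d, ℝ)) : ℝ :=
  a ^ (-a / (a + d)) * ∫ w, φ w ^ ((d : ℝ) / (a + d)) ∂(surf d)

/-- Dominated convergence: the exponent `d / (a + d)` lies in `[0, 1]`, so near `(α, ψ)` the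
integrand is at most `‖ψ‖ + 1`. -/
theorem continuousAt_plugInMass {α : ℝ} (hα : 0 < α) (hd : 0 < d) (ψ : C(Theta d, ℝ))
    (hψ : ∀ w, 0 < ψ w) :
    ContinuousAt (fun x : ℝ × C(Theta d, ℝ) => plugInMass x.1 x.2) (α, ψ) := by
  have hd' : (0 : ℝ) < d := by exact_mod_cast hd
  unfold plugInMass
  refine ContinuousAt.mul ?_ ?_
  · refine ContinuousAt.rpow continuousAt_fst ?_ (Or.inl hα.ne')
    exact ContinuousAt.div (by fun_prop) (by fun_prop) (by positivity)
  · have ha : ∀ᶠ x : ℝ × C(Theta d, ℝ) in 𝓝 (α, ψ), 0 < x.1 :=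
      continuousAt_fst.eventually (lt_mem_nhds hα)
    have hφ : ∀ᶠ x : ℝ × C(Theta d, ℝ) in 𝓝 (α, ψ), ‖x.2‖ < ‖ψ‖ + 1 :=
      (continuous_norm.comp continuous_snd).continuousAt.eventually
        (gt_mem_nhds (lt_add_one ‖ψ‖))
    refine continuousAt_of_dominated (bound := fun _ => ‖ψ‖ + 1) ?_ ?_ (integrable_const _) ?_
    · refine Eventually.of_forall fun x => ?_
      have := x.2.continuous.measurable
      exact (by fun_prop : Measurable fun w => x.2 w ^ ((d : ℝ) / (x.1 + d))).aestronglyMeasurable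
    · filter_upwards [ha, hφ] with x hx1 hx2
      refine Eventually.of_forall fun w => ?_
      have he0 : 0 ≤ (d : ℝ) / (x.1 + d) := by positivity
      have he1 : (d : ℝ) / (x.1 + d) ≤ 1 := by
        rw [div_le_one (by positivity)]; linarith
      have h1 : 1 ≤ ‖ψ‖ + 1 := by linarith [norm_nonneg ψ]
      calc ‖x.2 w ^ ((d : ℝ) / (x.1 + d))‖ ≤ |x.2 w| ^ ((d : ℝ) / (x.1 + d)) :=
            Real.abs_rpow_le_abs_rpow _ _
        _ ≤ (‖ψ‖ + 1) ^ ((d : ℝ) / (x.1 + d)) := by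
            gcongr
            exact (x.2.norm_coe_le_norm w).trans hx2.le
        _ ≤ (‖ψ‖ + 1) ^ (1 : ℝ) := Real.rpow_le_rpow_of_exponent_le h1 he1
        _ = _ := Real.rpow_one _
    · refine Eventually.of_forall fun w => ?_
      refine ContinuousAt.rpow ?_ ?_ (Or.inl (hψ w).ne')
      · exact (by fun_prop : Continuous fun x : ℝ × C(Theta d, ℝ) => x.2 w).continuousAt
      · exact ContinuousAt.div (by fun_prop) (by fun_prop) (by positivity)

end Continuity

/-! ### Limits of the plug-in quantities and the sandwich for the estimated region. -/

namespace HomogeneousTail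

variable {d : ℕ} {P : Measure (E d)} {f g : E d → ℝ} {α : ℝ}

/-- The spectral density of the limit measure. -/
def spectralDensity (H : HomogeneousTail P f g α) : C(Theta d, ℝ) :=
  ⟨fun w => g w / (α * tailMass g α), H.continuous_sphere.div_const _⟩

theorem spectralDensity_apply (H : HomogeneousTail P f g α) (w : Theta d) :
    H.spectralDensity w = g w / (α * tailMass g α) := rfl

theorem spectralDensity_pos (H : HomogeneousTail P f g α) (hd : 0 < d) (w : Theta d) :
    0 < H.spectralDensity w :=
  div_pos (H.pos_on_sphere w.2) (mul_pos H.alpha_pos (H.tailMass_pos hd))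

theorem plugInMass_spectralDensity (H : HomogeneousTail P f g α) (hd : 0 < d) :
    plugInMass α H.spectralDensity
      = tailMass g α ^ (-((d : ℝ) / (d + α))) * levelMass g α := by
  have hα := H.alpha_pos
  have hC := H.tailMass_pos hd
  have hdα := H.dim_add_pos
  have h1 : ∀ w : Theta d, H.spectralDensity w ^ ((d : ℝ) / (α + d))
      = (α * tailMass g α) ^ (-((d : ℝ) / (d + α))) * g w ^ ((d : ℝ) / (d + α)) := by
    intro w
    have hg := H.pos_on_sphere w.2
    rw [spectralDensity_apply, Real.div_rpow hg.le (by positivity), Real.rpow_neg (by positivity),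
      add_comm α]
    field_simp
  rw [plugInMass, levelMass]
  simp_rw [h1]
  rw [integral_const_mul, Real.mul_rpow hα.le hC.le]
  have h2 : α ^ (-α / (α + d)) * α ^ (-((d : ℝ) / (d + α))) = α⁻¹ := by
    rw [← Real.rpow_add hα, ← Real.rpow_neg_one]
    congr 1
    rw [add_comm α]
    field_simp
    ring
  rw [← h2]
  ring

/-- The limiting normalization is the right one. -/
theorem normalization_eq (H : HomogeneousTail P f g α) (hd : 0 < d) :
    tailMass g α ^ (1 / α) * 1 * plugInMass α H.spectralDensity ^ (1 / α)
      * levelMass g α ^ (-(1 / α)) = tailMass g α ^ (1 / (d + α)) := by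
  have hα := H.alpha_pos
  have hC := H.tailMass_pos hd
  have hM := H.levelMass_pos hd
  have hdα := H.dim_add_pos
  rw [H.plugInMass_spectralDensity hd, Real.mul_rpow (by positivity) hM.le,
    ← Real.rpow_mul hC.le, mul_one, mul_assoc, mul_assoc, ← Real.rpow_add hM, add_neg_cancel,
    Real.rpow_zero, mul_one, ← Real.rpow_add hC]
  congr 1
  field_simp
  ring

/-- The value of `g` at the points of the boundary of the rescaled estimated risk region, as a
function of the scale `D`, the index `a` and the spectral density `φ`. -/
theorem eventually_boundary (H : HomogeneousTail P f g α) (hd : 0 < d) {ε : ℝ} (hε : 0 < ε) :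
    ∀ᶠ x : ℝ × ℝ × C(Theta d, ℝ) in 𝓝 (tailMass g α ^ (1 / (d + α)), α, H.spectralDensity),
      ∀ w : Theta d, (0 < x.1 ∧ 0 < (x.2.1 * x.2.2 w) ^ (1 / (x.2.1 + d))) ∧
        |g w * (x.1 * (x.2.1 * x.2.2 w) ^ (1 / (x.2.1 + d))) ^ (-(d + α)) - 1| < ε := by
  have hα := H.alpha_pos
  have hC := H.tailMass_pos hd
  have hdα := H.dim_add_pos
  -- Joint continuity in the parameters and the direction, with compactness of the sphere, makes the
  -- estimate uniform in `w`.
  have hmain := (isCompact_univ (X := Theta d)).eventually_forall_of_forall_eventually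
    (x₀ := (tailMass g α ^ (1 / (d + α)), α, H.spectralDensity))
    (P := fun x w => (0 < x.1 ∧ 0 < (x.2.1 * x.2.2 w) ^ (1 / (x.2.1 + d))) ∧
        |g w * (x.1 * (x.2.1 * x.2.2 w) ^ (1 / (x.2.1 + d))) ^ (-(d + α)) - 1| < ε) ?_
  · simpa using hmain
  intro w _
  have hψ := H.spectralDensity_pos hd w
  have hg := H.pos_on_sphere w.2
  set z₀ : (ℝ × ℝ × C(Theta d, ℝ)) × Theta d :=
    ((tailMass g α ^ (1 / (d + α)), α, H.spectralDensity), w) with hz₀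
  have hev : ContinuousAt (fun z : (ℝ × ℝ × C(Theta d, ℝ)) × Theta d => z.1.2.2 z.2) z₀ := by
    fun_prop
  have hbase : ContinuousAt (fun z : (ℝ × ℝ × C(Theta d, ℝ)) × Theta d =>
      (z.1.2.1 * z.1.2.2 z.2) ^ (1 / (z.1.2.1 + d))) z₀ := by
    refine ContinuousAt.rpow (ContinuousAt.mul (by fun_prop) hev) ?_
      (Or.inl (mul_pos hα hψ).ne')
    exact ContinuousAt.div (by fun_prop) (by fun_prop) (by simp only [hz₀]; positivity)
  have hpos : 0 < (α * H.spectralDensity w) ^ (1 / (α + d)) := by positivity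
  have hD : 0 < tailMass g α ^ (1 / (d + α)) := by positivity
  have hgc : ContinuousAt (fun z : (ℝ × ℝ × C(Theta d, ℝ)) × Theta d => g z.2) z₀ :=
    (H.continuous_sphere.comp continuous_snd).continuousAt
  have hF : ContinuousAt (fun z : (ℝ × ℝ × C(Theta d, ℝ)) × Theta d =>
      g z.2 * (z.1.1 * (z.1.2.1 * z.1.2.2 z.2) ^ (1 / (z.1.2.1 + d))) ^ (-(d + α))) z₀ := by
    refine hgc.mul (ContinuousAt.rpow_const (ContinuousAt.mul (by fun_prop) hbase) (Or.inl ?_))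
    exact (mul_pos hD hpos).ne'
  -- At the limit parameters the boundary radius is `(tailMass * α * ψ w) ^ (1 / (d + α)) = g w ^ (1
  -- / (d + α))`, exactly where `g` equals one on the ray.
  have hval : g w * (tailMass g α ^ (1 / (d + α))
      * (α * H.spectralDensity w) ^ (1 / (α + d))) ^ (-(d + α)) = 1 := by
    rw [add_comm α, ← Real.mul_rpow hC.le (by positivity), ← Real.rpow_mul (by positivity),
      spectralDensity_apply,
      show tailMass g α * (α * (g w / (α * tailMass g α))) = g w by field_simp,
      show 1 / ((d : ℝ) + α) * -(d + α) = -1 by field_simp, Real.rpow_neg_one,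
      mul_inv_cancel₀ hg.ne']
  have h1 : ∀ᶠ z in 𝓝 z₀, 0 < z.1.1 :=
    (by fun_prop : ContinuousAt (fun z : (ℝ × ℝ × C(Theta d, ℝ)) × Theta d => z.1.1)
      z₀).eventually (lt_mem_nhds hD)
  have h2 := hbase.eventually (lt_mem_nhds hpos)
  have h3 := (Metric.tendsto_nhds.1 hF.tendsto) ε hε
  simp only [hz₀, hval, Real.dist_eq] at h3
  filter_upwards [h1, h2, h3] with z hz1 hz2 hz3
  exact ⟨⟨hz1, hz2⟩, hz3⟩

end HomogeneousTail

/-- The scale factor of the estimated risk region. -/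
def scaleHat (K : ℝ → ℝ) (h : ℝ) (k : ℕ) (p a : ℝ) {n : ℕ} (x : Fin n → E d) : ℝ :=
  UHat k x * (k * nuSHat K h k a x / (n * p)) ^ (1 / a)

open HomogeneousTail in
/-- The estimated risk region lies between sublevel sets of the limiting density. -/
theorem HomogeneousTail.QHat_between {d : ℕ} {P : Measure (E d)} {f g : E d → ℝ} {α : ℝ}
    {K : ℝ → ℝ} (H : HomogeneousTail P f g α) {n : ℕ} {h' p' a b ε : ℝ} {k' : ℕ}
    {x : Fin n → E d} (hb : 0 < b)
    (hx : ∀ w : Theta d, (0 < scaleHat K h' k' p' a x * b ^ (1 / (d + α)) ∧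
        0 < (a * psiHat K h' k' x w) ^ (1 / (a + d))) ∧
      |g w * (scaleHat K h' k' p' a x * b ^ (1 / (d + α))
        * (a * psiHat K h' k' x w) ^ (1 / (a + d))) ^ (-(d + α)) - 1| < ε) :
    level g (b * (1 - ε)) ⊆ QHat K h' k' p' a x ∧ QHat K h' k' p' a x ⊆ level g (b * (1 + ε)) := by
  have hdα := H.dim_add_pos
  have hQ : QHat K h' k' p' a x = scaleHat K h' k' p' a x • SHat K h' k' a x := rfl
  rw [hQ]
  set s := scaleHat K h' k' p' a x
  have hbp : 0 < b ^ (1 / (d + α)) := by positivity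
  have key : ∀ w : Theta d, 0 < s ∧ 0 < (a * psiHat K h' k' x w) ^ (1 / (a + d)) ∧
      b * (1 - ε) < g w * (s * (a * psiHat K h' k' x w) ^ (1 / (a + d))) ^ (-(d + α)) ∧
      g w * (s * (a * psiHat K h' k' x w) ^ (1 / (a + d))) ^ (-(d + α)) < b * (1 + ε) := by
    intro w
    obtain ⟨⟨h1, h2⟩, h3⟩ := hx w
    have hs : 0 < s := pos_of_mul_pos_left h1 hbp.le
    set y := (a * psiHat K h' k' x w) ^ (1 / (a + d))
    -- By homogeneity the factor `b ^ (1 / (d + α))` turns the level `b` into the level `1`.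
    have h4 : g w * (s * b ^ (1 / (d + α)) * y) ^ (-(d + α))
        = g w * (s * y) ^ (-(d + α)) / b := by
      rw [mul_right_comm, Real.mul_rpow (by positivity) hbp.le, ← Real.rpow_mul hb.le,
        show 1 / ((d : ℝ) + α) * -(d + α) = -1 by field_simp, Real.rpow_neg_one]
      field_simp
    rw [h4, abs_lt, sub_lt_iff_lt_add, lt_sub_iff_add_lt, lt_div_iff₀ hb, div_lt_iff₀ hb] at h3
    refine ⟨hs, h2, ?_, ?_⟩ <;> linarith [h3.1, h3.2]
  constructor
  · intro z hz
    have hn := norm_pos_iff.2 hz.1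
    let w : Theta d := ⟨‖z‖⁻¹ • z, norm_inv_smul_mem_sphere hz.1⟩
    obtain ⟨hs, hy, h1, -⟩ := key w
    set y := (a * psiHat K h' k' x w) ^ (1 / (a + d)) with hydef
    have hg := H.pos_on_sphere w.2
    have h2 := hz.2
    rw [H.homogeneous z hz.1] at h2
    have h3 : s * y < ‖z‖ := by
      by_contra hc
      have h4 : (s * y) ^ (-(d + α)) ≤ ‖z‖ ^ (-(d + α)) :=
        Real.rpow_le_rpow_of_nonpos hn (not_lt.1 hc) (by linarith)
      have h5 : g w * (s * y) ^ (-(d + α)) ≤ g w * ‖z‖ ^ (-(d + α)) := by gcongr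
      have h6 : ‖z‖ ^ (-(d + α)) * g w < b * (1 - ε) := h2
      linarith
    refine mem_smul_set.2 ⟨(‖z‖ / s) • (w : E d), ⟨‖z‖ / s, w, ?_, rfl⟩, ?_⟩
    · rw [← hydef, le_div_iff₀ hs, mul_comm]
      exact h3.le
    · rw [smul_smul, mul_div_cancel₀ _ hs.ne', smul_smul, mul_inv_cancel₀ hn.ne', one_smul]
  · intro z hz
    obtain ⟨_, ⟨r, w, hr, rfl⟩, rfl⟩ := mem_smul_set.1 hz
    obtain ⟨hs, hy, -, h1⟩ := key w
    set y := (a * psiHat K h' k' x w) ^ (1 / (a + d))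
    have hr0 : 0 < r := hy.trans_le hr
    have hg := H.pos_on_sphere w.2
    rw [smul_smul]
    obtain ⟨h2, h3⟩ := normalize_smul (mul_pos hs hr0) w
    have hz0 : (s * r) • (w : E d) ≠ 0 := norm_pos_iff.1 (by rw [h2]; positivity)
    refine ⟨hz0, ?_⟩
    rw [H.homogeneous _ hz0, h3, h2, mul_comm]
    refine lt_of_le_of_lt ?_ h1
    refine mul_le_mul_of_nonneg_left ?_ hg.le
    exact Real.rpow_le_rpow_of_nonpos (by positivity) (by gcongr) (by linarith)

/-! ### Convergence of the normalization of the estimated region -/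

section Sample

variable {d : ℕ} {Ω : Type*} [MeasurableSpace Ω] {μ : Measure Ω} [IsProbabilityMeasure μ]
  {P : Measure (E d)} [IsProbabilityMeasure P] {f g : E d → ℝ} {α : ℝ}
  {X : ℕ → Ω → E d} {k : ℕ → ℕ} {K : ℝ → ℝ} {h : ℕ → ℝ} {w₀ : Theta d}
  {p β : ℕ → ℝ} {αhat : ℕ → Ω → ℝ}

open HomogeneousTail

theorem tendsto_inv_sqrt (hb : IntermediateSeq k) :
    Tendsto (fun n => (√(k n : ℝ))⁻¹) atTop (𝓝 0) :=
  tendsto_inv_atTop_zero.comp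
    (Real.tendsto_sqrt_atTop.comp (tendsto_natCast_atTop_atTop.comp hb.tendsto))

theorem tendsto_alphaHat (hb : IntermediateSeq k)
    (hα : BoundedInProb μ (fun n ω => √(k n : ℝ) * (αhat n ω - α))) :
    Tendsto (fun x : ℕ × Ω => αhat x.1 x.2) (aas μ) (𝓝 α) := by
  have h1 := (hα.tendsto_mul_aas (tendsto_inv_sqrt hb)).add_const α
  rw [zero_add] at h1
  refine h1.congr' ?_
  filter_upwards [(tendsto_fst_aas μ).eventually hb.bounds] with x hx
  have : 0 < √(k x.1 : ℝ) := Real.sqrt_pos.2 (by exact_mod_cast hx.1)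
  field_simp
  ring

/-- The logarithm equals `-√k (αhat - α) * ((log k - log (n p)) / √k) / (αhat α)`: a
bounded-in-probability factor, a vanishing one and a convergent one. -/
theorem tendsto_rpow_inv_sub_inv (hb : IntermediateSeq k) (hα0 : 0 < α) (hppos : ∀ n, 0 < p n)
    (hα : BoundedInProb μ (fun n ω => √(k n : ℝ) * (αhat n ω - α)))
    (hlog : Tendsto (fun n : ℕ => Real.log (n * p n) / √(k n : ℝ)) atTop (𝓝 0)) :
    Tendsto (fun x : ℕ × Ω => ((k x.1 : ℝ) / (x.1 * p x.1)) ^ (1 / αhat x.1 x.2 - 1 / α))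
      (aas μ) (𝓝 1) := by
  have hlogk : Tendsto (fun n => Real.log (k n) / √(k n : ℝ)) atTop (𝓝 0) := by
    have h1 : Tendsto (fun x : ℝ => Real.log x / √x) atTop (𝓝 0) := by
      simp_rw [Real.sqrt_eq_rpow]
      exact (isLittleO_log_rpow_atTop (by norm_num : (0 : ℝ) < 1 / 2)).tendsto_div_nhds_zero
    exact h1.comp (tendsto_natCast_atTop_atTop.comp hb.tendsto)
  have h2 := hα.tendsto_mul_aas (hlogk.sub hlog |>.trans (by rw [sub_zero]))
  have hαhat := tendsto_alphaHat hb hα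
  have h3 := h2.mul (((hαhat.mul_const α).inv₀ (mul_pos hα0 hα0).ne').neg)
  rw [zero_mul] at h3
  have h4 := (Real.continuous_exp.tendsto 0).comp h3
  rw [Real.exp_zero] at h4
  refine h4.congr' ?_
  filter_upwards [(tendsto_fst_aas μ).eventually hb.bounds,
    hαhat.eventually (lt_mem_nhds hα0)] with x hx ha
  have hk : (0 : ℝ) < k x.1 := by exact_mod_cast hx.1
  have hn : (0 : ℝ) < x.1 := by exact_mod_cast hx.1.trans hx.2
  have hp := hppos x.1
  have hs : 0 < √(k x.1 : ℝ) := Real.sqrt_pos.2 hk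
  simp only [Function.comp_apply]
  rw [Real.rpow_def_of_pos (by positivity), Real.log_div hk.ne' (by positivity)]
  congr 1
  field_simp
  ring

/-- The estimator of the spectral density, as a random continuous function. -/
def psiHatMap (hK : IsKernel K) (hh : ∀ n, 0 < h n ∧ h n < 1) (k : ℕ → ℕ) (X : ℕ → Ω → E d)
    (x : ℕ × Ω) : C(Theta d, ℝ) :=
  ⟨psiHat K (h x.1) (k x.1) (fun i : Fin x.1 => X i x.2), continuous_psiHat hK (hh x.1).1 _ _⟩

/-- The normalized scale factors into the order statistic over `(n / k) ^ (1 / α)`, the power with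
exponent `1 / αhat - 1 / α`, the plug-in mass to the power `1 / αhat`, and `(p / β ^ (α / (d + α)))
^ (-1 / α)`. The remaining powers of `n`, `k` and `p` cancel. -/
theorem tendsto_scaleHat (H : HomogeneousTail P f g α) (hK : IsKernel K) (hd : 0 < d)
    (hh : ∀ n, 0 < h n ∧ h n < 1)
    (hXmeas : ∀ i, Measurable (X i)) (hXindep : iIndepFun X μ) (hXlaw : ∀ i, μ.map (X i) = P)
    (hb : IntermediateSeq k) (hppos : ∀ n, 0 < p n) (hβ0 : Tendsto β atTop (𝓝[>] 0))
    (hβ : ∀ n, P.real (riskRegion f (β n)) = p n)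
    (hα : BoundedInProb μ (fun n ω => √(k n : ℝ) * (αhat n ω - α)))
    (hlog : Tendsto (fun n : ℕ => Real.log (n * p n) / √(k n : ℝ)) atTop (𝓝 0))
    (hψ : Tendsto (psiHatMap hK hh k X) (aas μ) (𝓝 H.spectralDensity)) :
    Tendsto (fun x : ℕ × Ω => scaleHat K (h x.1) (k x.1) (p x.1) (αhat x.1 x.2)
        (fun i : Fin x.1 => X i x.2) * β x.1 ^ (1 / (d + α))) (aas μ)
      (𝓝 (tailMass g α ^ (1 / (d + α)))) := by
  have hα0 := H.alpha_pos
  have hC := H.tailMass_pos hd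
  have hM := H.levelMass_pos hd
  have hdα := H.dim_add_pos
  have hαhat := tendsto_alphaHat hb hα
  have hν : Tendsto (fun x : ℕ × Ω => plugInMass (αhat x.1 x.2) (psiHatMap hK hh k X x)) (aas μ)
      (𝓝 (plugInMass α H.spectralDensity)) :=
    (continuousAt_plugInMass hα0 hd _ (H.spectralDensity_pos hd)).tendsto.comp
      (hαhat.prodMk_nhds hψ)
  have hν0 : 0 < plugInMass α H.spectralDensity := by
    rw [H.plugInMass_spectralDensity hd]
    positivity
  have hνpow := hν.rpow ((tendsto_const_nhds (x := (1 : ℝ))).div hαhat hα0.ne')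
    (Or.inl hν0.ne')
  have hpβ : Tendsto (fun n => (p n / β n ^ (α / (d + α))) ^ (-(1 / α))) atTop
      (𝓝 (levelMass g α ^ (-(1 / α)))) := by
    refine Tendsto.rpow_const ?_ (Or.inl hM.ne')
    refine ((H.tendsto_real_riskRegion hd).comp hβ0).congr fun n => ?_
    rw [Function.comp_apply, hβ]
  have hmain := (((tendsto_UHat H hd hXmeas hXindep hXlaw hb).mul
    (tendsto_rpow_inv_sub_inv hb hα0 hppos hα hlog)).mul hνpow).mul
      (hpβ.comp (tendsto_fst_aas μ))
  rw [H.normalization_eq hd] at hmain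
  refine hmain.congr' ?_
  filter_upwards [(tendsto_fst_aas μ).eventually hb.bounds,
    (tendsto_fst_aas μ).eventually (hβ0.eventually self_mem_nhdsWithin),
    hν.eventually (lt_mem_nhds hν0)] with x hx hβx hνx
  have hk : (0 : ℝ) < k x.1 := by exact_mod_cast hx.1
  have hn : (0 : ℝ) < x.1 := by exact_mod_cast hx.1.trans hx.2
  have hp := hppos x.1
  have hβx' : 0 < β x.1 := hβx
  set a := αhat x.1 x.2
  set ν := plugInMass a (psiHatMap hK hh k X x) with hνdef
  have hnu : nuSHat K (h x.1) (k x.1) a (fun i : Fin x.1 => X i x.2) = ν := rfl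
  have h1 : (k x.1 * ν / (x.1 * p x.1)) ^ (1 / a) = (k x.1 / (x.1 * p x.1)) ^ (1 / a - 1 / α)
      * (k x.1 ^ (1 / α) / (x.1 ^ (1 / α) * p x.1 ^ (1 / α))) * ν ^ (1 / a) := by
    rw [mul_div_right_comm, Real.mul_rpow (by positivity) hνx.le, ← Real.mul_rpow hn.le hp.le,
      ← Real.div_rpow hk.le (by positivity), ← Real.rpow_add (by positivity), sub_add_cancel]
  have h2 : (p x.1 / β x.1 ^ (α / (d + α))) ^ (-(1 / α))
      = β x.1 ^ (1 / (d + α)) / p x.1 ^ (1 / α) := by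
    rw [Real.div_rpow hp.le (by positivity), ← Real.rpow_mul hβx'.le,
      show α / ((d : ℝ) + α) * -(1 / α) = -(1 / (d + α)) by field_simp,
      Real.rpow_neg hβx'.le, div_inv_eq_mul, Real.rpow_neg hp.le, inv_mul_eq_div]
  simp only [Function.comp_apply, Pi.div_apply]
  rw [scaleHat, hnu, h1, h2, Real.div_rpow hn.le hk.le]
  have e1 : (k x.1 : ℝ) ^ (1 / α) ≠ 0 := by positivity
  have e2 : (x.1 : ℝ) ^ (1 / α) ≠ 0 := by positivity
  have e3 : p x.1 ^ (1 / α) ≠ 0 := by positivity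
  generalize ((k x.1 : ℝ) / (x.1 * p x.1)) ^ (1 / a - 1 / α) = y
  generalize (k x.1 : ℝ) ^ (1 / α) = y₁ at *
  generalize (x.1 : ℝ) ^ (1 / α) = y₂ at *
  generalize p x.1 ^ (1 / α) = y₃ at *
  field_simp
  rfl

/-- Subadditivity alone suffices, so the estimated region need not be shown measurable. -/
theorem abs_measureReal_sub_le_symmDiff (s t : Set (E d)) :
    |P.real s - P.real t| ≤ P.real (s ∆ t) := by
  have h1 : P.real s ≤ P.real t + P.real (s ∆ t) := by
    refine (measureReal_mono ?_).trans (measureReal_union_le _ _)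
    intro z hz
    by_cases hzt : z ∈ t
    · exact Or.inl hzt
    · exact Or.inr (Or.inl ⟨hz, hzt⟩)
  have h2 : P.real t ≤ P.real s + P.real (s ∆ t) := by
    refine (measureReal_mono ?_).trans (measureReal_union_le _ _)
    intro z hz
    by_cases hzs : z ∈ s
    · exact Or.inl hzs
    · exact Or.inr (Or.inr ⟨hz, hzs⟩)
  rw [abs_le]
  constructor <;> linarith

/-- The relative probability of the shell between two sublevel sets is small. -/
theorem HomogeneousTail.exists_shell_lt (H : HomogeneousTail P f g α) (hd : 0 < d)
    (hβ0 : Tendsto β atTop (𝓝[>] 0)) (hβ : ∀ n, P.real (riskRegion f (β n)) = p n)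
    {δ : ℝ} (hδ : 0 < δ) : ∃ ε, 0 < ε ∧ ε < 1 ∧ ∀ᶠ n in atTop,
      (P.real (level g (β n * (1 + ε))) - P.real (level g (β n * (1 - ε)))) / p n < δ := by
  have hM := H.levelMass_pos hd
  have hcont : Tendsto (fun ε : ℝ => (1 + ε) ^ (α / (d + α)) - (1 - ε) ^ (α / (d + α)))
      (𝓝[>] 0) (𝓝 0) := by
    have : ContinuousAt (fun ε : ℝ => (1 + ε) ^ (α / (d + α)) - (1 - ε) ^ (α / (d + α))) 0 :=
      (ContinuousAt.rpow_const (by fun_prop) (Or.inl (by simp))).sub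
        (ContinuousAt.rpow_const (by fun_prop) (Or.inl (by simp)))
    have h2 := this.tendsto.mono_left (nhdsWithin_le_nhds (s := Ioi 0))
    simpa using h2
  obtain ⟨ε, h1, h2, h3⟩ := ((hcont.eventually_lt_const hδ).and
    ((eventually_nhdsWithin_of_eventually_nhds (eventually_lt_nhds one_pos)).and
      (eventually_mem_nhdsWithin (s := Ioi 0)))).exists
  have h3' : 0 < ε := h3
  refine ⟨ε, h3', h2, ?_⟩
  -- After division by the asymptotics of `p n`, the factor `levelMass` cancels and the limit is `(1
  -- + ε) ^ (α / (d + α)) - (1 - ε) ^ (α / (d + α))`, which is below `δ` by the choice of `ε`.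
  have hup := (H.tendsto_real_level_mul hd (x := 1 + ε) (by linarith)).comp hβ0
  have hlo := (H.tendsto_real_level_mul hd (x := 1 - ε) (by linarith)).comp hβ0
  have hp := (H.tendsto_real_riskRegion hd).comp hβ0
  have hlim := (hup.sub hlo).div hp hM.ne'
  rw [← mul_sub, mul_div_cancel_left₀ _ hM.ne'] at hlim
  filter_upwards [hlim.eventually_lt_const h1, hβ0.eventually self_mem_nhdsWithin] with n hn hβn
  have hβn' : 0 < β n := hβn
  have hpow : 0 < β n ^ (α / (d + α)) := by positivity
  simp only [Pi.div_apply, Function.comp_apply, hβ] at hn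
  rwa [← sub_div, div_div_div_cancel_right₀ hpow.ne'] at hn

end Sample

end ExtremeRisk

end

/-! ### The main theorem. -/

theorem theorem1 {d : ℕ} (hd : 2 ≤ d)
    {Ω : Type*} [MeasurableSpace Ω] (μ : Measure Ω) [IsProbabilityMeasure μ]
    -- condition (a)
    (P : Measure (E d)) (f q : E d → ℝ) (V : ℝ → ℝ) (α : ℝ)
    (ha : RegularlyVaryingDensity P f q V α)
    -- the random sample `X 0, …, X (n - 1)` from `P`
    (X : ℕ → Ω → E d) (hXmeas : ∀ i, Measurable (X i)) (hXindep : iIndepFun X μ)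
    (hXlaw : ∀ i, μ.map (X i) = P)
    -- condition (b)
    (k : ℕ → ℕ) (hb : IntermediateSeq k)
    -- condition (c)
    (c : ℝ) (hcpos : 0 < c)
    (hc : Tendsto (fun t : ℝ => tailQuantile P t / t ^ (1 / α)) atTop (𝓝 c))
    -- the target probabilities and the risk regions `Q_n = {f ≤ β_n}` with `P(Q_n) = p_n`
    (p β : ℕ → ℝ) (hppos : ∀ n, 0 < p n) (hp : Tendsto p atTop (𝓝 0))
    (hβ : ∀ n, P.real (riskRegion f (β n)) = p n)
    -- the estimator of `α`
    (αhat : ℕ → Ω → ℝ) (hαmeas : ∀ n, Measurable (αhat n))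
    (hα : BoundedInProb μ (fun n ω => √(k n : ℝ) * (αhat n ω - α)))
    (hlog : Tendsto (fun n : ℕ => Real.log (n * p n) / √(k n : ℝ)) atTop (𝓝 0))
    -- kernel and bandwidth; `c(h, K)` does not depend on the point `w₀`
    (K : ℝ → ℝ) (hK : IsKernel K)
    (h : ℕ → ℝ) (hh : ∀ n, 0 < h n ∧ h n < 1) (hh0 : Tendsto h atTop (𝓝 0))
    (w₀ : Theta d)
    (hkc : Tendsto (fun n => (k n : ℝ) / (kernelConst K (h n) w₀ * Real.log (k n)))
      atTop atTop) :
    TendstoInMeasure μ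
      (fun n ω => P.real
        (QHat K (h n) (k n) (p n) (αhat n ω) (fun i : Fin n => X i ω) ∆ riskRegion f (β n)) / p n)
      atTop (fun _ => 0) ∧
    TendstoInMeasure μ
      (fun n ω => P.real
        (QHat K (h n) (k n) (p n) (αhat n ω) (fun i : Fin n => X i ω)) / p n)
      atTop (fun _ => 1) := by
  have hd0 : 0 < d := by omega
  have hPprob : IsProbabilityMeasure P := by
    rw [← hXlaw 0]
    exact Measure.isProbabilityMeasure_map (hXmeas 0).aemeasurable
  have hPopen := isOpenPosMeasure_of_density ha.density ha.continuous ha.pos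
  obtain ⟨g, H⟩ := ha.exists_homogeneousTail hd0 (Real.rpow_pos_of_pos hcpos α)
    (tendsto_rpow_mul_tail hd0 ha.alpha_pos hcpos hc)
  have hβ0 := H.tendsto_threshold hd0 hppos hp hβ
  have hψ : Tendsto (psiHatMap hK hh k X) (aas μ) (𝓝 H.spectralDensity) := by
    rw [Metric.tendsto_nhds]
    intro ε hε
    filter_upwards [eventually_abs_psiHat_sub_le H hK hd hXmeas hXindep hXlaw hb hh hh0 hkc
      (half_pos hε)] with x hx
    exact ((ContinuousMap.dist_le (half_pos hε).le).2 hx).trans_lt (half_lt_self hε)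
  have hall := (tendsto_scaleHat H hK hd0 hh hXmeas hXindep hXlaw hb hppos hβ0 hβ hα hlog
    hψ).prodMk_nhds ((tendsto_alphaHat hb hα).prodMk_nhds hψ)
  have hfirst : Tendsto (fun x : ℕ × Ω => P.real (QHat K (h x.1) (k x.1) (p x.1) (αhat x.1 x.2)
      (fun i : Fin x.1 => X i x.2) ∆ riskRegion f (β x.1)) / p x.1) (aas μ) (𝓝 0) := by
    rw [tendsto_order]
    refine ⟨fun a ha => Eventually.of_forall fun x => ha.trans_le ?_, fun δ hδ => ?_⟩
    · exact div_nonneg measureReal_nonneg (hppos _).le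
    obtain ⟨ε, hε, hε1, hshell⟩ := H.exists_shell_lt hd0 hβ0 hβ hδ
    filter_upwards [hall.eventually (H.eventually_boundary hd0 hε),
      (tendsto_fst_aas μ).eventually hshell,
      (tendsto_fst_aas μ).eventually (hβ0.eventually self_mem_nhdsWithin),
      (tendsto_fst_aas μ).eventually (hβ0.eventually (H.eventually_riskRegion_subset hε hε1))]
      with x h1 h2 h3 h4
    -- Both regions contain the inner level set and lie in the outer one, so their symmetric
    -- difference is contained in the shell; only the level sets have to be measurable.
    obtain ⟨h5, h6⟩ := H.QHat_between h3 h1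
    refine lt_of_le_of_lt ?_ h2
    refine div_le_div_of_nonneg_right ?_ (hppos _).le
    rw [← measureReal_sdiff (h5.trans h6) (H.measurableSet_level _)]
    refine measureReal_mono ?_
    rintro z (⟨hz1, hz2⟩ | ⟨hz1, hz2⟩)
    · exact ⟨h6 hz1, fun hz => hz2 (h4.1 hz)⟩
    · exact ⟨h4.2 hz1, fun hz => hz2 (h5 hz)⟩
  refine ⟨tendstoInMeasure_of_aas hfirst, tendstoInMeasure_of_aas ?_⟩
  rw [tendsto_iff_dist_tendsto_zero]
  refine squeeze_zero (fun _ => dist_nonneg) (fun x => ?_) hfirst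
  have hpx := hppos x.1
  rw [Real.dist_eq, div_sub_one hpx.ne', abs_div, abs_of_pos hpx]
  refine div_le_div_of_nonneg_right ?_ hpx.le
  nth_rewrite 2 [← hβ x.1]
  exact abs_measureReal_sub_le_symmDiff _ _
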